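/- Let $\pi:E\to M$ be a smooth fibre bundle with $n:=\dim M\ge 1$, let $l\ge 0$, put $J^k:=J^k\pi$, and let $\mathscr L$ be a Lagrangian density of order $l+1$, i.e. a smooth section over $J^{l+1}$ of the pull-back of $\Lambda^nT^*M$, regarded as a horizontal $n$-form on $J^{l+1}$. Let $J^\dagger\to J^l$ be the vector bundle with fibre $V_\theta^*J^l\otimes\Lambda^{n-1}T^*_xM$ over $\theta\in J^l$ ($x=\pi_l(\theta)$, $V_\theta J^l=\ker d_\theta\pi_l$), with projections $\tau_0^\dagger:J^\dagger\to J^l$ and $\tau^\dagger:J^\dagger\to M$, and let $W:=\pi_{l+1,l}^\circ(J^\dagger)=J^{l+1}\times_{J^l}J^\dagger$, with projection $\mathfrak p:W\to J^{l+1}$. Points of the first jet bundle $J^1\xi$ of a fibred manifold $\xi:P\to M$ are identified with pairs $(y,z)$, $y\in P$, $z:T_{\xi(y)}M\to T_yP$ a right inverse of $d_y\xi$. The Cartan embedding is $\mathscr C:J^{l+1}\to J^1\pi_l$, $(j_{l+1}s)(x)\mapsto j_1(j_ls)(x)$. For $z\in J^1\pi_l$ over $\theta\in J^l$ let $e_z:J^\dagger_\theta\to\Lambda^nT^*_\theta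 J^l$ be the linear map $e_z(p)(u_1,\dots,u_n)=\sum_{i}(-1)^{i-1}\,p\bigl(u_i-z(d\pi_l u_i)\bigr)\bigl(d\pi_lu_1,\dots,\widehat{d\pi_lu_i},\dots,d\pi_lu_n\bigr)$. For $w=(\vartheta,p)\in W$ over $\theta=\pi_{l+1,l}(\vartheta)$ let $h(w):=e_{\mathscr C(\vartheta)}(p)$ and let $\mathbb L(w)$ be the horizontal $n$-covector $\mathscr L(\vartheta)$ pulled back to $T_\theta J^l$; these are values of maps $h,\mathbb L$ from $W$ to the bundle $\mathscr M\subset\Lambda^nT^*J^l$ of $n$-covectors which vanish on any two vertical vectors. Let $\Theta$ be the tautological $n$-form of $\mathscr M$, and let $\theta':=h^*\Theta+\mathfrak p^*\mathscr L$, an $n$-form on $W$. For an $(n+1)$-form $\Omega$ on $P$ and $y\in P$, where $\xi:P\to M$, let $\operatorname{Ker}\Omega|_y$ be the set of the $z\in J^1\xi$ at $y$ such that $\Omega(v,z(u_1),\dots,z(u_n))=0$ for all $v\in\ker d_y\xi$ and all $u_1,\dots,u_n\in T_{\xi(y)}M$. Let $\mathscr P:=\{w\in W:\operatorname{Ker}d\theta'|_w\ne\varnothing\}$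 be the first constraint submanifold of $d\theta'$. Assume that $\mathscr L$ is hyperregular, i.e. that $\mathscr P\to J^\dagger$ is a diffeomorphism. Let $\mathfrak s:J^\dagger\to W$ be its inverse followed by the inclusion $\mathscr P\subset W$, $\mathsf{leg}^{-1}:=\mathfrak p\circ\mathfrak s:J^\dagger\to J^{l+1}$ the inverse Legendre transform, $\omega:=d(\mathfrak s^*\theta')$, and $\mathscr H:=(h+\mathbb L)\circ\mathfrak s:J^\dagger\to\mathscr M$ the Hamiltonian section. Define $\mathbb F\mathscr H:J^\dagger\to J^1\pi_l$ by $\mathbb F\mathscr H(P):=(\tau_0^\dagger)_{[1]}(z)=d\tau_0^\dagger\circ z$ for $z\in\operatorname{Ker}\omega|_P$. Then: 1. $\mathbb F\mathscr H$ is well defined: for every $P\in J^\dagger$ the set $\operatorname{Ker}\omega|_P$ is non-empty, and $(\tau_0^\dagger)_{[1]}(z)$ does not depend on $z\in\operatorname{Ker}\omega|_P$. 2. $\mathbb F\mathscr H$ is a map over $J^l$, and it is the fibre derivative of $\mathscr H$: for $\theta\in J^l$ the map $\mathscr H|_{J^\dagger_\theta}:J^\dagger_\theta\to\Lambda^nT^*_\theta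 J^l$ is differentiable at every $P\in J^\dagger_\theta$, with derivative $e_{\mathbb F\mathscr H(P)}$. 3. $\mathbb F\mathscr H=\mathscr C\circ\mathsf{leg}^{-1}$. 4. In particular $\operatorname{im}\mathbb F\mathscr H\subset\operatorname{im}\mathscr C$, and $\mathbb F\mathscr H$ factors through $\mathscr C:J^{l+1}\to J^1\pi_l$ by a unique map $J^\dagger\to J^{l+1}$ (which, by 3, is $\mathsf{leg}^{-1}$). -/

import Mathlib

open Set Filter Topology Manifold
open scoped ContDiff

noncomputable section

namespace JetLegendre

/-! ### Derivatives of order `≤ k` of maps between normed spaces -/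

section Jets
variable {X Y : Type*} [NormedAddCommGroup X] [NormedSpace ℝ X]
  [NormedAddCommGroup Y] [NormedSpace ℝ Y]

theorem iteratedFDeriv_swap (f : X → Y) (j : ℕ) :
    ∀ (i : Fin j) (x : X), ContDiffAt ℝ (j + 1 : ℕ) f x → ∀ v : Fin (j + 1) → X,
    iteratedFDeriv ℝ (j + 1) f x (v ∘ Equiv.swap i.castSucc i.succ) =
      iteratedFDeriv ℝ (j + 1) f x v := by
  induction j with
  | zero => intro i; exact i.elim0
  | succ j ih =>
    intro i x hf v
    refine Fin.cases ?_ (fun i => ?_) i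
    · have hs : IsSymmSndFDerivAt ℝ (iteratedFDeriv ℝ j f) x := by
        refine ContDiffAt.isSymmSndFDerivAt (n := 2)
          (hf.iteratedFDeriv_right (m := 2) ?_) (by simp)
        norm_cast; omega
      have hd2 : DifferentiableAt ℝ (fderiv ℝ (iteratedFDeriv ℝ j f)) x := by
        refine ContDiffAt.differentiableAt (n := 1) (ContDiffAt.fderiv_right (n := 2)
          (hf.iteratedFDeriv_right (m := 2) ?_) (by norm_num)) (by simp)
        norm_cast; omega
      have hd1 : DifferentiableAt ℝ (iteratedFDeriv ℝ (j + 1) f) x := by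
        refine ContDiffAt.differentiableAt (n := 1) (hf.iteratedFDeriv_right ?_) (by simp)
        norm_cast; omega
      have key : ∀ w : Fin (j + 1 + 1) → X, iteratedFDeriv ℝ (j + 1 + 1) f x w =
          fderiv ℝ (fderiv ℝ (iteratedFDeriv ℝ j f)) x (w 0) (w 1) (fun i => w i.succ.succ) := by
        intro w
        rw [iteratedFDeriv_succ_apply_left,
          ← fderiv_continuousMultilinear_apply_const_apply hd1]
        have : (fun y => iteratedFDeriv ℝ (j + 1) f y (Fin.tail w)) = fun y =>
            fderiv ℝ (iteratedFDeriv ℝ j f) y (w 1) (fun i => w i.succ.succ) := by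
          funext y
          rw [iteratedFDeriv_succ_apply_left]
          rfl
        rw [this]
        have h1 := (hd2.hasFDerivAt.clm_apply (hasFDerivAt_const (w 1) x))
        have h2 := h1.continuousMultilinear_apply_const (fun i => w i.succ.succ)
        rw [h2.fderiv]
        simp
      rw [key, key]
      have h0 : (v ∘ Equiv.swap (Fin.castSucc (0 : Fin (j+1))) (Fin.succ 0)) 0 = v 1 := by
        simp
      have h1 : (v ∘ Equiv.swap (Fin.castSucc (0 : Fin (j+1))) (Fin.succ 0)) 1 = v 0 := by
        simp
      have h2 : (fun i : Fin j => (v ∘ Equiv.swap (Fin.castSucc (0 : Fin (j+1))) (Fin.succ 0))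
          i.succ.succ) = fun i => v i.succ.succ := by
        funext i
        simp only [Function.comp]
        rw [Equiv.swap_apply_of_ne_of_ne]
        · simp
        · exact fun h => Fin.succ_ne_zero i (Fin.succ_injective _ h)
      rw [h0, h1, h2, hs.eq]
    · rw [iteratedFDeriv_succ_apply_left, iteratedFDeriv_succ_apply_left]
      have hsw : ∀ k : Fin (j + 1), (v ∘ Equiv.swap (Fin.castSucc i.succ) i.succ.succ) k.succ =
          ((Fin.tail v) ∘ Equiv.swap i.castSucc i.succ) k := by
        intro k
        simp only [Function.comp, Fin.tail, ← Fin.succ_castSucc]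
        rw [(Fin.succ_injective _).swap_apply]
      have h0 : (v ∘ Equiv.swap (Fin.castSucc i.succ) i.succ.succ) 0 = v 0 := by
        simp only [Function.comp, ← Fin.succ_castSucc]
        rw [Equiv.swap_apply_of_ne_of_ne (Fin.succ_ne_zero _).symm (Fin.succ_ne_zero _).symm]
      rw [h0]
      have ht : Fin.tail (v ∘ Equiv.swap (Fin.castSucc i.succ) i.succ.succ) =
          Fin.tail v ∘ Equiv.swap i.castSucc i.succ := funext hsw
      rw [ht]
      have hdd : DifferentiableAt ℝ (iteratedFDeriv ℝ (j + 1) f) x := by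
        refine ContDiffAt.differentiableAt (n := 1) (hf.iteratedFDeriv_right ?_) (by simp)
        norm_cast; omega
      rw [← fderiv_continuousMultilinear_apply_const_apply hdd,
        ← fderiv_continuousMultilinear_apply_const_apply hdd]
      congr 1
      apply Filter.EventuallyEq.fderiv_eq
      have hev : ∀ᶠ y in 𝓝 x, ContDiffAt ℝ (j + 1 : ℕ) f y :=
        (hf.of_le (by norm_cast; omega)).eventually (by simp)
      filter_upwards [hev] with y hy
      exact ih i y hy (Fin.tail v)

theorem iteratedFDeriv_perm {f : X → Y} {j : ℕ} {x : X} (hf : ContDiffAt ℝ j f x)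
    (σ : Equiv.Perm (Fin j)) (v : Fin j → X) :
    iteratedFDeriv ℝ j f x (v ∘ σ) = iteratedFDeriv ℝ j f x v := by
  cases j with
  | zero => congr 1; exact Subsingleton.elim _ _
  | succ j =>
    have hσ : σ ∈ Submonoid.closure
        (Set.range fun i : Fin j => Equiv.swap i.castSucc i.succ) := by
      rw [Equiv.Perm.mclosure_swap_castSucc_succ]; trivial
    revert v
    induction hσ using Submonoid.closure_induction with
    | mem τ hτ => obtain ⟨i, rfl⟩ := hτ; exact iteratedFDeriv_swap f j i x hf
    | one => intro v; rfl
    | mul τ₁ τ₂ _ _ h₁ h₂ =>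
      intro v
      rw [← h₁ v, ← h₂ (v ∘ τ₁)]
      rfl

variable (X Y)

/-- The space `Sym^j(X; Y)` of symmetric continuous `j`-linear maps. -/
def SymMult (j : ℕ) : Submodule ℝ (X [×j]→L[ℝ] Y) where
  carrier := {A | ∀ (σ : Equiv.Perm (Fin j)) (v : Fin j → X), A (v ∘ σ) = A v}
  zero_mem' := by intro σ v; simp
  add_mem' := by intro A B hA hB σ v; simp [hA σ v, hB σ v]
  smul_mem' := by intro c A hA σ v; simp [hA σ v]

/-- The average of a multilinear map over all permutations of its arguments. -/
def symAverage (j : ℕ) : (X [×j]→L[ℝ] Y) →L[ℝ] (X [×j]→L[ℝ] Y) :=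
  (j.factorial : ℝ)⁻¹ • ∑ σ : Equiv.Perm (Fin j),
    ((ContinuousMultilinearMap.domDomCongrₗᵢ ℝ X Y σ).toContinuousLinearEquiv :
      (X [×j]→L[ℝ] Y) →L[ℝ] (X [×j]→L[ℝ] Y))

theorem symAverage_apply (j : ℕ) (A : X [×j]→L[ℝ] Y) (v : Fin j → X) :
    symAverage X Y j A v = (j.factorial : ℝ)⁻¹ • ∑ σ : Equiv.Perm (Fin j), A (v ∘ σ) := by
  simp only [symAverage, smul_apply, sum_apply]
  rfl

/-- Symmetrization, a continuous projection onto `Sym^j(X; Y)`. -/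
def symmetrize (j : ℕ) : (X [×j]→L[ℝ] Y) →L[ℝ] SymMult X Y j :=
  (symAverage X Y j).codRestrict (SymMult X Y j) (by
    intro A τ v
    rw [symAverage_apply, symAverage_apply]
    congr 1
    exact Fintype.sum_equiv (Equiv.mulLeft τ) _ _ (fun σ => rfl))

variable {X Y}

theorem symmetrize_coe {j : ℕ} (A : X [×j]→L[ℝ] Y) (hA : A ∈ SymMult X Y j) :
    (symmetrize X Y j A : X [×j]→L[ℝ] Y) = A := by
  ext v
  change symAverage X Y j A v = A v
  rw [symAverage_apply, Finset.sum_congr rfl (fun σ _ => hA σ v)]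
  simp [Fintype.card_perm, ← Nat.cast_smul_eq_nsmul ℝ, smul_smul,
    inv_mul_cancel₀ (Nat.cast_ne_zero.2 j.factorial_ne_zero : (j.factorial : ℝ) ≠ 0)]

/-- Derivatives in the last argument of a jointly smooth map are jointly smooth. -/
theorem contDiffAt_iteratedFDeriv_param {P : Type*} [NormedAddCommGroup P] [NormedSpace ℝ P]
    (G : P → X → Y) (j : ℕ) : ∀ (p : P) (x : X), ContDiffAt ℝ ∞ (Function.uncurry G) (p, x) →
    ContDiffAt ℝ ∞ (fun q : P × X => iteratedFDeriv ℝ j (G q.1) q.2) (p, x) := by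
  induction j with
  | zero =>
    intro p x h
    exact (continuousMultilinearCurryFin0 ℝ X Y).symm.contDiff.contDiffAt.comp (p, x) h
  | succ j ih =>
    intro p x h
    have h2 : ContDiffAt ℝ ∞ (fun q : P × X => fderiv ℝ (iteratedFDeriv ℝ j (G q.1)) q.2)
        (p, x) := by
      refine ContDiffAt.fderiv (n := ∞) (f := fun (q : P × X) y => iteratedFDeriv ℝ j (G q.1) y)
        (g := Prod.snd) ?_ contDiffAt_snd (by simp)
      exact (ih p x h).comp (((p, x), x) : (P × X) × X)
        (g := fun q : P × X => iteratedFDeriv ℝ j (G q.1) q.2)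
        (f := fun r : (P × X) × X => (r.1.1, r.2)) (by fun_prop)
    exact (continuousMultilinearCurryLeftEquiv ℝ
      (fun _ : Fin (j + 1) => X) Y).symm.contDiff.contDiffAt.comp (p, x) h2

/-- Derivatives of a composite up to order `k` depend only on those of the inner map. -/
theorem iteratedFDeriv_comp_congr {Z : Type*} [NormedAddCommGroup Z] [NormedSpace ℝ Z]
    {g : Y → Z} {f f' : X → Y} {x : X} {k : ℕ}
    (h0 : f x = f' x) (hg : ContDiffAt ℝ k g (f x)) (hf : ContDiffAt ℝ k f x)
    (hf' : ContDiffAt ℝ k f' x)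
    (h : ∀ j ≤ k, iteratedFDeriv ℝ j f x = iteratedFDeriv ℝ j f' x) :
    ∀ j ≤ k, iteratedFDeriv ℝ j (g ∘ f) x = iteratedFDeriv ℝ j (g ∘ f') x := by
  intro j hj
  rw [iteratedFDeriv_comp hg hf (by exact_mod_cast hj),
    iteratedFDeriv_comp (h0 ▸ hg) hf' (by exact_mod_cast hj), ← h0]
  simp only [FormalMultilinearSeries.taylorComp]
  refine Finset.sum_congr rfl (fun c _ => ?_)
  ext v
  simp only [FormalMultilinearSeries.compAlongOrderedFinpartition_apply]
  congr 1
  funext m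
  simp only [OrderedFinpartition.applyOrderedFinpartition]
  simp only [ftaylorSeries]
  rw [h _ ((c.partSize_le m).trans hj)]

variable (X Y)

/-- The model fibre of the bundle of `k`-jets: derivatives of order `≤ k`. -/
def JetFibre (k : ℕ) : Type _ := (j : Fin (k + 1)) → SymMult X Y j

instance (k : ℕ) : NormedAddCommGroup (JetFibre X Y k) :=
  inferInstanceAs (NormedAddCommGroup ((j : Fin (k + 1)) → SymMult X Y j))

instance (k : ℕ) : NormedSpace ℝ (JetFibre X Y k) :=
  inferInstanceAs (NormedSpace ℝ ((j : Fin (k + 1)) → SymMult X Y j))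

/-- The derivative of order `j` of a jet. -/
def JetFibre.derivCLM (k : ℕ) (j : Fin (k + 1)) : JetFibre X Y k →L[ℝ] (X [×j]→L[ℝ] Y) :=
  (SymMult X Y j).subtypeL ∘L ContinuousLinearMap.proj (R := ℝ)
    (φ := fun j : Fin (k + 1) => SymMult X Y j) j

variable {X Y}

/-- The polynomial with prescribed symmetric derivatives of order `≤ k` at `a`. -/
def taylorPoly {k : ℕ} (a : X) (A : JetFibre X Y k) (y : X) : Y :=
  ∑ j : Fin (k + 1), ((j : ℕ).factorial : ℝ)⁻¹ • JetFibre.derivCLM X Y k j A (fun _ => y - a)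

theorem contDiff_multilinear_eval (j : ℕ) :
    ContDiff ℝ ∞ (fun q : (X [×j]→L[ℝ] Y) × (Fin j → X) => q.1 q.2) := by
  induction j with
  | zero =>
    have : (fun q : (X [×0]→L[ℝ] Y) × (Fin 0 → X) => q.1 q.2) =
        fun q => continuousMultilinearCurryFin0 ℝ X Y q.1 := by
      funext q
      rw [Subsingleton.elim q.2 0]
      rfl
    rw [this]
    exact (continuousMultilinearCurryFin0 ℝ X Y).contDiff.comp contDiff_fst
  | succ j ih =>
    let c := continuousMultilinearCurryLeftEquiv ℝ (fun _ : Fin (j + 1) => X) Y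
    have h1 : ContDiff ℝ ∞ (fun q : (X [×(j + 1)]→L[ℝ] Y) × (Fin (j + 1) → X) =>
        ((c q.1) (q.2 0), (fun i : Fin j => q.2 i.succ))) := by
      have hc : ContDiff ℝ ∞ (fun A : X [×(j + 1)]→L[ℝ] Y => c A) :=
        ContinuousLinearEquiv.contDiff (𝕜 := ℝ) (n := ∞) (E := X [×(j + 1)]→L[ℝ] Y)
          (F := X →L[ℝ] X [×j]→L[ℝ] Y) c.toContinuousLinearEquiv
      exact ContDiff.prodMk (ContDiff.clm_apply (hc.comp contDiff_fst) (by fun_prop))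
        (by fun_prop)
    have h2 : (fun q : (X [×(j + 1)]→L[ℝ] Y) × (Fin (j + 1) → X) => q.1 q.2) =
        (fun q : (X [×j]→L[ℝ] Y) × (Fin j → X) => q.1 q.2) ∘
          fun q : (X [×(j + 1)]→L[ℝ] Y) × (Fin (j + 1) → X) =>
            ((c q.1) (q.2 0), (fun i : Fin j => q.2 i.succ)) := by
      funext q
      change q.1 q.2 = q.1 (Fin.cons (q.2 0) (fun i => q.2 i.succ))
      congr 1
      exact (Fin.cons_self_tail q.2).symm
    rw [h2]
    exact ih.comp h1

theorem contDiff_taylorPoly_joint {k : ℕ} :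
    ContDiff ℝ ∞ (fun q : (X × JetFibre X Y k) × X => taylorPoly q.1.1 q.1.2 q.2) := by
  unfold taylorPoly
  refine ContDiff.sum fun j _ => contDiff_const.smul ?_
  exact (contDiff_multilinear_eval (X := X) (Y := Y) j).comp
    (f := fun q : (X × JetFibre X Y k) × X =>
      (JetFibre.derivCLM X Y k j q.1.2, fun _ : Fin (j : ℕ) => q.2 - q.1.1))
    (ContDiff.prodMk (by fun_prop) (contDiff_pi.2 fun _ => by fun_prop))

theorem contDiff_taylorPoly {k : ℕ} (a : X) (A : JetFibre X Y k) :
    ContDiff ℝ ∞ (taylorPoly a A) :=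
  contDiff_taylorPoly_joint.comp (f := fun y => ((a, A), y)) (by fun_prop)

theorem iteratedFDeriv_monomial {m : ℕ} (B : X [×m]→L[ℝ] Y) (hB : B ∈ SymMult X Y m)
    (a : X) (j : ℕ) :
    iteratedFDeriv ℝ j (fun y => B (fun _ => y - a)) a =
      if h : m = j then (m.factorial : ℝ) • (h ▸ B) else 0 := by
  rw [iteratedFDeriv_comp_sub j a a (f := fun y => B (fun _ => y)), sub_self]
  split_ifs with h
  · subst h
    ext v
    have : ∀ σ : Equiv.Perm (Fin m), B (fun i => v (σ i)) = B v := fun σ => hB σ v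
    rw [B.iteratedFDeriv_comp_diagonal 0 v, smul_apply, Finset.sum_congr rfl (fun σ _ => this σ)]
    simp [Fintype.card_perm, ← Nat.cast_smul_eq_nsmul ℝ]
  · ext v
    let q : FormalMultilinearSeries ℝ X Y := fun k => if h : m = k then (h ▸ B) else 0
    have hq : HasFiniteFPowerSeriesOnBall (fun y => B (fun _ => y)) q 0 (m + 1) ⊤ := by
      apply HasFiniteFPowerSeriesOnBall.mk' _ (by simp)
      · intro y hy
        rw [Finset.sum_eq_single_of_mem m]
        · simp [q]
        · simp
        · intro i hi h'i
          simp [q, h'i.symm]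
      · intro i hi
        have : m ≠ i := by omega
        simp [q, this]
    have hB' : ContDiff ℝ ω (fun y => B (fun _ => y)) :=
      B.contDiff.comp (contDiff_pi.2 fun _ => contDiff_id)
    rw [hq.toHasFPowerSeriesOnBall.iteratedFDeriv_eq_sum
      (analyticOn_univ.2 fun x _ => hB'.contDiffAt.analyticAt) v]
    simp [q, h]

theorem iteratedFDeriv_taylorPoly {k : ℕ} (a : X) (A : JetFibre X Y k)
    (j : Fin (k + 1)) :
    iteratedFDeriv ℝ j (taylorPoly a A) a = JetFibre.derivCLM X Y k j A := by
  have hm : ∀ i : Fin (k + 1), JetFibre.derivCLM X Y k i A ∈ SymMult X Y i := fun i => (A i).2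
  have hc : ∀ i : Fin (k + 1), ContDiff ℝ ∞ (fun y =>
      JetFibre.derivCLM X Y k i A (fun _ => y - a)) := fun i =>
    (JetFibre.derivCLM X Y k i A).contDiff.comp (contDiff_pi.2 fun _ => by fun_prop)
  have h1 : iteratedFDeriv ℝ j (taylorPoly a A) a = ∑ i : Fin (k + 1),
      ((i : ℕ).factorial : ℝ)⁻¹ • iteratedFDeriv ℝ j (fun y =>
        JetFibre.derivCLM X Y k i A (fun _ => y - a)) a := by
    have hs := iteratedFDeriv_sum (𝕜 := ℝ) (i := (j : ℕ)) (u := Finset.univ)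
      (f := fun (i : Fin (k + 1)) y => ((i : ℕ).factorial : ℝ)⁻¹ •
        JetFibre.derivCLM X Y k i A (fun _ => y - a))
      (fun i _ => (contDiff_const.smul (hc i)).of_le (by exact_mod_cast le_top))
    change iteratedFDeriv ℝ j (fun y => ∑ i : Fin (k + 1), ((i : ℕ).factorial : ℝ)⁻¹ •
        JetFibre.derivCLM X Y k i A (fun _ => y - a)) a = _
    rw [hs, Finset.sum_apply]
    refine Finset.sum_congr rfl fun i _ => ?_
    exact iteratedFDeriv_const_smul_apply' ((hc i).of_le (by exact_mod_cast le_top)).contDiffAt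
  rw [h1, Finset.sum_eq_single j]
  · rw [iteratedFDeriv_monomial _ (hm j), dif_pos rfl, smul_smul,
      inv_mul_cancel₀ (Nat.cast_ne_zero.2 (Nat.factorial_ne_zero _)), one_smul]
  · intro i _ hij
    rw [iteratedFDeriv_monomial _ (hm i), dif_neg (fun h => hij (Fin.ext h)), smul_zero]
  · simp

/-- Derivatives of a composite up to order `k` depend only on those of the outer map. -/
theorem iteratedFDeriv_comp_congr_left {Z : Type*} [NormedAddCommGroup Z] [NormedSpace ℝ Z]
    {g g' : Y → Z} {f : X → Y} {x : X} {k : ℕ} (hg : ContDiffAt ℝ k g (f x))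
    (hg' : ContDiffAt ℝ k g' (f x)) (hf : ContDiffAt ℝ k f x)
    (h : ∀ j ≤ k, iteratedFDeriv ℝ j g (f x) = iteratedFDeriv ℝ j g' (f x)) :
    ∀ j ≤ k, iteratedFDeriv ℝ j (g ∘ f) x = iteratedFDeriv ℝ j (g' ∘ f) x := by
  intro j hj
  rw [iteratedFDeriv_comp hg hf (by exact_mod_cast hj),
    iteratedFDeriv_comp hg' hf (by exact_mod_cast hj)]
  simp only [FormalMultilinearSeries.taylorComp]
  refine Finset.sum_congr rfl (fun c _ => ?_)
  ext v
  simp only [FormalMultilinearSeries.compAlongOrderedFinpartition_apply]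
  simp only [ftaylorSeries]
  rw [h _ (c.length_le.trans hj)]

/-- The value (derivative of order `0`) of a jet. -/
def JetFibre.value {k : ℕ} (A : JetFibre X Y k) : Y :=
  JetFibre.derivCLM X Y k 0 A 0

theorem taylorPoly_self {k : ℕ} (a : X) (A : JetFibre X Y k) : taylorPoly a A a = A.value := by
  have h := congrArg (fun B : X [×0]→L[ℝ] Y => B 0) (iteratedFDeriv_taylorPoly a A 0)
  exact h

theorem continuous_value {k : ℕ} : Continuous (JetFibre.value : JetFibre X Y k → Y) := by
  have : Continuous (fun A : JetFibre X Y k => taylorPoly (0 : X) A 0) :=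
    (contDiff_taylorPoly_joint (X := X) (Y := Y) (k := k)).continuous.comp
      (f := fun A => (((0 : X), A), (0 : X))) (by fun_prop)
  simpa only [taylorPoly_self] using this

/-- The jet with derivatives `D j`, `j ≤ k` (symmetrized; derivatives of smooth maps already are
symmetric). -/
def JetFibre.ofDerivs (k : ℕ) (D : (j : ℕ) → X [×j]→L[ℝ] Y) : JetFibre X Y k :=
  fun j => symmetrize X Y j (D j)

theorem contDiff_symmetrize (j : ℕ) :
    ContDiff ℝ ∞ (fun A : X [×j]→L[ℝ] Y => symmetrize X Y j A) := by
  have h : ∀ (G : Type _) [NormedAddCommGroup G] [NormedSpace ℝ G]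
      (f : (X [×j]→L[ℝ] Y) →ₗ[ℝ] G) (hf : Continuous f), ContDiff ℝ ∞ f :=
    fun G _ _ f hf => ContinuousLinearMap.contDiff (⟨f, hf⟩ : (X [×j]→L[ℝ] Y) →L[ℝ] G)
  exact h (SymMult X Y j) (symmetrize X Y j).toLinearMap (symmetrize X Y j).cont

theorem contDiffAt_ofDerivs {P : Type*} [NormedAddCommGroup P] [NormedSpace ℝ P] (k : ℕ)
    {D : P → (j : ℕ) → X [×j]→L[ℝ] Y} {p : P}
    (hD : ∀ j, ContDiffAt ℝ ∞ (fun q => D q j) p) :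
    ContDiffAt ℝ ∞ (fun q => JetFibre.ofDerivs k (D q)) p := by
  have h2 : ∀ j : Fin (k + 1), ContDiffAt ℝ ∞ (fun q => symmetrize X Y j (D q j)) p := fun j =>
    ContDiffAt.comp p (contDiff_symmetrize (j : ℕ)).contDiffAt (hD j)
  exact (contDiffAt_pi (F' := fun j : Fin (k + 1) => SymMult X Y j)).2 h2

end Jets

/-! ### Fibre bundles -/

section Bundles

/-- Model space of the base manifold, whose dimension is `n + 1`. -/
abbrev BaseModel (n : ℕ) := EuclideanSpace ℝ (Fin (n + 1))

/-- Model space of the typical fibre, whose dimension is `m`. -/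
abbrev FibreModel (m : ℕ) := EuclideanSpace ℝ (Fin m)

/-- A smooth (locally trivial) fibre bundle `E → M` with typical fibre `F`, where
`dim M = n + 1`, `dim F = m`. -/
structure SmoothFiberBundle (n m : ℕ) (M E F : Type*)
    [TopologicalSpace M] [ChartedSpace (BaseModel n) M]
    [TopologicalSpace E] [ChartedSpace (EuclideanSpace ℝ (Fin (n + 1 + m))) E]
    [TopologicalSpace F] [ChartedSpace (FibreModel m) F] where
  /-- the bundle projection -/
  proj : E → M
  exists_trivialization : ∀ x : M, ∃ (U : Set M) (t : OpenPartialHomeomorph E (M × F)),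
    IsOpen U ∧ x ∈ U ∧ t.source = proj ⁻¹' U ∧ t.target = U ×ˢ univ ∧
    (∀ e ∈ t.source, (t e).1 = proj e) ∧
    ContMDiffOn (𝓡 (n + 1 + m)) ((𝓡 (n + 1)).prod (𝓡 m)) ∞ t t.source ∧
    ContMDiffOn ((𝓡 (n + 1)).prod (𝓡 m)) (𝓡 (n + 1 + m)) ∞ t.symm t.target

variable {n m : ℕ} {M E F : Type*}
  [TopologicalSpace M] [ChartedSpace (BaseModel n) M]
  [TopologicalSpace E] [ChartedSpace (EuclideanSpace ℝ (Fin (n + 1 + m))) E]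
  [TopologicalSpace F] [ChartedSpace (FibreModel m) F]

/-- A fibred chart `e ↦ (xⁱ, uᵅ)` of the bundle, over a chart `xⁱ` of the base. -/
structure FibredChart (π : SmoothFiberBundle n m M E F) where
  /-- the chart of the total space -/
  total : OpenPartialHomeomorph E (BaseModel n × FibreModel m)
  /-- the chart of the base -/
  base : OpenPartialHomeomorph M (BaseModel n)
  smooth_total : ContMDiffOn (𝓡 (n + 1 + m)) 𝓘(ℝ, BaseModel n × FibreModel m) ∞
    total total.source
  smooth_total_symm : ContMDiffOn 𝓘(ℝ, BaseModel n × FibreModel m) (𝓡 (n + 1 + m)) ∞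
    total.symm total.target
  smooth_base : ContMDiffOn (𝓡 (n + 1)) (𝓡 (n + 1)) ∞ base base.source
  smooth_base_symm : ContMDiffOn (𝓡 (n + 1)) (𝓡 (n + 1)) ∞ base.symm base.target
  fibred : ∀ e ∈ total.source, π.proj e ∈ base.source ∧ base (π.proj e) = (total e).1

variable (π : SmoothFiberBundle n m M E F)

theorem exists_fibredChart [IsManifold (𝓡 (n + 1)) ∞ M] [IsManifold (𝓡 m) ∞ F] (e : E) : ∃ c : FibredChart π, e ∈ c.total.source := by
  obtain ⟨U, t, -, hx, hs, ht, hp, ht1, ht2⟩ := π.exists_trivialization (π.proj e)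
  have he : e ∈ t.source := by rw [hs]; exact hx
  let φ := chartAt (BaseModel n) (π.proj e)
  let χ := chartAt (FibreModel m) (t e).2
  have hφ : ContMDiffOn (𝓡 (n + 1)) (𝓡 (n + 1)) ∞ φ φ.source := contMDiffOn_chart
  have hφ' : ContMDiffOn (𝓡 (n + 1)) (𝓡 (n + 1)) ∞ φ.symm φ.target := contMDiffOn_chart_symm
  have hχ : ContMDiffOn (𝓡 m) (𝓡 m) ∞ χ χ.source := contMDiffOn_chart
  have hχ' : ContMDiffOn (𝓡 m) (𝓡 m) ∞ χ.symm χ.target := contMDiffOn_chart_symm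
  refine ⟨⟨t.trans (φ.prod χ), φ, ?_, ?_, hφ, hφ', ?_⟩, ?_⟩
  · have h1 : ContMDiffOn (𝓡 (n + 1 + m)) (𝓡 (n + 1)) ∞ (fun y => φ (t y).1)
        (t.trans (φ.prod χ)).source :=
      hφ.comp (contMDiff_fst.comp_contMDiffOn (ht1.mono inter_subset_left)) (fun y hy => hy.2.1)
    have h2 : ContMDiffOn (𝓡 (n + 1 + m)) (𝓡 m) ∞ (fun y => χ (t y).2)
        (t.trans (φ.prod χ)).source :=
      hχ.comp (contMDiff_snd.comp_contMDiffOn (ht1.mono inter_subset_left)) (fun y hy => hy.2.2)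
    exact h1.prodMk_space h2
  · have h1 : ContMDiffOn 𝓘(ℝ, BaseModel n × FibreModel m) (𝓡 (n + 1)) ∞ (fun q => φ.symm q.1)
        (t.trans (φ.prod χ)).target :=
      hφ'.comp contDiff_fst.contMDiff.contMDiffOn (fun y hy => hy.1.1)
    have h2 : ContMDiffOn 𝓘(ℝ, BaseModel n × FibreModel m) (𝓡 m) ∞ (fun q => χ.symm q.2)
        (t.trans (φ.prod χ)).target :=
      hχ'.comp contDiff_snd.contMDiff.contMDiffOn (fun y hy => hy.1.2)
    exact ht2.comp (h1.prodMk h2) (fun y hy => hy.2)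
  · intro y hy
    simp at hy
    have h1 := hp y hy.1
    rw [← h1]
    exact ⟨hy.2.1, rfl⟩
  · simp
    refine ⟨he, ?_, mem_chart_source _ _⟩
    rw [hp e he]
    exact mem_chart_source _ _

variable {π}

/-- `s` is, near `x`, a smooth section of the bundle. -/
def IsLocalSection (π : SmoothFiberBundle n m M E F) (s : M → E) (x : M) : Prop :=
  ∀ᶠ y in 𝓝 x, π.proj (s y) = y ∧ ContMDiffAt (𝓡 (n + 1)) (𝓡 (n + 1 + m)) ∞ s y

/-- Local coordinate expression `x ↦ uᵅ(s(x))` of a section in a fibred chart. -/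
def FibredChart.rep (c : FibredChart π) (s : M → E) (a : BaseModel n) : FibreModel m :=
  (c.total (s (c.base.symm a))).2

variable (c c' : FibredChart π) {s s' : M → E} {x : M}

theorem FibredChart.mem_base (hs : IsLocalSection π s x) (hx : s x ∈ c.total.source) :
    x ∈ c.base.source := by
  have := (c.fibred _ hx).1
  rwa [hs.self_of_nhds.1] at this

theorem FibredChart.total_section (hs : IsLocalSection π s x) (hx : s x ∈ c.total.source) :
    c.total (s x) = (c.base x, c.rep s (c.base x)) := by
  have h := (c.fibred _ hx).2
  rw [hs.self_of_nhds.1] at h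
  rw [FibredChart.rep, c.base.left_inv (c.mem_base hs hx), h]

theorem IsLocalSection.eventually_mem (hs : IsLocalSection π s x)
    (hx : s x ∈ c.total.source) : ∀ᶠ y in 𝓝 x, IsLocalSection π s y ∧ s y ∈ c.total.source :=
  (eventually_eventually_nhds.2 hs).and
    (hs.self_of_nhds.2.continuousAt.eventually (c.total.open_source.mem_nhds hx))

theorem FibredChart.contDiffAt_rep (hs : IsLocalSection π s x) (hx : s x ∈ c.total.source) :
    ContDiffAt ℝ ∞ (c.rep s) (c.base x) := by
  have hb := c.mem_base hs hx
  rw [← contMDiffAt_iff_contDiffAt]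
  have h1 : ContMDiffAt (𝓡 (n + 1)) (𝓡 (n + 1)) ∞ c.base.symm (c.base x) :=
    c.smooth_base_symm.contMDiffAt (c.base.open_target.mem_nhds (c.base.map_source hb))
  have h2 : ContMDiffAt (𝓡 (n + 1)) (𝓡 (n + 1 + m)) ∞ s (c.base.symm (c.base x)) := by
    rw [c.base.left_inv hb]; exact hs.self_of_nhds.2
  have h3 : ContMDiffAt (𝓡 (n + 1 + m)) 𝓘(ℝ, BaseModel n × FibreModel m) ∞ c.total
      (s (c.base.symm (c.base x))) := by
    rw [c.base.left_inv hb]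
    exact c.smooth_total.contMDiffAt (c.total.open_source.mem_nhds hx)
  have h4 : ContMDiffAt (𝓡 (n + 1)) 𝓘(ℝ, BaseModel n × FibreModel m) ∞
      (fun a => c.total (s (c.base.symm a))) (c.base x) :=
    ContMDiffAt.comp (c.base x) (g := c.total) (f := fun a => s (c.base.symm a)) h3
      (ContMDiffAt.comp (c.base x) (g := s) (f := c.base.symm) h2 h1)
  exact contDiff_snd.contDiffAt.comp _ h4.contDiffAt |>.contMDiffAt

/-- Coordinate change of the fibre coordinates. -/
def fibreChange (q : BaseModel n × FibreModel m) : FibreModel m := (c'.total (c.total.symm q)).2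

/-- Coordinate change of the base coordinates. -/
def baseChange (a : BaseModel n) : BaseModel n := c'.base (c.base.symm a)

theorem contDiffAt_totalChange {q : BaseModel n × FibreModel m} (hq : q ∈ c.total.target)
    (hq' : c.total.symm q ∈ c'.total.source) :
    ContDiffAt ℝ ∞ (c'.total ∘ c.total.symm) q := by
  rw [← contMDiffAt_iff_contDiffAt]
  exact (c'.smooth_total.contMDiffAt (c'.total.open_source.mem_nhds hq')).comp _
    (c.smooth_total_symm.contMDiffAt (c.total.open_target.mem_nhds hq))

theorem contDiffAt_fibreChange {q : BaseModel n × FibreModel m} (hq : q ∈ c.total.target)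
    (hq' : c.total.symm q ∈ c'.total.source) : ContDiffAt ℝ ∞ (fibreChange c c') q :=
  contDiff_snd.contDiffAt.comp _ (contDiffAt_totalChange c c' hq hq')

theorem contDiffAt_baseChange {a : BaseModel n} (ha : a ∈ c.base.target)
    (ha' : c.base.symm a ∈ c'.base.source) : ContDiffAt ℝ ∞ (baseChange c c') a := by
  rw [← contMDiffAt_iff_contDiffAt]
  exact (c'.smooth_base.contMDiffAt (c'.base.open_source.mem_nhds ha')).comp _
    (c.smooth_base_symm.contMDiffAt (c.base.open_target.mem_nhds ha))

theorem rep_change (hs : IsLocalSection π s x) (hx : s x ∈ c.total.source)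
    (hx' : s x ∈ c'.total.source) :
    c'.rep s =ᶠ[𝓝 (c'.base x)]
      (fibreChange c c' ∘ fun b => (b, c.rep s b)) ∘ baseChange c' c := by
  have hb := c'.mem_base hs hx'
  have h1 : ∀ᶠ a in 𝓝 (c'.base x), IsLocalSection π s (c'.base.symm a) ∧
      s (c'.base.symm a) ∈ c.total.source := by
    have h := c'.base.continuousAt_symm (c'.base.map_source hb)
    have h2 := hs.eventually_mem c hx
    rw [ContinuousAt, c'.base.left_inv hb] at h
    exact h.eventually h2
  filter_upwards [h1] with a ha
  have h2 := c.total_section ha.1 ha.2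
  have h3 : c.total.symm (baseChange c' c a, c.rep s (baseChange c' c a)) =
      s (c'.base.symm a) := by
    rw [baseChange, ← h2, c.total.left_inv ha.2]
  simp only [Function.comp, fibreChange, h3]
  rfl

/-- Two sections have the same derivatives of order `≤ k` at `x`, in a fibred chart. -/
def FibredChart.SameJet (k : ℕ) (x : M) (s s' : M → E) : Prop :=
  ∀ j ≤ k, iteratedFDeriv ℝ j (c.rep s) (c.base x) = iteratedFDeriv ℝ j (c.rep s') (c.base x)

theorem sameJet_change {k : ℕ} (hs : IsLocalSection π s x) (hs' : IsLocalSection π s' x)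
    (hss : s x = s' x) (hx : s x ∈ c.total.source) (hx' : s x ∈ c'.total.source)
    (h : c.SameJet k x s s') : c'.SameJet k x s s' := by
  intro j hj
  rw [(EventuallyEq.iteratedFDeriv ℝ (rep_change c c' hs hx hx') j).eq_of_nhds,
    (EventuallyEq.iteratedFDeriv ℝ
      (rep_change c c' hs' (hss ▸ hx) (hss ▸ hx')) j).eq_of_nhds]
  have hb := c.mem_base hs hx
  have hb' := c'.mem_base hs hx'
  have hbc : baseChange c' c (c'.base x) = c.base x := by
    rw [baseChange, c'.base.left_inv hb']
  have hk : (k : ℕ∞ω) ≤ ∞ := by exact_mod_cast le_top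
  have hr := (c.contDiffAt_rep hs hx).of_le hk
  have hr' := (c.contDiffAt_rep hs' (hss ▸ hx)).of_le hk
  have hg : ContDiffAt ℝ k (fibreChange c c') (c.base x, c.rep s (c.base x)) := by
    rw [← c.total_section hs hx]
    refine (contDiffAt_fibreChange c c' (c.total.map_source hx) ?_).of_le hk
    rwa [c.total.left_inv hx]
  have h0 : c.rep s (c.base x) = c.rep s' (c.base x) := by
    simp only [FibredChart.rep, c.base.left_inv hb, hss]
  have hχ : ContDiffAt ℝ k (baseChange c' c) (c'.base x) := by
    refine (contDiffAt_baseChange c' c (c'.base.map_source hb') ?_).of_le hk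
    rwa [c'.base.left_inv hb']
  have hg' : ContDiffAt ℝ k (fibreChange c c') (c.base x, c.rep s' (c.base x)) := by
    rw [← h0]; exact hg
  have hid : ContDiffAt ℝ k (fun b : BaseModel n => b) (c.base x) := contDiffAt_id
  refine iteratedFDeriv_comp_congr_left (k := k) (f := baseChange c' c) ?_ ?_ hχ ?_ j hj
  · rw [hbc]; exact ContDiffAt.comp (c.base x) hg (hid.prodMk hr)
  · rw [hbc]; exact ContDiffAt.comp (c.base x) hg' (hid.prodMk hr')
  · rw [hbc]
    refine iteratedFDeriv_comp_congr (k := k) (by simp [h0]) hg (hid.prodMk hr)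
      (hid.prodMk hr') ?_
    intro i hi
    rw [iteratedFDeriv_prodMk hid hr (by exact_mod_cast hi),
      iteratedFDeriv_prodMk hid hr' (by exact_mod_cast hi), h i hi]

/-! ### Jets -/

variable (π)

/-- Two local sections define the same `k`-jet at `x`: they have the same value and, in every
fibred chart, the same derivatives of order `≤ k` at `x`. -/
def jetSetoid (k : ℕ) (x : M) : Setoid {s : M → E // IsLocalSection π s x} where
  r s s' := s.1 x = s'.1 x ∧
    ∀ c : FibredChart π, s.1 x ∈ c.total.source → c.SameJet k x s.1 s'.1
  iseqv :=
    { refl := fun _ => ⟨rfl, fun _ _ _ _ => rfl⟩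
      symm := fun h => ⟨h.1.symm, fun c hc j hj => (h.2 c (h.1 ▸ hc) j hj).symm⟩
      trans := fun h h' => ⟨h.1.trans h'.1, fun c hc j hj =>
        (h.2 c hc j hj).trans (h'.2 c (h.1 ▸ hc) j hj)⟩ }

/-- The `k`-th jet bundle `J^k π`. -/
def Jet (k : ℕ) : Type _ := Σ x : M, Quotient (jetSetoid π k x)

variable {π}

/-- The `k`-jet `(j_k s)(x)`. -/
def Jet.mk {k : ℕ} (s : M → E) (x : M) (h : IsLocalSection π s x) : Jet π k :=
  ⟨x, Quotient.mk (jetSetoid π k x) ⟨s, h⟩⟩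

/-- The projection `π_k : J^k π → M`. -/
def Jet.base {k : ℕ} (θ : Jet π k) : M := θ.1

/-- A section representing a jet. -/
def Jet.repr {k : ℕ} (θ : Jet π k) : M → E := (Quotient.out θ.2).1

theorem Jet.isLocalSection {k : ℕ} (θ : Jet π k) : IsLocalSection π θ.repr θ.base :=
  (Quotient.out θ.2).2

theorem Jet.mk_repr {k : ℕ} (θ : Jet π k) : Jet.mk θ.repr θ.base θ.isLocalSection = θ :=
  Sigma.ext rfl (heq_of_eq (Quotient.out_eq θ.2))

/-- The projection `π_{k,0} : J^k π → J^0 π = E`. -/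
def Jet.target {k : ℕ} (θ : Jet π k) : E := θ.repr θ.base

/-- The projection `π_{k,l} : J^k π → J^l π`. -/
def Jet.trunc {k : ℕ} (l : ℕ) (θ : Jet π k) : Jet π l := Jet.mk θ.repr θ.base θ.isLocalSection

theorem Jet.repr_mk {k : ℕ} {s : M → E} {x : M} (h : IsLocalSection π s x) :
    (Jet.mk s x h : Jet π k).repr x = s x ∧ ∀ c : FibredChart π,
      s x ∈ c.total.source → c.SameJet k x (Jet.mk s x h : Jet π k).repr s := by
  have := Quotient.mk_out (s := jetSetoid π k x) ⟨s, h⟩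
  exact ⟨this.1, fun c hc => this.2 c (by rw [this.1]; exact hc)⟩

theorem Jet.target_mk {k : ℕ} {s : M → E} {x : M} (h : IsLocalSection π s x) :
    (Jet.mk s x h : Jet π k).target = s x := (Jet.repr_mk h).1

theorem Jet.mk_eq {k : ℕ} {x x' : M} (hs : IsLocalSection π s x)
    (hs' : IsLocalSection π s' x') (hxx : x = x') (hss : s x = s' x) (hx : s x ∈ c.total.source)
    (h : c.SameJet k x s s') : (Jet.mk s x hs : Jet π k) = Jet.mk s' x' hs' := by
  subst hxx
  refine Sigma.ext rfl (heq_of_eq (Quotient.sound ⟨hss, fun c' hc' => ?_⟩))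
  exact sameJet_change c c' hs hs' hss hx hc' h

/-! ### The manifold structure of the jet bundles -/

/-- The model space of `J^k π`. -/
abbrev JetModel (n m k : ℕ) := BaseModel n × JetFibre (BaseModel n) (FibreModel m) k

/-- The jet coordinates of the `k`-jet of `s` at `x`: the point `x` and the derivatives
of `s` (which are symmetric already). -/
def FibredChart.jetCoord (k : ℕ) (s : M → E) (x : M) : JetModel n m k :=
  (c.base x, JetFibre.ofDerivs k fun j => iteratedFDeriv ℝ j (c.rep s) (c.base x))

theorem FibredChart.derivCLM_jetCoord {k : ℕ} (hs : IsLocalSection π s x)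
    (hx : s x ∈ c.total.source) (j : Fin (k + 1)) :
    JetFibre.derivCLM _ _ k j (c.jetCoord k s x).2 =
      iteratedFDeriv ℝ j (c.rep s) (c.base x) :=
  symmetrize_coe _ (fun σ v => iteratedFDeriv_perm
    ((c.contDiffAt_rep hs hx).of_le (by exact_mod_cast le_top)) σ v)

/-- The polynomial section with given jet coordinates. -/
def FibredChart.polySection {k : ℕ} (q : JetModel n m k) (y : M) : E :=
  c.total.symm (c.base y, taylorPoly q.1 q.2 (c.base y))

variable {c} in
theorem FibredChart.mem_base_target {q : BaseModel n × FibreModel m}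
    (hq : q ∈ c.total.target) : q.1 ∈ c.base.target := by
  have h := c.fibred _ (c.total.map_target hq)
  rw [c.total.right_inv hq] at h
  rw [← h.2]
  exact c.base.map_source h.1

theorem FibredChart.polySection_base {k : ℕ} {q : JetModel n m k}
    (hq : (q.1, q.2.value) ∈ c.total.target) :
    c.polySection q (c.base.symm q.1) = c.total.symm (q.1, q.2.value) := by
  rw [FibredChart.polySection, c.base.right_inv (FibredChart.mem_base_target hq), taylorPoly_self]

theorem FibredChart.isLocalSection_polySection {k : ℕ} {q : JetModel n m k}
    (hq : (q.1, q.2.value) ∈ c.total.target) :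
    IsLocalSection π (c.polySection q) (c.base.symm q.1) := by
  have hb := FibredChart.mem_base_target hq
  have hx := c.base.map_target hb
  have hc : ContinuousAt (fun y => (c.base y, taylorPoly q.1 q.2 (c.base y)))
      (c.base.symm q.1) := by
    have h1 := c.base.continuousAt hx
    exact h1.prodMk ((contDiff_taylorPoly q.1 q.2).continuous.continuousAt.comp h1)
  have hmem : (c.base (c.base.symm q.1), taylorPoly q.1 q.2 (c.base (c.base.symm q.1))) ∈
      c.total.target := by
    rwa [c.base.right_inv hb, taylorPoly_self]
  filter_upwards [hc.eventually (c.total.open_target.mem_nhds hmem),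
    c.base.open_source.mem_nhds hx] with y hy hy'
  constructor
  · have h := c.fibred _ (c.total.map_target hy)
    rw [c.total.right_inv hy] at h
    exact c.base.injOn h.1 hy' h.2
  · have h1 := c.smooth_base.contMDiffAt (c.base.open_source.mem_nhds hy')
    have h2 : ContMDiffAt (𝓡 (n + 1)) 𝓘(ℝ, BaseModel n × FibreModel m) ∞
        (fun y => (c.base y, taylorPoly q.1 q.2 (c.base y))) y :=
      h1.prodMk_space ((contDiff_taylorPoly q.1 q.2).contDiffAt.comp_contMDiffAt h1)
    exact ContMDiffAt.comp y (c.smooth_total_symm.contMDiffAt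
      (c.total.open_target.mem_nhds hy)) h2

theorem FibredChart.rep_polySection {k : ℕ} {q : JetModel n m k}
    (hq : (q.1, q.2.value) ∈ c.total.target) :
    c.rep (c.polySection q) =ᶠ[𝓝 q.1] taylorPoly q.1 q.2 := by
  have hb := FibredChart.mem_base_target hq
  have hc : ContinuousAt (fun a => (a, taylorPoly q.1 q.2 a)) q.1 :=
    continuousAt_id.prodMk (contDiff_taylorPoly q.1 q.2).continuous.continuousAt
  have hmem : (q.1, taylorPoly q.1 q.2 q.1) ∈ c.total.target := by rwa [taylorPoly_self]
  filter_upwards [hc.eventually (c.total.open_target.mem_nhds hmem),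
    c.base.open_target.mem_nhds hb] with a ha ha'
  rw [FibredChart.rep, FibredChart.polySection, c.base.right_inv ha', c.total.right_inv ha]

theorem FibredChart.value_jetCoord {k : ℕ} (hs : IsLocalSection π s x)
    (hx : s x ∈ c.total.source) :
    ((c.jetCoord k s x).1, (c.jetCoord k s x).2.value) = c.total (s x) := by
  rw [c.total_section hs hx, JetFibre.value, c.derivCLM_jetCoord hs hx]
  rfl

theorem FibredChart.jetCoord_congr {k : ℕ} (h : c.SameJet k x s s') :
    c.jetCoord k s x = c.jetCoord k s' x := by
  refine Prod.ext rfl (funext fun j => ?_)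
  simp only [FibredChart.jetCoord, JetFibre.ofDerivs]
  rw [h j (Nat.lt_succ_iff.1 j.2)]

theorem FibredChart.jetCoord_mk {k : ℕ} (hs : IsLocalSection π s x)
    (hx : s x ∈ c.total.source) :
    c.jetCoord k (Jet.mk s x hs : Jet π k).repr x = c.jetCoord k s x :=
  c.jetCoord_congr ((Jet.repr_mk hs).2 c hx)

theorem FibredChart.jetCoord_polySection {k : ℕ} {q : JetModel n m k}
    (hq : (q.1, q.2.value) ∈ c.total.target) :
    c.jetCoord k (c.polySection q) (c.base.symm q.1) = q := by
  have hb := FibredChart.mem_base_target hq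
  refine Prod.ext (c.base.right_inv hb) (funext fun j => Subtype.ext ?_)
  simp only [FibredChart.jetCoord, JetFibre.ofDerivs]
  rw [c.base.right_inv hb, (EventuallyEq.iteratedFDeriv ℝ (c.rep_polySection hq) j).eq_of_nhds,
    iteratedFDeriv_taylorPoly]
  exact symmetrize_coe _ (q.2 j).2

theorem FibredChart.sameJet_of_jetCoord {k : ℕ} (hs : IsLocalSection π s x)
    (hx : s x ∈ c.total.source) (hs' : IsLocalSection π s' x) (hx' : s' x ∈ c.total.source)
    (h : c.jetCoord k s x = c.jetCoord k s' x) : s x = s' x ∧ c.SameJet k x s s' := by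
  constructor
  · apply c.total.injOn hx hx'
    rw [← c.value_jetCoord (k := k) hs hx, h, c.value_jetCoord hs' hx']
  · intro j hj
    have h1 := c.derivCLM_jetCoord (k := k) hs hx ⟨j, Nat.lt_succ_of_le hj⟩
    rw [h, c.derivCLM_jetCoord hs' hx'] at h1
    exact h1.symm

open Classical in
/-- Jet coordinates `(xⁱ, uᵅ_I)`, `|I| ≤ k`, as a partial equivalence. -/
def FibredChart.jetChart (k : ℕ) [Nonempty (Jet π k)] :
    PartialEquiv (Jet π k) (JetModel n m k) where
  toFun θ := c.jetCoord k θ.repr θ.base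
  invFun q := if h : (q.1, q.2.value) ∈ c.total.target then
      Jet.mk (c.polySection q) (c.base.symm q.1) (c.isLocalSection_polySection h)
    else Classical.arbitrary _
  source := {θ | θ.target ∈ c.total.source}
  target := {q | (q.1, q.2.value) ∈ c.total.target}
  map_source' θ hθ := by
    change ((c.jetCoord k θ.repr θ.base).1, (c.jetCoord k θ.repr θ.base).2.value) ∈
      c.total.target
    rw [c.value_jetCoord θ.isLocalSection hθ]
    exact c.total.map_source hθ
  map_target' q hq := by
    replace hq : (q.1, q.2.value) ∈ c.total.target := hq
    rw [dif_pos hq]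
    change Jet.target _ ∈ c.total.source
    rw [Jet.target_mk, c.polySection_base hq]
    exact c.total.map_target hq
  left_inv' θ hθ := by
    have hq : ((c.jetCoord k θ.repr θ.base).1, (c.jetCoord k θ.repr θ.base).2.value) ∈
        c.total.target := by
      rw [c.value_jetCoord θ.isLocalSection hθ]
      exact c.total.map_source hθ
    have hb : c.base.symm (c.base θ.base) = θ.base :=
      c.base.left_inv (c.mem_base θ.isLocalSection hθ)
    have hls := c.isLocalSection_polySection hq
    have hsb := c.polySection_base hq
    have hjc := c.jetCoord_polySection hq
    change IsLocalSection π _ (c.base.symm (c.base θ.base)) at hls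
    change c.polySection _ (c.base.symm (c.base θ.base)) = _ at hsb
    change c.jetCoord k _ (c.base.symm (c.base θ.base)) = _ at hjc
    rw [hb] at hls hsb hjc
    have hx : c.polySection (c.jetCoord k θ.repr θ.base) θ.base ∈ c.total.source := by
      rw [hsb]; exact c.total.map_target hq
    rw [dif_pos hq]
    have h := c.sameJet_of_jetCoord (k := k) hls hx θ.isLocalSection hθ hjc
    refine Eq.trans (Eq.symm ?_) θ.mk_repr
    exact Jet.mk_eq c θ.isLocalSection _ hb.symm (by rw [← h.1]) hθ
      (fun j hj => (h.2 j hj).symm)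
  right_inv' q hq := by
    replace hq : (q.1, q.2.value) ∈ c.total.target := hq
    rw [dif_pos hq]
    refine (c.jetCoord_mk (k := k) (c.isLocalSection_polySection hq) ?_).trans
      (c.jetCoord_polySection hq)
    rw [c.polySection_base hq]
    exact c.total.map_target hq

theorem FibredChart.jetChart_symm {k : ℕ} [Nonempty (Jet π k)] {q : JetModel n m k}
    (hq : (q.1, q.2.value) ∈ c.total.target) : (c.jetChart k).symm q =
      Jet.mk (c.polySection q) (c.base.symm q.1) (c.isLocalSection_polySection hq) :=
  dif_pos hq

/-- Change of jet coordinates. -/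
def FibredChart.jetChange (k : ℕ) (q : JetModel n m k) : JetModel n m k :=
  c'.jetCoord k (c.polySection q) (c.base.symm q.1)

theorem FibredChart.jetChart_change {k : ℕ} [Nonempty (Jet π k)] {q : JetModel n m k}
    (hq : (q.1, q.2.value) ∈ c.total.target)
    (hq' : c.total.symm (q.1, q.2.value) ∈ c'.total.source) :
    c'.jetChart k ((c.jetChart k).symm q) = c.jetChange c' k q := by
  rw [c.jetChart_symm hq]
  exact c'.jetCoord_mk (c.isLocalSection_polySection hq) (by rwa [c.polySection_base hq])

theorem FibredChart.jetChart_source {k : ℕ} [Nonempty (Jet π k)] :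
    ((c.jetChart k).symm.trans (c'.jetChart k)).source =
      {q | (q.1, q.2.value) ∈ c.total.target ∧
        c.total.symm (q.1, q.2.value) ∈ c'.total.source} := by
  ext q
  constructor
  · rintro ⟨h1, h2⟩
    refine ⟨h1, ?_⟩
    change Jet.target ((c.jetChart k).symm q) ∈ c'.total.source at h2
    rwa [c.jetChart_symm h1, Jet.target_mk, c.polySection_base h1] at h2
  · rintro ⟨h1, h2⟩
    refine ⟨h1, ?_⟩
    change Jet.target ((c.jetChart k).symm q) ∈ c'.total.source
    rwa [c.jetChart_symm h1, Jet.target_mk, c.polySection_base h1]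

theorem FibredChart.isOpen_jetChart_source {k : ℕ} [Nonempty (Jet π k)] :
    IsOpen ((c.jetChart k).symm.trans (c'.jetChart k)).source := by
  rw [FibredChart.jetChart_source]
  have h : Continuous (fun q : JetModel n m k => (q.1, q.2.value)) :=
    continuous_fst.prodMk (continuous_value.comp continuous_snd)
  exact (c.total.isOpen_inter_preimage_symm c'.total.open_source).preimage h

theorem FibredChart.jetChange_eq {k : ℕ} {q : JetModel n m k}
    (hq : (q.1, q.2.value) ∈ c.total.target)
    (hq' : c.total.symm (q.1, q.2.value) ∈ c'.total.source) :
    c.jetChange c' k q = (baseChange c c' q.1, JetFibre.ofDerivs k fun j => iteratedFDeriv ℝ j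
      (fun a => fibreChange c c' (baseChange c' c a, taylorPoly q.1 q.2 (baseChange c' c a)))
      (baseChange c c' q.1)) := by
  have hs := c.isLocalSection_polySection hq
  have hb := FibredChart.mem_base_target hq
  have hx : c.polySection q (c.base.symm q.1) ∈ c.total.source := by
    rw [c.polySection_base hq]; exact c.total.map_target hq
  have hx' : c.polySection q (c.base.symm q.1) ∈ c'.total.source := by
    rwa [c.polySection_base hq]
  have hb' := c'.mem_base hs hx'
  have hbb : baseChange c' c (c'.base (c.base.symm q.1)) = q.1 := by
    rw [baseChange, c'.base.left_inv hb', c.base.right_inv hb]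
  have hcont : Tendsto (baseChange c' c) (𝓝 (c'.base (c.base.symm q.1))) (𝓝 q.1) := by
    have := (contDiffAt_baseChange c' c (c'.base.map_source hb') (by
      rw [c'.base.left_inv hb']; exact c.base.map_target hb)).continuousAt
    rwa [ContinuousAt, hbb] at this
  have h2 := hcont.eventually (c.rep_polySection hq)
  have h : c'.rep (c.polySection q) =ᶠ[𝓝 (c'.base (c.base.symm q.1))]
      fun a => fibreChange c c' (baseChange c' c a, taylorPoly q.1 q.2 (baseChange c' c a)) := by
    filter_upwards [rep_change c c' hs hx hx', h2] with a ha ha2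
    rw [ha, ← ha2]
    rfl
  refine Prod.ext rfl (funext fun j => ?_)
  simp only [FibredChart.jetChange, FibredChart.jetCoord, JetFibre.ofDerivs]
  rw [(EventuallyEq.iteratedFDeriv ℝ h j).eq_of_nhds]
  rfl

theorem FibredChart.contDiffAt_jetChange {k : ℕ} {q : JetModel n m k}
    (hq : (q.1, q.2.value) ∈ c.total.target)
    (hq' : c.total.symm (q.1, q.2.value) ∈ c'.total.source) :
    ContDiffAt ℝ ∞ (c.jetChange c' k) q := by
  have hcont : Continuous (fun q : JetModel n m k => (q.1, q.2.value)) :=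
    continuous_fst.prodMk (continuous_value.comp continuous_snd)
  have hopen := (c.total.isOpen_inter_preimage_symm c'.total.open_source).preimage hcont
  have hev : ∀ᶠ q' : JetModel n m k in 𝓝 q, (q'.1, q'.2.value) ∈ c.total.target ∧
      c.total.symm (q'.1, q'.2.value) ∈ c'.total.source := hopen.mem_nhds ⟨hq, hq'⟩
  have hb := FibredChart.mem_base_target hq
  have hb' : c.base.symm q.1 ∈ c'.base.source := by
    have := c'.mem_base (c.isLocalSection_polySection hq) (by rwa [c.polySection_base hq])
    exact this
  have hbb : baseChange c' c (baseChange c c' q.1) = q.1 := by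
    rw [baseChange, baseChange, c'.base.left_inv hb', c.base.right_inv hb]
  have hχ' : ContDiffAt ℝ ∞ (baseChange c c') q.1 := contDiffAt_baseChange c c' hb hb'
  have hχ : ContDiffAt ℝ ∞ (baseChange c' c) (baseChange c c' q.1) :=
    contDiffAt_baseChange c' c (c'.base.map_source hb') (by
      rw [baseChange, c'.base.left_inv hb']; exact c.base.map_target hb)
  have hG : ContDiffAt ℝ ∞ (Function.uncurry fun (q : JetModel n m k) (a : BaseModel n) =>
      fibreChange c c' (baseChange c' c a, taylorPoly q.1 q.2 (baseChange c' c a)))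
      (q, baseChange c c' q.1) := by
    have h1 : ContDiffAt ℝ ∞ (fun r : JetModel n m k × BaseModel n => baseChange c' c r.2)
        (q, baseChange c c' q.1) :=
      ContDiffAt.comp (g := baseChange c' c) (q, baseChange c c' q.1) hχ contDiffAt_snd
    have h2 : ContDiffAt ℝ ∞ (fun r : JetModel n m k × BaseModel n =>
        taylorPoly r.1.1 r.1.2 (baseChange c' c r.2)) (q, baseChange c c' q.1) :=
      contDiff_taylorPoly_joint.contDiffAt.comp (q, baseChange c c' q.1)
        (f := fun r : JetModel n m k × BaseModel n => (r.1, baseChange c' c r.2))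
        (contDiffAt_fst.prodMk h1)
    have h3 : ContDiffAt ℝ ∞ (fibreChange c c')
        (baseChange c' c (baseChange c c' q.1),
          taylorPoly q.1 q.2 (baseChange c' c (baseChange c c' q.1))) := by
      rw [hbb, taylorPoly_self]
      exact contDiffAt_fibreChange c c' hq hq'
    exact ContDiffAt.comp (q, baseChange c c' q.1) h3 (h1.prodMk h2)
  have hD : ∀ j : ℕ, ContDiffAt ℝ ∞ (fun q : JetModel n m k =>
      iteratedFDeriv ℝ j (fun a => fibreChange c c'
        (baseChange c' c a, taylorPoly q.1 q.2 (baseChange c' c a))) (baseChange c c' q.1)) q := by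
    intro j
    exact ContDiffAt.comp q (contDiffAt_iteratedFDeriv_param _ j q _ hG)
      (f := fun q : JetModel n m k => (q, baseChange c c' q.1))
      (contDiffAt_id.prodMk (ContDiffAt.comp (g := baseChange c c') q hχ' contDiffAt_fst))
  refine ContDiffAt.congr_of_eventuallyEq ?_ (hev.mono fun q' h => c.jetChange_eq c' h.1 h.2)
  exact (ContDiffAt.comp (g := baseChange c c') q hχ' contDiffAt_fst).prodMk (contDiffAt_ofDerivs k hD)

end Bundles

section JetManifold

variable {n m : ℕ} {M E F : Type*}
  [TopologicalSpace M] [ChartedSpace (BaseModel n) M]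
  [TopologicalSpace E] [ChartedSpace (EuclideanSpace ℝ (Fin (n + 1 + m))) E]
  [TopologicalSpace F] [ChartedSpace (FibreModel m) F]
  {π : SmoothFiberBundle n m M E F} (c c' : FibredChart π) {k : ℕ}

theorem FibredChart.contDiffAt_chartChange [Nonempty (Jet π k)] {q : JetModel n m k}
    (hq : q ∈ ((c.jetChart k).symm.trans (c'.jetChart k)).source) :
    ContDiffAt ℝ ∞ (c'.jetChart k ∘ (c.jetChart k).symm) q ∧
      ∀ᶠ q' in 𝓝 q, (c'.jetChart k ((c.jetChart k).symm q')).1 = baseChange c c' q'.1 := by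
  have hev : ∀ᶠ q' in 𝓝 q, (c'.jetChart k ∘ (c.jetChart k).symm) q' = c.jetChange c' k q' := by
    filter_upwards [(c.isOpen_jetChart_source c').mem_nhds hq] with q' h
    rw [FibredChart.jetChart_source] at h
    exact c.jetChart_change c' h.1 h.2
  have hq2 := hq
  rw [FibredChart.jetChart_source] at hq2
  refine ⟨(c.contDiffAt_jetChange c' hq2.1 hq2.2).congr_of_eventuallyEq hev, ?_⟩
  filter_upwards [hev] with q' h
  exact congrArg Prod.fst h

variable [IsManifold (𝓡 (n + 1)) ∞ M] [IsManifold (𝓡 m) ∞ F]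

variable (π) in
/-- The jet coordinate charts of `J^k π`. -/
def jetChartedSpaceCore (k : ℕ) : ChartedSpaceCore (JetModel n m k) (Jet π k) where
  atlas := {e | ∃ (_ : Nonempty (Jet π k)) (c : FibredChart π), e = c.jetChart k}
  chartAt θ :=
    haveI : Nonempty (Jet π k) := ⟨θ⟩
    (exists_fibredChart π θ.target).choose.jetChart k
  mem_chart_source θ := (exists_fibredChart π θ.target).choose_spec
  chart_mem_atlas θ := ⟨⟨θ⟩, _, rfl⟩
  open_source := by
    rintro _ _ ⟨_, c, rfl⟩ ⟨_, c', rfl⟩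
    exact c.isOpen_jetChart_source c'
  continuousOn_toFun := by
    rintro _ _ ⟨_, c, rfl⟩ ⟨_, c', rfl⟩ q hq
    exact (c.contDiffAt_chartChange c' hq).1.continuousAt.continuousWithinAt

instance : TopologicalSpace (Jet π k) := (jetChartedSpaceCore π k).toTopologicalSpace

instance : ChartedSpace (JetModel n m k) (Jet π k) := (jetChartedSpaceCore π k).toChartedSpace

/-- A jet coordinate chart as a local homeomorphism. -/
def FibredChart.jetHomeo (k : ℕ) [h : Nonempty (Jet π k)] :
    OpenPartialHomeomorph (Jet π k) (JetModel n m k) :=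
  (jetChartedSpaceCore π k).openPartialHomeomorph (c.jetChart k) ⟨h, c, rfl⟩

theorem mem_atlas_jet {e : OpenPartialHomeomorph (Jet π k) (JetModel n m k)}
    (he : e ∈ atlas (JetModel n m k) (Jet π k)) :
    ∃ (_ : Nonempty (Jet π k)) (c : FibredChart π), e = c.jetHomeo k := by
  change e ∈ ⋃ (e : PartialEquiv (Jet π k) (JetModel n m k))
    (he : e ∈ (jetChartedSpaceCore π k).atlas), {_} at he
  simp only [mem_iUnion, mem_singleton_iff] at he
  obtain ⟨e', ⟨h, c, rfl⟩, he⟩ := he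
  exact ⟨h, c, he⟩

theorem FibredChart.jetHomeo_mem_atlas [h : Nonempty (Jet π k)] :
    c.jetHomeo k ∈ atlas (JetModel n m k) (Jet π k) := by
  change _ ∈ ⋃ (e : PartialEquiv (Jet π k) (JetModel n m k))
    (he : e ∈ (jetChartedSpaceCore π k).atlas), {_}
  simp only [mem_iUnion, mem_singleton_iff]
  exact ⟨_, ⟨h, c, rfl⟩, rfl⟩

instance : IsManifold 𝓘(ℝ, JetModel n m k) ∞ (Jet π k) := by
  refine isManifold_of_contDiffOn _ _ _ fun e e' he he' => ?_
  obtain ⟨_, c, rfl⟩ := mem_atlas_jet he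
  obtain ⟨_, c', rfl⟩ := mem_atlas_jet he'
  rintro q ⟨hq, -⟩
  exact (c.contDiffAt_chartChange c' hq).1.contDiffWithinAt

variable (π) in
theorem exists_jetHomeo (θ : Jet π k) : ∃ (_ : Nonempty (Jet π k)) (c : FibredChart π),
    θ.target ∈ c.total.source :=
  ⟨⟨θ⟩, exists_fibredChart π θ.target⟩

theorem Jet.contMDiff_base : ContMDiff 𝓘(ℝ, JetModel n m k) (𝓡 (n + 1)) ∞
    (Jet.base : Jet π k → M) := by
  intro θ
  obtain ⟨_, c, hc⟩ := exists_jetHomeo π θ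
  have h1 : ContMDiffAt 𝓘(ℝ, JetModel n m k) 𝓘(ℝ, JetModel n m k) ∞ (c.jetHomeo k) θ :=
    contMDiffAt_of_mem_maximalAtlas
      (IsManifold.subset_maximalAtlas (c.jetHomeo_mem_atlas)) hc
  have h2 : ContMDiffAt 𝓘(ℝ, JetModel n m k) (𝓡 (n + 1)) ∞
      (fun θ => (c.jetHomeo k θ).1) θ :=
    contDiff_fst.contMDiff.contMDiffAt.comp θ h1
  have h3 : ContMDiffAt (𝓡 (n + 1)) (𝓡 (n + 1)) ∞ c.base.symm (c.jetHomeo k θ).1 :=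
    c.smooth_base_symm.contMDiffAt (c.base.open_target.mem_nhds
      (c.base.map_source (c.mem_base θ.isLocalSection hc)))
  refine (h3.comp θ h2).congr_of_eventuallyEq ?_
  filter_upwards [(c.jetHomeo k).open_source.mem_nhds hc] with θ' h
  exact (c.base.left_inv (c.mem_base θ'.isLocalSection h)).symm

/-- Near a point, a section has smooth prolongations. -/
theorem contMDiffAt_prolong {s : M → E} {x : M} (hs : IsLocalSection π s x)
    (σ : M → Jet π k) (hσ : ∀ y (h : IsLocalSection π s y), σ y = Jet.mk s y h) :
    ContMDiffAt (𝓡 (n + 1)) 𝓘(ℝ, JetModel n m k) ∞ σ x := by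
  have : Nonempty (Jet π k) := ⟨Jet.mk s x hs⟩
  obtain ⟨c, hc⟩ := exists_fibredChart π (s x)
  have hb := c.mem_base hs hc
  have h1 : ContDiffAt ℝ ∞ (fun a => ((a, JetFibre.ofDerivs k fun j =>
      iteratedFDeriv ℝ j (c.rep s) a) : JetModel n m k)) (c.base x) :=
    contDiffAt_id.prodMk (contDiffAt_ofDerivs k fun j =>
      (c.contDiffAt_rep hs hc).iteratedFDeriv_right (by exact_mod_cast le_top))
  have h2 : ContMDiffAt (𝓡 (n + 1)) (𝓡 (n + 1)) ∞ c.base x :=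
    c.smooth_base.contMDiffAt (c.base.open_source.mem_nhds hb)
  have hcoord : c.jetHomeo k (Jet.mk s x hs) = c.jetCoord k s x := c.jetCoord_mk hs hc
  have hsrc : Jet.mk s x hs ∈ (c.jetHomeo k).source := by
    change Jet.target _ ∈ c.total.source
    rwa [Jet.target_mk]
  have h3 : ContMDiffAt 𝓘(ℝ, JetModel n m k) 𝓘(ℝ, JetModel n m k) ∞ (c.jetHomeo k).symm
      (c.jetCoord k s x) := by
    refine contMDiffOn_symm_of_mem_maximalAtlas
      (IsManifold.subset_maximalAtlas (c.jetHomeo_mem_atlas)) |>.contMDiffAt ?_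
    rw [← hcoord]
    exact (c.jetHomeo k).open_target.mem_nhds ((c.jetHomeo k).map_source hsrc)
  refine (h3.comp x (h1.contMDiffAt.comp x h2)).congr_of_eventuallyEq ?_
  filter_upwards [hs.eventually_mem c hc] with y hy
  rw [hσ y hy.1]
  have h4 : Jet.mk s y hy.1 ∈ (c.jetHomeo k).source := by
    change Jet.target _ ∈ c.total.source
    rw [Jet.target_mk]; exact hy.2
  have h5 := (c.jetHomeo k).left_inv h4
  have h6 : c.jetHomeo k (Jet.mk s y hy.1) = c.jetCoord k s y := c.jetCoord_mk hy.1 hy.2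
  rw [h6] at h5
  exact h5.symm

theorem Jet.trunc_mk {l : ℕ} (hl : l ≤ k) {s : M → E} {x : M} (h : IsLocalSection π s x) :
    (Jet.mk s x h : Jet π k).trunc l = Jet.mk s x h := by
  obtain ⟨c, hc⟩ := exists_fibredChart π (s x)
  have h1 := Jet.repr_mk (k := k) h
  exact Jet.mk_eq c _ h rfl h1.1 (by
    change (Jet.mk s x h : Jet π k).repr x ∈ _
    rwa [h1.1]) (fun j hj => h1.2 c hc j (hj.trans hl))

theorem Jet.contMDiff_trunc {l : ℕ} (hl : l ≤ k) :
    ContMDiff 𝓘(ℝ, JetModel n m k) 𝓘(ℝ, JetModel n m l) ∞ (Jet.trunc l : Jet π k → Jet π l) := by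
  intro θ
  obtain ⟨_, c, hc⟩ := exists_jetHomeo π θ
  have : Nonempty (Jet π l) := ⟨θ.trunc l⟩
  let r : JetFibre (BaseModel n) (FibreModel m) k → JetFibre (BaseModel n) (FibreModel m) l :=
    fun A => JetFibre.ofDerivs l fun j => if h : j < k + 1 then
      JetFibre.derivCLM _ _ k ⟨j, h⟩ A else 0
  have hr : ContDiff ℝ ∞ r := contDiff_iff_contDiffAt.2 fun A => contDiffAt_ofDerivs l fun j => by
    by_cases h : j < k + 1
    · simpa only [h, dif_pos] using (JetFibre.derivCLM (BaseModel n) (FibreModel m) k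
        ⟨j, h⟩).contDiff.contDiffAt
    · simp only [h, dif_neg, not_false_eq_true]
      exact contDiffAt_const
  have hcoord : ∀ θ' : Jet π k, θ'.target ∈ c.total.source →
      c.jetHomeo l (θ'.trunc l) = ((c.jetHomeo k θ').1, r (c.jetHomeo k θ').2) := by
    intro θ' h
    refine (c.jetCoord_mk (k := l) θ'.isLocalSection h).trans ?_
    refine Prod.ext rfl (funext fun j => congrArg (symmetrize _ _ j) ?_)
    have hj : (j : ℕ) < k + 1 := j.2.trans_le (by omega)
    simp only [hj, dif_pos]
    exact (c.derivCLM_jetCoord (k := k) θ'.isLocalSection h ⟨j, hj⟩).symm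
  have hmem : ∀ θ' : Jet π k, θ'.target ∈ c.total.source →
      θ'.trunc l ∈ (c.jetHomeo l).source := by
    intro θ' h
    change Jet.target (Jet.mk _ _ _) ∈ c.total.source
    rwa [Jet.target_mk]
  have h1 : ContMDiffAt 𝓘(ℝ, JetModel n m k) 𝓘(ℝ, JetModel n m k) ∞ (c.jetHomeo k) θ :=
    contMDiffAt_of_mem_maximalAtlas
      (IsManifold.subset_maximalAtlas (c.jetHomeo_mem_atlas)) hc
  have h2 : ContMDiff 𝓘(ℝ, JetModel n m k) 𝓘(ℝ, JetModel n m l) ∞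
      (fun q : JetModel n m k => ((q.1, r q.2) : JetModel n m l)) :=
    (contDiff_fst.prodMk (hr.comp contDiff_snd)).contMDiff
  have h3 : ContMDiffAt 𝓘(ℝ, JetModel n m l) 𝓘(ℝ, JetModel n m l) ∞ (c.jetHomeo l).symm
      ((c.jetHomeo k θ).1, r (c.jetHomeo k θ).2) := by
    refine contMDiffOn_symm_of_mem_maximalAtlas
      (IsManifold.subset_maximalAtlas (c.jetHomeo_mem_atlas)) |>.contMDiffAt ?_
    rw [← hcoord θ hc]
    exact (c.jetHomeo l).open_target.mem_nhds ((c.jetHomeo l).map_source (hmem θ hc))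
  refine (ContMDiffAt.comp θ h3 (h2.contMDiffAt.comp θ h1)).congr_of_eventuallyEq ?_
  filter_upwards [(c.jetHomeo k).open_source.mem_nhds hc] with θ' h
  have h5 := (c.jetHomeo l).left_inv (hmem θ' h)
  rw [hcoord θ' h] at h5
  exact h5.symm

end JetManifold

/-! ### The dual bundle `V^*P ⊗ Λ^{n}T^*M` of a fibred manifold `P → M`, `dim M = n + 1` -/

section Dual
variable (X V : Type*) [NormedAddCommGroup X] [NormedSpace ℝ X]
  [NormedAddCommGroup V] [NormedSpace ℝ V]
  (P : Type*) [TopologicalSpace P] [ChartedSpace (X × V) P]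

/-- The changes of charts `(x, v) ↦ (x', v')` of `P` are fibred: `x'` depends on `x` only. -/
class FibredAtlas : Prop where
  change_fst : ∀ i j : atlas (X × V) P, ∀ x ∈ i.1.source ∩ j.1.source, ∀ v : V,
    (fderiv ℝ (j.1 ∘ i.1.symm) (i.1 x) (0, v)).1 = 0

variable {X V P}

/-- The change of charts between vectors tangent to the base. -/
def baseBlock (i j : atlas (X × V) P) (x : P) : X →L[ℝ] X :=
  .fst ℝ X V ∘L fderiv ℝ (j.1 ∘ i.1.symm) (i.1 x) ∘L .inl ℝ X V

/-- The change of charts between vertical vectors. -/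
def verticalBlock (i j : atlas (X × V) P) (x : P) : V →L[ℝ] V :=
  .snd ℝ X V ∘L fderiv ℝ (j.1 ∘ i.1.symm) (i.1 x) ∘L .inr ℝ X V

variable [IsManifold 𝓘(ℝ, X × V) 1 P]

theorem tangent_coordChange_eq (i j : atlas (X × V) P) (x : P) :
    (tangentBundleCore 𝓘(ℝ, X × V) P).coordChange i j x =
      fderiv ℝ (j.1 ∘ i.1.symm) (i.1 x) := by
  change fderivWithin ℝ _ (range 𝓘(ℝ, X × V)) _ = _
  rw [ModelWithCorners.range_eq_univ, fderivWithin_univ]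
  rfl

theorem block_self (i : atlas (X × V) P) {x : P} (hx : x ∈ i.1.source) :
    baseBlock i i x = .id ℝ X ∧ verticalBlock i i x = .id ℝ V := by
  have h := (tangentBundleCore 𝓘(ℝ, X × V) P).coordChange_self i x hx
  simp only [tangent_coordChange_eq] at h
  constructor <;> ext v
  · change (fderiv ℝ (i.1 ∘ i.1.symm) (i.1 x) (v, 0)).1 = v
    rw [h]
  · change (fderiv ℝ (i.1 ∘ i.1.symm) (i.1 x) (0, v)).2 = v
    rw [h]

theorem block_comp [FibredAtlas X V P] (i j k : atlas (X × V) P) {x : P}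
    (hi : x ∈ i.1.source) (hj : x ∈ j.1.source) (hk : x ∈ k.1.source) :
    baseBlock j k x ∘L baseBlock i j x = baseBlock i k x ∧
      verticalBlock j k x ∘L verticalBlock i j x = verticalBlock i k x := by
  have h := (tangentBundleCore 𝓘(ℝ, X × V) P).coordChange_comp i j k x ⟨⟨hi, hj⟩, hk⟩
  simp only [tangent_coordChange_eq] at h
  set T := fderiv ℝ (j.1 ∘ i.1.symm) (i.1 x) with hT
  set S := fderiv ℝ (k.1 ∘ j.1.symm) (j.1 x) with hS
  have hS0 : ∀ v : V, (S (0, v)).1 = 0 := FibredAtlas.change_fst j k x ⟨hj, hk⟩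
  have hT0 : ∀ v : V, (T (0, v)).1 = 0 := FibredAtlas.change_fst i j x ⟨hi, hj⟩
  constructor <;> ext v
  · change (S ((T (v, 0)).1, 0)).1 = (fderiv ℝ (k.1 ∘ i.1.symm) (i.1 x) (v, 0)).1
    rw [← h]
    have : T (v, 0) = ((T (v, 0)).1, 0) + (0, (T (v, 0)).2) := by simp
    conv_rhs => rw [this, map_add, Prod.fst_add, hS0, add_zero]
  · change (S (0, (T (0, v)).2)).2 = (fderiv ℝ (k.1 ∘ i.1.symm) (i.1 x) (0, v)).2
    rw [← h]
    congr 2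
    exact Prod.ext (hT0 v).symm rfl

theorem continuousOn_block (i j : atlas (X × V) P) :
    ContinuousOn (baseBlock i j) (i.1.source ∩ j.1.source) ∧
      ContinuousOn (verticalBlock i j) (i.1.source ∩ j.1.source) := by
  have h := (tangentBundleCore 𝓘(ℝ, X × V) P).continuousOn_coordChange i j
  have h' : ContinuousOn (fun x => fderiv ℝ (j.1 ∘ i.1.symm) (i.1 x))
      (i.1.source ∩ j.1.source) := h.congr fun x _ => (tangent_coordChange_eq i j x).symm
  exact ⟨continuousOn_const.clm_comp (h'.clm_comp continuousOn_const),
    continuousOn_const.clm_comp (h'.clm_comp continuousOn_const)⟩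

variable (X V P)

/-- The vector bundle `V^*P ⊗ Λ^{n}T^*M → P`.  The fibre at `θ` consists of the linear maps from
vertical vectors at `θ` to `n`-covectors of the base, expressed in the preferred chart at `θ`
(in which `T_θP = X × V`, vertical vectors are those in `0 × V`, and `X` is the tangent space
of the base). -/
def dualCore (n : ℕ) [FibredAtlas X V P] :
    VectorBundleCore ℝ P (V →L[ℝ] X [⋀^Fin n]→L[ℝ] ℝ) (atlas (X × V) P) where
  baseSet i := i.1.source
  isOpen_baseSet i := i.1.open_source
  indexAt := achart (X × V)
  mem_baseSet_at := mem_chart_source (X × V)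
  coordChange i j x :=
    (ContinuousLinearMap.compL ℝ V (X [⋀^Fin n]→L[ℝ] ℝ) (X [⋀^Fin n]→L[ℝ] ℝ)
      (ContinuousAlternatingMap.compContinuousLinearMapCLM (baseBlock j i x))) ∘L
    (ContinuousLinearMap.compL ℝ V V (X [⋀^Fin n]→L[ℝ] ℝ)).flip (verticalBlock j i x)
  coordChange_self i x hx p := by
    rw [(block_self i hx).1, (block_self i hx).2]
    ext v u
    rfl
  continuousOn_coordChange i j := by
    have h := continuousOn_block (P := P) (X := X) (V := V) j i
    rw [inter_comm] at h
    have h1 : ContinuousOn (fun x => ContinuousLinearMap.compL ℝ V (X [⋀^Fin n]→L[ℝ] ℝ)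
        (X [⋀^Fin n]→L[ℝ] ℝ) (ContinuousAlternatingMap.compContinuousLinearMapCLM
          (baseBlock j i x))) (i.1.source ∩ j.1.source) :=
      (ContinuousLinearMap.compL ℝ V (X [⋀^Fin n]→L[ℝ] ℝ)
        (X [⋀^Fin n]→L[ℝ] ℝ)).continuous.comp_continuousOn
        (ContinuousAlternatingMap.continuous_compContinuousLinearMapCLM.comp_continuousOn h.1)
    have h2 : ContinuousOn (fun x => (ContinuousLinearMap.compL ℝ V V
        (X [⋀^Fin n]→L[ℝ] ℝ)).flip (verticalBlock j i x)) (i.1.source ∩ j.1.source) :=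
      (ContinuousLinearMap.compL ℝ V V
        (X [⋀^Fin n]→L[ℝ] ℝ)).flip.continuous.comp_continuousOn h.2
    exact h1.clm_comp h2
  coordChange_comp i j k x hx p := by
    have h := block_comp (P := P) (X := X) (V := V) k j i hx.2 hx.1.2 hx.1.1
    rw [← h.1, ← h.2]
    ext v u
    rfl

end Dual

/-! ### Differential forms on manifolds -/

section Forms
variable {EP HP P : Type*} [NormedAddCommGroup EP] [NormedSpace ℝ EP] [TopologicalSpace HP]
  [TopologicalSpace P] [ChartedSpace HP P] {I : ModelWithCorners ℝ EP HP}

variable (I P) in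
/-- (Not necessarily smooth) differential forms of degree `k`. -/
abbrev DForm (k : ℕ) : Type _ := (p : P) → TangentSpace I p [⋀^Fin k]→L[ℝ] ℝ

variable {k : ℕ}

/-- The coordinate expression of a form in the preferred chart at `p`. -/
def DForm.inChart (Ω : DForm P I k) (p : P) (y : EP) : EP [⋀^Fin k]→L[ℝ] ℝ :=
  (Ω ((extChartAt I p).symm y)).compContinuousLinearMap
    (mfderiv 𝓘(ℝ, EP) I (extChartAt I p).symm y)

/-- Smoothness of a differential form on a manifold without boundary. -/
def DForm.IsSmooth (Ω : DForm P I k) : Prop :=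
  ∀ p, ContDiffOn ℝ ∞ (Ω.inChart p) (extChartAt I p).target

/-- The exterior derivative `dΩ` on a manifold without boundary. -/
def DForm.d (Ω : DForm P I k) : DForm P I (k + 1) := fun p =>
  (extDeriv (Ω.inChart p) (extChartAt I p p)).compContinuousLinearMap
    (mfderiv I 𝓘(ℝ, EP) (extChartAt I p) p)

/-- The pull-back `f^*Ω`. -/
def DForm.pullback {EN HN N : Type*} [NormedAddCommGroup EN] [NormedSpace ℝ EN]
    [TopologicalSpace HN] [TopologicalSpace N] [ChartedSpace HN N] {J : ModelWithCorners ℝ EN HN}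
    (f : N → P) (Ω : DForm P I k) : DForm N J k := fun p =>
  (Ω (f p)).compContinuousLinearMap (mfderiv J I f p)

end Forms

/-! ### First jets of a fibred manifold `ξ : P → M` -/

section FirstJets
variable {n : ℕ} {M : Type*} [TopologicalSpace M] [ChartedSpace (BaseModel n) M]
  {EP HP P : Type*} [NormedAddCommGroup EP] [NormedSpace ℝ EP] [TopologicalSpace HP]
  [TopologicalSpace P] [ChartedSpace HP P]

variable (n) in
/-- A point of `J^1ξ`: a point `y` of `P` with a right inverse `T_{ξ(y)}M → T_yP` of `d_yξ`, i.e.,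
with the tangent map of a local section through `y`. -/
@[ext]
structure FirstJet (I : ModelWithCorners ℝ EP HP) (ξ : P → M) where
  /-- the point `y`, i.e., the image under `ξ_{1,0}` -/
  point : P
  /-- the tangent map -/
  lin : TangentSpace (𝓡 (n + 1)) (ξ point) →L[ℝ] TangentSpace I point
  splitting : (mfderiv I (𝓡 (n + 1)) ξ point).comp lin = .id ℝ _

variable {I : ModelWithCorners ℝ EP HP}

/-- The first jet prolongation `J^1(ξ ∘ f) → J^1ξ` of a morphism `f : N → P` over `M`. -/
def FirstJet.push {EN HN N : Type*} [NormedAddCommGroup EN] [NormedSpace ℝ EN]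
    [TopologicalSpace HN] [TopologicalSpace N] [ChartedSpace HN N] {J : ModelWithCorners ℝ EN HN}
    {ξ : P → M} {f : N → P} (hξ : MDifferentiable I (𝓡 (n + 1)) ξ) (hf : MDifferentiable J I f)
    (z : FirstJet n J (ξ ∘ f)) : FirstJet n I ξ where
  point := f z.point
  lin := (mfderiv J I f z.point).comp z.lin
  splitting := by
    rw [← ContinuousLinearMap.comp_assoc, ← mfderiv_comp z.point (hξ _) (hf _)]
    exact z.splitting

/-- For an `(n+2)`-form `Ω` on `P`, the set of the first jets `z` at `y` with
`i^{1,n+1}(z)(Ω|_y) = 0`, i.e., such that `Ω(v, z(u_0), …, z(u_n)) = 0` for every vertical tangent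
vector `v` at `y` and all `u_0, …, u_n` tangent to the base. -/
def pdKernel (ξ : P → M) (Ω : DForm P I (n + 2)) (y : P) : Set (FirstJet n I ξ) :=
  {z | z.point = y ∧ ∀ v : TangentSpace I z.point, mfderiv I (𝓡 (n + 1)) ξ z.point v = 0 →
    ∀ u : Fin (n + 1) → TangentSpace (𝓡 (n + 1)) (ξ z.point),
      Ω z.point (Fin.cons (α := fun _ => TangentSpace I z.point) v (fun i => z.lin (u i))) = 0}

end FirstJets

/-! ### The dual bundle of a jet bundle -/

section DualJets
variable {n m : ℕ} {M E F : Type*}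
  [TopologicalSpace M] [ChartedSpace (BaseModel n) M]
  [TopologicalSpace E] [ChartedSpace (EuclideanSpace ℝ (Fin (n + 1 + m))) E]
  [TopologicalSpace F] [ChartedSpace (FibreModel m) F]
  [IsManifold (𝓡 (n + 1)) ∞ M] [IsManifold (𝓡 m) ∞ F]

instance (π : SmoothFiberBundle n m M E F) (k : ℕ) :
    FibredAtlas (BaseModel n) (JetFibre (BaseModel n) (FibreModel m) k) (Jet π k) where
  change_fst := by
    rintro ⟨_, hi⟩ ⟨_, hj⟩ x hx v
    obtain ⟨_, c, rfl⟩ := mem_atlas_jet hi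
    obtain ⟨_, c', rfl⟩ := mem_atlas_jet hj
    have hq : c.jetHomeo k x ∈ ((c.jetChart k).symm.trans (c'.jetChart k)).source := by
      refine ⟨(c.jetHomeo k).map_source hx.1, ?_⟩
      change (c.jetHomeo k).symm (c.jetHomeo k x) ∈ (c'.jetHomeo k).source
      rw [(c.jetHomeo k).left_inv hx.1]
      exact hx.2
    obtain ⟨h1, h2⟩ := c.contDiffAt_chartChange c' hq
    have hd : DifferentiableAt ℝ (c'.jetHomeo k ∘ (c.jetHomeo k).symm) (c.jetHomeo k x) :=
      h1.differentiableAt (by simp)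
    have hb : DifferentiableAt ℝ (baseChange c c') (c.jetHomeo k x).1 := by
      have hxb := c.mem_base x.isLocalSection hx.1
      have hxb' := c'.mem_base x.isLocalSection hx.2
      refine (contDiffAt_baseChange c c' (c.base.map_source hxb) ?_).differentiableAt (by simp)
      rwa [c.base.left_inv hxb]
    have h3 := (hasFDerivAt_fst (𝕜 := ℝ)
      (p := (c'.jetHomeo k ∘ (c.jetHomeo k).symm) (c.jetHomeo k x))).comp _ hd.hasFDerivAt
    have h4 := (hb.hasFDerivAt.comp (c.jetHomeo k x) hasFDerivAt_fst).congr_of_eventuallyEq h2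
    have h5 := DFunLike.congr_fun (h3.unique h4) (0, v)
    simpa using h5

instance (π : SmoothFiberBundle n m M E F) (k : ℕ) :
    IsManifold 𝓘(ℝ, JetModel n m k) 1 (Jet π k) :=
  IsManifold.of_le (n := ∞) (by exact_mod_cast le_top)

/-- Model fibre of the bundle `J†π_l → J^lπ`. -/
abbrev DualFibre (n m l : ℕ) :=
  JetFibre (BaseModel n) (FibreModel m) l →L[ℝ] BaseModel n [⋀^Fin n]→L[ℝ] ℝ

/-- The vector bundle `J†π_l = V^*J^lπ ⊗ Λ^{dim M - 1}T^*M` over `J^lπ`. -/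
def dualJetCore (π : SmoothFiberBundle n m M E F) (l : ℕ) :
    VectorBundleCore ℝ (Jet π l) (DualFibre n m l) (atlas (JetModel n m l) (Jet π l)) :=
  dualCore (BaseModel n) (JetFibre (BaseModel n) (FibreModel m) l) (Jet π l) n

/-- The total space of `J†π_l`. -/
abbrev DualJet (π : SmoothFiberBundle n m M E F) (l : ℕ) :=
  Bundle.TotalSpace (DualFibre n m l) (dualJetCore π l).Fiber

/-- The projection `π_{l+1,l}` as a smooth map. -/
def truncMap (π : SmoothFiberBundle n m M E F) (l : ℕ) :
    C^∞⟮𝓘(ℝ, JetModel n m (l + 1)), Jet π (l + 1); 𝓘(ℝ, JetModel n m l), Jet π l⟯ :=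
  ⟨Jet.trunc l, Jet.contMDiff_trunc (Nat.le_succ l)⟩

/-- The total space `W` of the pull-back `π_{l+1,l}^∘(J†π_l) → J^{l+1}π`; its projection
`𝔭 : W → J^{l+1}π` is `TotalSpace.proj`. -/
abbrev MixedSpace (π : SmoothFiberBundle n m M E F) (l : ℕ) :=
  Bundle.TotalSpace (DualFibre n m l)
    (Bundle.Pullback (truncMap π l : Jet π (l + 1) → Jet π l) (dualJetCore π l).Fiber)

/-- Model with corners of `J†π_l`. -/
abbrev dualModel (n m l : ℕ) := 𝓘(ℝ, JetModel n m l).prod 𝓘(ℝ, DualFibre n m l)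

/-- Model with corners of `W`. -/
abbrev mixedModel (n m l : ℕ) := 𝓘(ℝ, JetModel n m (l + 1)).prod 𝓘(ℝ, DualFibre n m l)

variable {π : SmoothFiberBundle n m M E F} {l : ℕ}

/-- The projection `W → J†π_l`. -/
def MixedSpace.toDual (w : MixedSpace π l) : DualJet π l := Bundle.Pullback.lift (truncMap π l) w

/-- The projection `W → J^lπ`. -/
def MixedSpace.toJet (w : MixedSpace π l) : Jet π l := truncMap π l w.proj

/-- The projection `W → M`. -/
def MixedSpace.base (w : MixedSpace π l) : M := w.proj.base

/-- The projection `τ_0† : J†π_l → J^lπ`. -/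
def tau0 (P : DualJet π l) : Jet π l := P.proj

theorem contMDiff_tau0 : ContMDiff (dualModel n m l) 𝓘(ℝ, JetModel n m l) ∞
    (tau0 : DualJet π l → Jet π l) := Bundle.contMDiff_proj _

/-- The projection `τ† : J†π_l → M`. -/
def tau : DualJet π l → M := Jet.base ∘ tau0

/-! ### The Cartan embedding and the map `h` -/

open Classical in
/-- The jet prolongation `j_ks`, where `s` is a section (and `θ₀` elsewhere). -/
def prolong {k : ℕ} (s : M → E) (θ₀ : Jet π k) (y : M) : Jet π k :=
  if h : IsLocalSection π s y then Jet.mk s y h else θ₀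

/-- The first jet `j_1(j_ks)(x)` of the prolongation of a local section `s`. -/
def firstJetOfSection {k : ℕ} (s : M → E) (x : M) (h : IsLocalSection π s x) :
    FirstJet n 𝓘(ℝ, JetModel n m k) (Jet.base : Jet π k → M) where
  point := Jet.mk s x h
  lin := mfderiv (𝓡 (n + 1)) 𝓘(ℝ, JetModel n m k) (prolong s (Jet.mk s x h)) x
  splitting := by
    have hx : prolong s (Jet.mk s x h : Jet π k) x = Jet.mk s x h := dif_pos h
    have h1 : MDifferentiableAt (𝓡 (n + 1)) 𝓘(ℝ, JetModel n m k)
        (prolong s (Jet.mk s x h : Jet π k)) x :=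
      (contMDiffAt_prolong h _ fun y hy => dif_pos hy).mdifferentiableAt (by simp)
    have h2 := mfderiv_comp (I'' := 𝓡 (n + 1)) x
      (Jet.contMDiff_base.mdifferentiable (by simp) _) h1
    have h3 : (Jet.base : Jet π k → M) ∘ prolong s (Jet.mk s x h) =ᶠ[𝓝 x] id := by
      filter_upwards [eventually_eventually_nhds.2 h] with y hy
      have : prolong s (Jet.mk s x h : Jet π k) y = Jet.mk s y hy := dif_pos hy
      rw [Function.comp_apply, this]
      rfl
    rw [h3.mfderiv_eq, mfderiv_id, hx] at h2
    exact h2.symm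

/-- The Cartan embedding `𝒞 : J^{l+1}π → J^1π_l`, `(j_{l+1}s)(x) ↦ j_1(j_ls)(x)`. -/
def cartan (θ : Jet π (l + 1)) : FirstJet n 𝓘(ℝ, JetModel n m l) (Jet.base : Jet π l → M) :=
  firstJetOfSection θ.repr θ.base θ.isLocalSection

/-- The vertical part `v ↦ v - z(dπ_l(v))` of tangent vectors of `J^lπ` determined by
`z ∈ J^1π_l`. -/
def verticalPart (z : FirstJet n 𝓘(ℝ, JetModel n m l) (Jet.base : Jet π l → M)) :
    JetModel n m l →L[ℝ] JetFibre (BaseModel n) (FibreModel m) l :=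
  .snd ℝ (BaseModel n) (JetFibre (BaseModel n) (FibreModel m) l) ∘L
    ((.id ℝ (TangentSpace 𝓘(ℝ, JetModel n m l) z.point) -
      z.lin ∘L mfderiv 𝓘(ℝ, JetModel n m l) (𝓡 (n + 1)) Jet.base z.point :) :
        JetModel n m l →L[ℝ] JetModel n m l)

/-- For `z ∈ J^1π_l` over `θ`, the linear map `J†_θ → Λ^{dim M}T_θ^*J^lπ` which reads an element
`p` of `V_θ^* ⊗ Λ^{dim M - 1}T^*M` as an exterior form, by means of the splitting
`T_θJ^lπ = im z ⊕ V_θ`: locally, `p_α^{I.i} ↦ p_α^{I.i}(du^α_I - z^α_{I|j}dx^j) ∧ d^{n}x_i`. -/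
def exteriorOfDual (z : FirstJet n 𝓘(ℝ, JetModel n m l) (Jet.base : Jet π l → M)) :
    DualFibre n m l →L[ℝ] (JetModel n m l [⋀^Fin (n + 1)]→L[ℝ] ℝ) :=
  ContinuousAlternatingMap.alternatizeUncurryFinCLM ℝ (JetModel n m l) ℝ ∘L
    ContinuousLinearMap.compL ℝ (JetModel n m l) (BaseModel n [⋀^Fin n]→L[ℝ] ℝ)
      (JetModel n m l [⋀^Fin n]→L[ℝ] ℝ) (ContinuousAlternatingMap.compContinuousLinearMapCLM
        (.fst ℝ (BaseModel n) (JetFibre (BaseModel n) (FibreModel m) l))) ∘L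
    (ContinuousLinearMap.compL ℝ (JetModel n m l) (JetFibre (BaseModel n) (FibreModel m) l)
      (BaseModel n [⋀^Fin n]→L[ℝ] ℝ)).flip (verticalPart z)

/-- The map `h : W → 𝓜π_l`; the value at `w` is a form on `T_θJ^lπ`, `θ` the projection
of `w`. -/
def hMap (w : MixedSpace π l) :
    TangentSpace 𝓘(ℝ, JetModel n m l) w.toJet [⋀^Fin (n + 1)]→L[ℝ] ℝ :=
  exteriorOfDual (cartan w.proj) w.2

end DualJets

section Lagrangian
variable {n m : ℕ} {M E F : Type*}
  [TopologicalSpace M] [ChartedSpace (BaseModel n) M]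
  [TopologicalSpace E] [ChartedSpace (EuclideanSpace ℝ (Fin (n + 1 + m))) E]
  [TopologicalSpace F] [ChartedSpace (FibreModel m) F]
  [IsManifold (𝓡 (n + 1)) ∞ M] [IsManifold (𝓡 m) ∞ F]
  {π : SmoothFiberBundle n m M E F} {l : ℕ}

/-! ### Lagrangian densities, the form `θ'` and the first constraint submanifold -/

variable (π) in
/-- A Lagrangian density of order `k`: an element of `Λ^{dim M}_{dim M}(J^kπ, π_k)`, i.e., a
smooth horizontal form of top degree, given at `θ` by a top degree covector of `T_{π_k(θ)}M`. -/
structure LagrangianDensity (k : ℕ) where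
  /-- the top degree covector of the base -/
  toFun : (θ : Jet π k) → TangentSpace (𝓡 (n + 1)) θ.base [⋀^Fin (n + 1)]→L[ℝ] ℝ
  smooth : DForm.IsSmooth (P := Jet π k) (I := 𝓘(ℝ, JetModel n m k)) fun θ =>
    (toFun θ).compContinuousLinearMap (mfderiv 𝓘(ℝ, JetModel n m k) (𝓡 (n + 1)) Jet.base θ)

namespace LagrangianDensity
variable (L : LagrangianDensity π (l + 1))

/-- The map `𝕃 : W → 𝓜π_l` with `𝕃^*Θ = 𝔭^*𝓛`. -/
def momentum (w : MixedSpace π l) :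
    TangentSpace 𝓘(ℝ, JetModel n m l) w.toJet [⋀^Fin (n + 1)]→L[ℝ] ℝ :=
  (L.toFun w.proj).compContinuousLinearMap
    (mfderiv 𝓘(ℝ, JetModel n m l) (𝓡 (n + 1)) Jet.base w.toJet)

/-- The form `h^*Θ` on `W`, where `Θ` is the tautological form. -/
def pullbackTheta : DForm (MixedSpace π l) (mixedModel n m l) (n + 1) := fun w =>
  (hMap w).compContinuousLinearMap
    (mfderiv (mixedModel n m l) 𝓘(ℝ, JetModel n m l) MixedSpace.toJet w)

/-- The form `𝔭^*𝓛` on `W`. -/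
def pullbackLagrangian : DForm (MixedSpace π l) (mixedModel n m l) (n + 1) := fun w =>
  (L.toFun w.proj).compContinuousLinearMap
    (mfderiv (mixedModel n m l) (𝓡 (n + 1)) MixedSpace.base w)

/-- The form `θ' = h^*Θ + 𝔭^*𝓛` on `W`. -/
def thetaPrime : DForm (MixedSpace π l) (mixedModel n m l) (n + 1) := fun w =>
  pullbackTheta w + L.pullbackLagrangian w

/-- The first constraint submanifold `𝒫 ⊆ W` of `dθ'`. -/
def constraintSet : Set (MixedSpace π l) :=
  {w | (pdKernel MixedSpace.base L.thetaPrime.d w).Nonempty}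

/-- Hyperregularity: the map `𝒫 → J†` is a diffeomorphism, i.e., it is bijective and its inverse
is smooth (as a map to `W`). -/
structure IsHyperregular : Prop where
  bijective : Function.Bijective fun w : L.constraintSet => w.1.toDual
  contMDiff_symm : ContMDiff (dualModel n m l) (mixedModel n m l) ∞
    fun P : DualJet π l => ((Equiv.ofBijective _ bijective).symm P).1

variable {L}

namespace IsHyperregular
variable (hL : L.IsHyperregular)

/-- The section `𝔰 : J† → W`, inverse of `𝒫 → J†`. -/
def invSection (P : DualJet π l) : MixedSpace π l := ((Equiv.ofBijective _ hL.bijective).symm P).1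

/-- The inverse Legendre transform `leg⁻¹ = 𝔭 ∘ 𝔰 : J† → J^{l+1}`. -/
def legInv (P : DualJet π l) : Jet π (l + 1) := (hL.invSection P).proj

/-- The form `θ = 𝔰^*θ'` on `J†`. -/
def theta : DForm (DualJet π l) (dualModel n m l) (n + 1) := L.thetaPrime.pullback hL.invSection

/-- The form `ω = dθ` on `J†`. -/
def omega : DForm (DualJet π l) (dualModel n m l) (n + 2) := hL.theta.d

/-- `Ker ω|_P`. -/
def ker (P : DualJet π l) : Set (FirstJet n (dualModel n m l) (tau : DualJet π l → M)) :=
  pdKernel tau hL.omega P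

/-- The Hamiltonian section `𝓗 = (h + 𝕃) ∘ 𝔰 : J† → 𝓜π_l`. -/
def hamiltonian (P : DualJet π l) :
    TangentSpace 𝓘(ℝ, JetModel n m l) P.proj [⋀^Fin (n + 1)]→L[ℝ] ℝ :=
  hMap (hL.invSection P) + L.momentum (hL.invSection P)

end IsHyperregular
end LagrangianDensity

/-- The map `(τ_0†)_{[1]} : J^1τ† → J^1π_l`. -/
def tau0Jet (z : FirstJet n (dualModel n m l) (tau : DualJet π l → M)) :
    FirstJet n 𝓘(ℝ, JetModel n m l) (Jet.base : Jet π l → M) :=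
  z.push (Jet.contMDiff_base.mdifferentiable (by simp))
    (contMDiff_tau0.mdifferentiable (by simp))

open Classical in
/-- The map `𝔽𝓗 : J† → J^1π_l`, `P ↦ (τ_0†)_{[1]}(z)` with `z ∈ Ker ω|_P`
(an arbitrary first jet over `P` if there were no such `z`). -/
def LagrangianDensity.IsHyperregular.fiberDerivative {L : LagrangianDensity π (l + 1)}
    (hL : L.IsHyperregular) (P : DualJet π l) :
    FirstJet n 𝓘(ℝ, JetModel n m l) (Jet.base : Jet π l → M) :=
  if h : (hL.ker P).Nonempty then tau0Jet h.some
  else firstJetOfSection P.proj.repr P.proj.base P.proj.isLocalSection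

end Lagrangian

end JetLegendre

end

open JetLegendre

noncomputable section

namespace JetLegendre

/-! Everything rests on one formula for the contraction of `dθ'` at points of `𝒫`. In a bundle chart
of W with coordinates (q, p), q a jet of order l + 1 and p the momenta, the projection W → J^l is a
linear map R. There θ' is the pull-back along R of G(q, p) = p(du - C(A) dx) + 𝓛(q), where A is the
derivative part of q and C is the Cartan embedding in coordinates (`thetaPrime_inChart`). If Rv = 0,
every term of dθ'(v, ξ₀, …, ξₙ) in which v is an argument of the form vanishes, so the contraction
is (D_v G)(Rξ₀, …, Rξₙ) (`model_d_thetaPrime_cons`).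

Write such a vector as v = (q, p). The momenta enter G linearly, and the direction (0, p) gives
e_{𝒞(ϑ)}(p). The jet enters only through C(A) dx and 𝓛, so the derivative along (q, 0) is a
horizontal form of top degree. At a point of `𝒫` there is some z in Ker dθ'. The horizontal form
vanishes on the vectors z(u), and these project onto the whole tangent space of the base, so it is
zero. Hence on `𝒫` the contraction of dθ' with v is the pull-back of e_{𝒞(ϑ)}(p): the directions of
highest order drop out (`fderiv_coordMomentum_of_mem`, `model_d_thetaPrime_cons_of_mem`).

The theorem is read off from this formula at 𝔰(P). Here ω = 𝔰^*dθ', and d𝔰 is a right inverse of the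
derivative of W → J†.

Existence (`ker_nonempty`): push an element z of Ker dθ' down to J†. Applying d𝔰 to the result
changes z only by vectors killed by W → J†, and these contract dθ' to zero.

Uniqueness and the formula 𝔽𝓗 = 𝒞 ∘ leg⁻¹ (`tau0Jet_eq`): testing z ∈ Ker ω against the fibre
directions (0, p) gives e_{𝒞(ϑ)}(p)(ζ(u₀), …, ζ(uₙ)) = 0 for all p, where ζ is the image of z on
J^l. The pairing is nondegenerate (`eq_zero_of_forall_dual`), so ζ has no vertical part relative to
𝒞(ϑ), i.e. ζ = 𝒞(ϑ).

Fibre derivative (`hasFDerivAt_totalMomentum`): on a fibre 𝓗 is G ∘ 𝔰 in coordinates, and d𝔰(0, p)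
is vertical over J^l with momentum component p, so the chain rule gives e_{𝒞(ϑ)}(p).

Unique factorization is the injectivity of 𝒞 (`cartan_injective`): a jet is recovered from its
truncation and the first derivatives of the truncated prolongation. -/

theorem two_le_infty : (2 : ℕ∞ω) ≤ ∞ := ENat.LEInfty.out

/-! ### Forms and derivatives read in the model spaces; naturality of d -/

section FormsCalculus
variable {EP HP P : Type*} [NormedAddCommGroup EP] [NormedSpace ℝ EP] [TopologicalSpace HP]
  [TopologicalSpace P] [ChartedSpace HP P] {I : ModelWithCorners ℝ EP HP} {k : ℕ}
  {EN HN N : Type*} [NormedAddCommGroup EN] [NormedSpace ℝ EN]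
  [TopologicalSpace HN] [TopologicalSpace N] [ChartedSpace HN N] {J : ModelWithCorners ℝ EN HN}
  {EQ HQ Q : Type*} [NormedAddCommGroup EQ] [NormedSpace ℝ EQ] [TopologicalSpace HQ]
  [TopologicalSpace Q] [ChartedSpace HQ Q] {K : ModelWithCorners ℝ EQ HQ}

/-- The derivative of a map of manifolds, as a map between the model spaces. -/
def modelDeriv (J : ModelWithCorners ℝ EN HN) (I : ModelWithCorners ℝ EP HP) (f : N → P) (p : N) :
    EN →L[ℝ] EP := mfderiv J I f p

theorem modelDeriv_comp {g : P → Q} {f : N → P} (p : N) (hg : MDifferentiableAt I K g (f p))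
    (hf : MDifferentiableAt J I f p) :
    modelDeriv J K (g ∘ f) p = modelDeriv I K g (f p) ∘L modelDeriv J I f p :=
  mfderiv_comp p hg hf

theorem modelDeriv_congr {f g : N → P} {p : N} (h : f =ᶠ[𝓝 p] g) :
    modelDeriv J I f p = modelDeriv J I g p :=
  h.mfderiv_eq

theorem modelDeriv_eq_fderiv {f : EN → EP} {y : EN} :
    modelDeriv 𝓘(ℝ, EN) 𝓘(ℝ, EP) f y = fderiv ℝ f y :=
  mfderiv_eq_fderiv

theorem modelDeriv_id (p : N) : modelDeriv J J id p = .id ℝ EN := mfderiv_id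

/-- Tangent vectors at p are by construction read in the preferred chart at p. This is why an
identity at p can be checked in that chart without any transition factor. -/
theorem modelDeriv_extChartAt_self [I.Boundaryless] [IsManifold I 1 P] (p : P) :
    modelDeriv I 𝓘(ℝ, EP) (extChartAt I p) p = .id ℝ EP := mfderiv_extChartAt_self

theorem modelDeriv_extChartAt_symm_self [I.Boundaryless] [IsManifold I 1 P] (p : P) :
    modelDeriv 𝓘(ℝ, EP) I (extChartAt I p).symm (extChartAt I p p) = .id ℝ EP := by
  have := mfderivWithin_range_extChartAt_symm (I := I) (x := p)
  rw [I.range_eq_univ, mfderivWithin_univ] at this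
  exact this

/-- A form with values in the exterior powers of the model space. -/
def DForm.model (Ω : DForm P I k) (p : P) : EP [⋀^Fin k]→L[ℝ] ℝ := Ω p

theorem DForm.inChart_eq (Ω : DForm P I k) (p : P) (y : EP) :
    Ω.inChart p y = (Ω.model ((extChartAt I p).symm y)).compContinuousLinearMap
      (modelDeriv 𝓘(ℝ, EP) I (extChartAt I p).symm y) := rfl

theorem DForm.model_pullback (f : N → P) (Ω : DForm P I k) (p : N) :
    (Ω.pullback f : DForm N J k).model p =
      (Ω.model (f p)).compContinuousLinearMap (modelDeriv J I f p) := rfl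

/-- In the preferred chart, the exterior derivative is that of the coordinate expression. -/
theorem DForm.model_d [I.Boundaryless] [IsManifold I 1 P] (Ω : DForm P I k) (p : P) :
    Ω.d.model p = extDeriv (Ω.inChart p) (extChartAt I p p) := by
  have h : Ω.d.model p = (extDeriv (Ω.inChart p) (extChartAt I p p)).compContinuousLinearMap
    (modelDeriv I 𝓘(ℝ, EP) (extChartAt I p) p) := rfl
  rw [h, modelDeriv_extChartAt_self]
  rfl

/-- The derivative of a map in the preferred charts at `p` and `f p`. -/
theorem modelDeriv_eq_fderiv_inCharts [J.Boundaryless] {f : N → P} {p : N}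
    (hf : MDifferentiableAt J I f p) :
    modelDeriv J I f p = fderiv ℝ (extChartAt I (f p) ∘ f ∘ (extChartAt J p).symm)
      (extChartAt J p p) := by
  rw [modelDeriv, hf.mfderiv, J.range_eq_univ, fderivWithin_univ]
  rfl

theorem mdifferentiableAt_extChartAt_symm [I.Boundaryless] [IsManifold I 1 P] {p : P} {y : EP}
    (hy : y ∈ (extChartAt I p).target) :
    MDifferentiableAt 𝓘(ℝ, EP) I (extChartAt I p).symm y := by
  have h := mdifferentiableWithinAt_extChartAt_symm (I := I) hy
  rwa [I.range_eq_univ, mdifferentiableWithinAt_univ] at h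

/-- The coordinate expression of a pull-back is the pull-back of the coordinate expression. -/
theorem DForm.inChart_pullback [I.Boundaryless] [J.Boundaryless] [IsManifold I 1 P]
    [IsManifold J 1 N] {f : N → P} (hf : MDifferentiable J I f) (Ω : DForm P I k) (p : N) :
    (Ω.pullback f : DForm N J k).inChart p =ᶠ[𝓝 (extChartAt J p p)] fun y =>
      (Ω.inChart (f p) ((extChartAt I (f p) ∘ f ∘ (extChartAt J p).symm) y)).compContinuousLinearMap
        (fderiv ℝ (extChartAt I (f p) ∘ f ∘ (extChartAt J p).symm) y) := by
  have hc : ContinuousAt (f ∘ (extChartAt J p).symm) (extChartAt J p p) := by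
    refine ContinuousAt.comp ?_ (continuousAt_extChartAt_symm p)
    rw [extChartAt_to_inv]
    exact (hf p).continuousAt
  have hs : (extChartAt I (f p)).source ∈
      𝓝 ((f ∘ (extChartAt J p).symm) (extChartAt J p p)) := by
    simp only [Function.comp_apply, extChartAt_to_inv]
    exact extChartAt_source_mem_nhds (f p)
  filter_upwards [hc hs, (isOpen_extChartAt_target p).mem_nhds (mem_extChartAt_target p)]
    with y hy hy'
  have h1 := mdifferentiableAt_extChartAt_symm hy'
  have h2 : MDifferentiableAt J I f ((extChartAt J p).symm y) := hf _
  have h3 : MDifferentiableAt 𝓘(ℝ, EN) I (f ∘ (extChartAt J p).symm) y := h2.comp y h1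
  have hy2 : f ((extChartAt J p).symm y) ∈ (extChartAt I (f p)).source := hy
  have h4 : MDifferentiableAt I 𝓘(ℝ, EP) (extChartAt I (f p)) (f ((extChartAt J p).symm y)) :=
    mdifferentiableAt_extChartAt (by rwa [← extChartAt_source I])
  have h5 := mdifferentiableAt_extChartAt_symm ((extChartAt I (f p)).map_source hy2)
  have h6 : MDifferentiableAt 𝓘(ℝ, EN) 𝓘(ℝ, EP)
      (extChartAt I (f p) ∘ f ∘ (extChartAt J p).symm) y := h4.comp y h3
  -- Near y, the map `f` after the inverse chart is the inverse chart at `f p` after the coordinate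
  -- expression of `f`. Differentiating both factorizations gives the identity between the two
  -- pull-backs.
  have key := modelDeriv_comp y (g := (extChartAt I (f p)).symm) h5 h6
  rw [modelDeriv_congr (g := f ∘ (extChartAt J p).symm), modelDeriv_comp y h2 h1,
    modelDeriv_eq_fderiv] at key
  · rw [DForm.inChart_eq, DForm.inChart_eq, DForm.model_pullback]
    simp only [Function.comp_apply] at key ⊢
    rw [(extChartAt I (f p)).left_inv hy2]
    ext v
    exact congrArg _ (funext fun i => DFunLike.congr_fun key (v i))
  · filter_upwards [h3.continuousAt ((isOpen_extChartAt_source (f p)).mem_nhds hy2)] with y' h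
    exact (extChartAt I (f p)).left_inv h

/-- The exterior derivative commutes with pull-backs. -/
theorem DForm.model_d_pullback [I.Boundaryless] [J.Boundaryless] [IsManifold I 1 P]
    [IsManifold J 1 N] {f : N → P} (hf : ContMDiff J I ∞ f) (Ω : DForm P I k) (p : N)
    (hΩ : DifferentiableAt ℝ (Ω.inChart (f p)) (extChartAt I (f p) (f p))) :
    (Ω.pullback f : DForm N J k).d.model p =
      (Ω.d.model (f p)).compContinuousLinearMap (modelDeriv J I f p) := by
  have hp : (extChartAt I (f p) ∘ f ∘ (extChartAt J p).symm) (extChartAt J p p) =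
      extChartAt I (f p) (f p) := by simp
  rw [DForm.model_d, DForm.model_d, modelDeriv_eq_fderiv_inCharts
    (hf.mdifferentiable (by simp) p),
    (DForm.inChart_pullback (hf.mdifferentiable (by simp)) Ω p).extDeriv_eq]
  have h := (contMDiffAt_iff.1 (hf p)).2
  rw [J.range_eq_univ, contDiffWithinAt_univ] at h
  rw [extDeriv_pullback (r := ∞) (by rwa [hp]) h (by simpa using two_le_infty), hp]

end FormsCalculus

/-! ### Multilinear algebra on X × V: the forms e_z and their nondegeneracy -/

section ModelAlgebra
variable {X V : Type*} [NormedAddCommGroup X] [NormedSpace ℝ X]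
  [NormedAddCommGroup V] [NormedSpace ℝ V] {n : ℕ}

/-- The derivative of a family of horizontal-for-`R` forms in a direction killed by `R`. -/
theorem extDeriv_compContinuousLinearMap_cons {E' : Type*} [NormedAddCommGroup E']
    [NormedSpace ℝ E'] {G : X → E' [⋀^Fin (n + 1)]→L[ℝ] ℝ} (R : X →L[ℝ] E') {y : X}
    (hG : DifferentiableAt ℝ G y) {v : X} (hv : R v = 0) (ξ : Fin (n + 1) → X) :
    extDeriv (fun y => (G y).compContinuousLinearMap R) y (Fin.cons v ξ) =
      fderiv ℝ G y v (fun i => R (ξ i)) := by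
  have h : HasFDerivAt (fun y => (G y).compContinuousLinearMap R)
      ((ContinuousAlternatingMap.compContinuousLinearMapCLM R) ∘L fderiv ℝ G y) y :=
    (ContinuousAlternatingMap.compContinuousLinearMapCLM (𝕜 := ℝ) (ι := Fin (n + 1))
      (F := ℝ) R).hasFDerivAt.comp y hG.hasFDerivAt
  -- Only the summand differentiating along `v` survives. In all others `v` is an argument of a form
  -- pulled back by `R`, and `R v = 0`.
  rw [extDeriv, h.fderiv, ContinuousAlternatingMap.alternatizeUncurryFin_apply,
    Fin.sum_univ_succ, Finset.sum_eq_zero, add_zero]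
  · simp [Function.comp_def]
  · intro i _
    have h0 : (ContinuousAlternatingMap.compContinuousLinearMapCLM R ∘L fderiv ℝ G y)
        ((Fin.cons v ξ : Fin (n + 2) → X) i.succ)
        (i.succ.removeNth (Fin.cons v ξ : Fin (n + 2) → X)) = 0 := by
      rw [ContinuousLinearMap.comp_apply,
        ContinuousAlternatingMap.compContinuousLinearMapCLM_apply,
        ContinuousAlternatingMap.compContinuousLinearMap_apply]
      apply ContinuousAlternatingMap.map_coord_zero _ (0 : Fin (n + 1))
      simp [Fin.removeNth, hv]
    rw [h0, smul_zero]

/-- The exterior form on `X × V` made from `p : V → Λⁿ X*` by means of `κ : X × V → V`. -/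
def altDual (κ : X × V →L[ℝ] V) :
    (V →L[ℝ] X [⋀^Fin n]→L[ℝ] ℝ) →L[ℝ] ((X × V) [⋀^Fin (n + 1)]→L[ℝ] ℝ) :=
  ContinuousAlternatingMap.alternatizeUncurryFinCLM ℝ (X × V) ℝ ∘L
    ContinuousLinearMap.compL ℝ (X × V) (X [⋀^Fin n]→L[ℝ] ℝ)
      ((X × V) [⋀^Fin n]→L[ℝ] ℝ) (ContinuousAlternatingMap.compContinuousLinearMapCLM
        (.fst ℝ X V)) ∘L
    (ContinuousLinearMap.compL ℝ (X × V) V (X [⋀^Fin n]→L[ℝ] ℝ)).flip κ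

theorem altDual_eq (κ : X × V →L[ℝ] V) (p : V →L[ℝ] X [⋀^Fin n]→L[ℝ] ℝ) :
    altDual κ p = ContinuousAlternatingMap.alternatizeUncurryFinCLM ℝ (X × V) ℝ
      ((ContinuousAlternatingMap.compContinuousLinearMapCLM (.fst ℝ X V)) ∘L p ∘L κ) := rfl

/-- The form is already alternating in the other n arguments, so alternatization only chooses the
argument that goes into `κ` and no factorials occur. Indices start at 0, which turns the sign
(-1)^(i-1) of e_z into (-1)^i. -/
theorem altDual_apply (κ : X × V →L[ℝ] V) (p : V →L[ℝ] X [⋀^Fin n]→L[ℝ] ℝ)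
    (u : Fin (n + 1) → X × V) :
    altDual κ p u = ∑ i : Fin (n + 1),
      (-1) ^ (i : ℕ) • p (κ (u i)) (fun j => (i.removeNth u j).1) := by
  rw [altDual_eq, ContinuousAlternatingMap.alternatizeUncurryFinCLM_apply,
    ContinuousAlternatingMap.alternatizeUncurryFin_apply]
  rfl

/-- The form `altDual` depends only on the values of `κ` and the projections to `X`. -/
theorem altDual_apply_congr {X' V' : Type*} [NormedAddCommGroup X'] [NormedSpace ℝ X']
    [NormedAddCommGroup V'] [NormedSpace ℝ V'] {κ : X × V →L[ℝ] V} {κ' : X' × V' →L[ℝ] V'}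
    {p : V →L[ℝ] X [⋀^Fin n]→L[ℝ] ℝ} {p' : V' →L[ℝ] X' [⋀^Fin n]→L[ℝ] ℝ}
    {u : Fin (n + 1) → X × V} {u' : Fin (n + 1) → X' × V'}
    (h : ∀ (i : Fin (n + 1)) (s : Fin n → Fin (n + 1)),
      p (κ (u i)) (fun j => (u (s j)).1) = p' (κ' (u' i)) (fun j => (u' (s j)).1)) :
    altDual κ p u = altDual κ' p' u' := by
  rw [altDual_apply, altDual_apply]
  refine Finset.sum_congr rfl fun i _ => ?_
  congr 1
  exact h i i.succAbove

/-- The minor of order `n` obtained by deleting a coordinate. -/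
def minorForm (k : Fin (n + 1)) : BaseModel n [⋀^Fin n]→L[ℝ] ℝ :=
  { Matrix.detRowAlternating.compLinearMap
      ((LinearMap.pi fun j => (EuclideanSpace.proj (k.succAbove j) :
        BaseModel n →L[ℝ] ℝ).toLinearMap : BaseModel n →ₗ[ℝ] (Fin n → ℝ))) with
    cont := by
      change Continuous fun v : Fin n → BaseModel n =>
        Matrix.det (Matrix.of fun i j => v i (k.succAbove j))
      refine Continuous.matrix_det (continuous_matrix fun i j => ?_)
      simp only [Matrix.of_apply]
      fun_prop }

theorem minorForm_apply (k : Fin (n + 1)) (v : Fin n → BaseModel n) :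
    minorForm k v = Matrix.det (Matrix.of fun i j => v i (k.succAbove j)) := rfl

/-- These minors form the basis dual to the products of all basis vectors but one. For `i = k` the
matrix is the identity; otherwise the k-th basis vector occurs among the arguments and gives a zero
row. -/
theorem minorForm_basis (k i : Fin (n + 1)) :
    minorForm k (fun j => EuclideanSpace.single (i.succAbove j) (1 : ℝ)) =
      if i = k then 1 else 0 := by
  rw [minorForm_apply]
  split_ifs with h
  · subst h
    rw [← Matrix.det_one (n := Fin n) (R := ℝ)]
    congr 1
    ext a b
    simp [Matrix.one_apply, eq_comm]
  · obtain ⟨j, hj⟩ := Fin.exists_succAbove_eq (Ne.symm h)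
    apply Matrix.det_eq_zero_of_row_eq_zero j
    intro b
    simp [hj]

/-- Nondegeneracy of the pairing of `V* ⊗ Λⁿ X*` and `X* ⊗ V`. -/
theorem eq_zero_of_forall_dual {S : BaseModel n →L[ℝ] BaseModel n}
    (b : BaseModel n →L[ℝ] V) (hS : Function.Surjective S)
    (h : ∀ (p : V →L[ℝ] BaseModel n [⋀^Fin n]→L[ℝ] ℝ) (u : Fin (n + 1) → BaseModel n),
      ∑ i : Fin (n + 1), (-1) ^ (i : ℕ) • p (b (u i)) (fun j => S (i.removeNth u j)) = 0) :
    b = 0 := by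
  -- `S` is an endomorphism of a finite-dimensional space.
  have hinj : Function.Injective S :=
    LinearMap.injective_iff_surjective (f := S.toLinearMap) |>.2 hS
  choose u hu using fun i : Fin (n + 1) => hS (EuclideanSpace.single i 1)
  have h0 : ∀ k, b (u k) = 0 := by
    intro k
    by_contra hk
    -- The test momentum is f ⊗ (k-th minor), with f a functional that does not vanish on `b (u k)`.
    -- As the vectors `S (u i)` are the standard basis, the minor removes every summand but the
    -- k-th.
    obtain ⟨f, -, hf⟩ := exists_dual_vector ℝ _ (norm_ne_zero_iff.2 hk)
    have h1 := h (f.smulRight (minorForm k)) u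
    simp only [ContinuousLinearMap.smulRight_apply, Fin.removeNth, hu,
      ContinuousAlternatingMap.smul_apply, minorForm_basis] at h1
    rw [Finset.sum_eq_single k (by intro i _ hi; simp [hi]) (by simp)] at h1
    rcases neg_one_pow_eq_or ℤ (k : ℕ) with h2 | h2 <;> simp [h2] at h1 <;>
      rw [h1] at hf <;> simp at hf <;> exact hk (norm_eq_zero.1 hf.symm)
  -- Already the vectors killed by `b` are mapped by `S` onto everything; injectivity of `S` then
  -- leaves no others.
  have h1 : ∀ y, ∃ x, S x = y ∧ b x = 0 := by
    intro y
    refine ⟨∑ i, y i • u i, ?_, by simp [h0]⟩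
    simp only [map_sum, map_smul, hu]
    ext j
    simp [Pi.single_apply]
  ext1 x
  obtain ⟨x', hx, hx'⟩ := h1 (S x)
  rw [← hinj hx, hx']
  rfl

/-- A form of degree `n + 1` on `X × V` is horizontal if it factors through `X`; it then vanishes
if it vanishes on vectors `ξ i` with arbitrary projections. -/
theorem eq_zero_of_horizontal {τ : (X × V) [⋀^Fin n]→L[ℝ] ℝ}
    (hτ : τ.compContinuousLinearMap (.inl ℝ X V ∘L .fst ℝ X V) = τ)
    {z : X →L[ℝ] X × V} (hz : Function.Surjective fun u => (z u).1)
    (h : ∀ u : Fin n → X, τ (fun i => z (u i)) = 0) : τ = 0 := by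
  ext v
  -- The form sees only X-components, so each `v i` may be replaced by a vector `z (u i)` with the
  -- same one.
  choose u hu using fun i => hz (v i).1
  rw [← hτ] at h ⊢
  have h1 := h u
  simp only [ContinuousAlternatingMap.compContinuousLinearMap_apply] at h1 ⊢
  refine Eq.trans (congrArg τ ?_) h1
  funext i
  simp [← hu]

end ModelAlgebra

/-! ### The Cartan embedding on the model fibres of the jet bundles -/

section ModelJets
variable {X Y : Type*} [NormedAddCommGroup X] [NormedSpace ℝ X]
  [NormedAddCommGroup Y] [NormedSpace ℝ Y] {k : ℕ}

variable (X Y) in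
/-- The component of order `j` of a jet. -/
def JetFibre.coord (k : ℕ) (j : Fin (k + 1)) : JetFibre X Y k →L[ℝ] SymMult X Y j :=
  ContinuousLinearMap.proj (R := ℝ) (φ := fun j : Fin (k + 1) => SymMult X Y j) j

variable (X Y) in
/-- The jet with a single component. -/
def JetFibre.single (k : ℕ) (j : Fin (k + 1)) : SymMult X Y j →L[ℝ] JetFibre X Y k :=
  ContinuousLinearMap.single ℝ (fun j : Fin (k + 1) => SymMult X Y j) j

theorem JetFibre.ext_coord {A B : JetFibre X Y k}
    (h : ∀ j, JetFibre.coord X Y k j A = JetFibre.coord X Y k j B) : A = B := funext h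

theorem JetFibre.coord_single (j : Fin (k + 1)) (B : SymMult X Y j) :
    JetFibre.coord X Y k j (JetFibre.single X Y k j B) = B :=
  Pi.single_eq_same (M := fun j : Fin (k + 1) => SymMult X Y j) j B

theorem JetFibre.coord_single_of_ne {i j : Fin (k + 1)} (h : i ≠ j) (B : SymMult X Y i) :
    JetFibre.coord X Y k j (JetFibre.single X Y k i B) = 0 :=
  Pi.single_eq_of_ne (M := fun j : Fin (k + 1) => SymMult X Y j) h.symm B

theorem JetFibre.coe_coord (j : Fin (k + 1)) (A : JetFibre X Y k) :
    (JetFibre.coord X Y k j A : X [×j]→L[ℝ] Y) = JetFibre.derivCLM X Y k j A := rfl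

variable (X Y k) in
/-- The truncation of jets in coordinates. -/
def JetFibre.truncL : JetFibre X Y (k + 1) →L[ℝ] JetFibre X Y k :=
  ContinuousLinearMap.pi (φ := fun j : Fin (k + 1) => SymMult X Y j) fun j =>
    JetFibre.coord X Y (k + 1) j.castSucc

/-- The linear map `A ↦ (u ↦ A(u, ·))` on multilinear maps, followed by symmetrization. -/
def curryL (X Y : Type*) [NormedAddCommGroup X] [NormedSpace ℝ X]
    [NormedAddCommGroup Y] [NormedSpace ℝ Y] (j : ℕ) :
    (X [×(j + 1)]→L[ℝ] Y) →L[ℝ] (X →L[ℝ] SymMult X Y j) :=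
  ContinuousLinearMap.compL ℝ X (X [×j]→L[ℝ] Y) (SymMult X Y j) (symmetrize X Y j) ∘L
    ((continuousMultilinearCurryLeftEquiv ℝ (fun _ : Fin (j + 1) => X)
      Y).toContinuousLinearEquiv : (X [×(j + 1)]→L[ℝ] Y) →L[ℝ] (X →L[ℝ] X [×j]→L[ℝ] Y))

variable (X Y k) in
/-- The Cartan embedding in coordinates: the derivatives of the derivatives. -/
def JetFibre.cartanL : JetFibre X Y (k + 1) →L[ℝ] (X →L[ℝ] JetFibre X Y k) :=
  ∑ j : Fin (k + 1), ContinuousLinearMap.compL ℝ X (SymMult X Y j) (JetFibre X Y k)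
    (JetFibre.single X Y k j) ∘L
      curryL X Y j ∘L JetFibre.derivCLM X Y (k + 1) j.succ

theorem JetFibre.coord_cartanL (A : JetFibre X Y (k + 1)) (u : X) (j : Fin (k + 1)) :
    JetFibre.coord X Y k j (JetFibre.cartanL X Y k A u) =
      symmetrize X Y j ((JetFibre.derivCLM X Y (k + 1) j.succ A).curryLeft u) := by
  have h1 : JetFibre.cartanL X Y k A u = ∑ i : Fin (k + 1), JetFibre.single X Y k i
        (curryL X Y i (JetFibre.derivCLM X Y (k + 1) i.succ A) u) := by
    simp only [JetFibre.cartanL, sum_apply]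
    rfl
  rw [h1, map_sum, Finset.sum_eq_single j]
  · rw [JetFibre.coord_single]
    rfl
  · intro i _ hi
    exact JetFibre.coord_single_of_ne hi _
  · simp

/-- The derivative of `a ↦ (f(a), …, Dᵏf(a))`. -/
theorem hasFDerivAt_ofDerivs {f : X → Y} {a : X} (hf : ContDiffAt ℝ ∞ f a)
    {A : JetFibre X Y (k + 1)}
    (hA : ∀ j : Fin (k + 2), JetFibre.derivCLM X Y (k + 1) j A = iteratedFDeriv ℝ j f a) :
    HasFDerivAt (fun a => JetFibre.ofDerivs k fun j => iteratedFDeriv ℝ j f a)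
      (JetFibre.cartanL X Y k A) a := by
  refine (hasFDerivAt_pi' (F' := fun j : Fin (k + 1) => SymMult X Y j)).2 fun j => ?_
  have hd : HasFDerivAt (iteratedFDeriv ℝ j f) (fderiv ℝ (iteratedFDeriv ℝ j f) a) a :=
    ((hf.iteratedFDeriv_right (m := 1)
      (by exact_mod_cast le_top)).differentiableAt (by simp)).hasFDerivAt
  have h1 : HasFDerivAt (fun a => symmetrize X Y j (iteratedFDeriv ℝ j f a))
      (symmetrize X Y j ∘L fderiv ℝ (iteratedFDeriv ℝ j f) a) a :=
    HasFDerivAt.comp a (g := fun B => symmetrize X Y j B)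
      (ContinuousLinearMap.hasFDerivAt (E := X [×j]→L[ℝ] Y) (F := SymMult X Y j)
      (symmetrize X Y j)) hd
  refine h1.congr_fderiv ?_
  ext1 u
  -- The derivative of D^j f in the direction `u` is D^(j+1) f with first argument `u`, and D^(j+1)
  -- f is the component of order j + 1 of `A`.
  refine Eq.trans ?_ (JetFibre.coord_cartanL A u j).symm
  rw [hA j.succ]
  rfl

/-- A jet is determined by its truncation and its image under the Cartan embedding. -/
theorem JetFibre.cartanL_injective {A B : JetFibre X Y (k + 1)}
    (h : JetFibre.truncL X Y k A = JetFibre.truncL X Y k B)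
    (h' : JetFibre.cartanL X Y k A = JetFibre.cartanL X Y k B) : A = B := by
  -- A symmetric map with its first argument fixed is still symmetric, so the symmetrization in
  -- `cartanL` loses nothing.
  have hs : ∀ (j : Fin (k + 1)) (A : JetFibre X Y (k + 1)) (u : X),
      (JetFibre.derivCLM X Y (k + 1) j.succ A).curryLeft u ∈ SymMult X Y j := by
    intro j A u σ v
    -- This permutation of j + 1 indices fixes 0 and acts as `σ` on the rest.
    have h1 := (A j.succ).2 (Equiv.Perm.decomposeFin.symm (0, σ)) (Fin.cons u v)
    refine Eq.trans (congrArg (A j.succ).1 ?_) h1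
    funext i
    refine Fin.cases ?_ (fun i => ?_) i <;> simp
  refine JetFibre.ext_coord fun j => ?_
  -- Order 0 comes from the truncation; order j + 1 comes from the component of order j of the
  -- Cartan image.
  induction j using Fin.cases with
  | zero => exact congrArg (JetFibre.coord X Y k 0) h
  | succ j =>
    apply Subtype.ext
    rw [JetFibre.coe_coord, JetFibre.coe_coord]
    refine (continuousMultilinearCurryLeftEquiv ℝ (fun _ : Fin (j + 1) => X) Y).injective ?_
    refine ContinuousLinearMap.ext fun u => ?_
    have h1 := congrArg (fun C => (JetFibre.coord X Y k j (C u)).1) h'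
    simp only [JetFibre.coord_cartanL] at h1
    rw [symmetrize_coe _ (hs j A u), symmetrize_coe _ (hs j B u)] at h1
    exact h1

end ModelJets

/-! ### First jets read in the model spaces -/

section FirstJetModels
variable {n : ℕ} {M : Type*} [TopologicalSpace M] [ChartedSpace (BaseModel n) M]

/-- The tangent map of a first jet, as a map between the model spaces. -/
def FirstJet.model {EP HP P : Type*} [NormedAddCommGroup EP] [NormedSpace ℝ EP]
    [TopologicalSpace HP] [TopologicalSpace P] [ChartedSpace HP P]
    {I : ModelWithCorners ℝ EP HP} {ξ : P → M} (z : FirstJet n I ξ) : BaseModel n →L[ℝ] EP := z.lin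

/-- All tangent spaces of P share one model space, so tangent maps at two points can be compared
there before the points are identified. -/
theorem FirstJet.ext_model {EP HP P : Type*} [NormedAddCommGroup EP] [NormedSpace ℝ EP]
    [TopologicalSpace HP] [TopologicalSpace P] [ChartedSpace HP P]
    {I : ModelWithCorners ℝ EP HP} {ξ : P → M} {z z' : FirstJet n I ξ}
    (h : z.point = z'.point) (h' : z.model = z'.model) : z = z' := by
  obtain ⟨p, u, hu⟩ := z
  obtain ⟨p', u', hu'⟩ := z'
  obtain rfl : p = p' := h
  obtain rfl : u = u' := h'
  rfl

theorem FirstJet.modelDeriv_comp_model {EP HP P : Type*} [NormedAddCommGroup EP]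
    [NormedSpace ℝ EP] [TopologicalSpace HP] [TopologicalSpace P] [ChartedSpace HP P]
    {I : ModelWithCorners ℝ EP HP} {ξ : P → M} (z : FirstJet n I ξ) :
    modelDeriv I (𝓡 (n + 1)) ξ z.point ∘L z.model = .id ℝ (BaseModel n) := z.splitting

end FirstJetModels

/-! ### Derivatives of fibred charts of the base -/

section FibredCharts
variable {n m : ℕ} {M E F : Type*}
  [TopologicalSpace M] [ChartedSpace (BaseModel n) M]
  [TopologicalSpace E] [ChartedSpace (EuclideanSpace ℝ (Fin (n + 1 + m))) E]
  [TopologicalSpace F] [ChartedSpace (FibreModel m) F]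
  {π : SmoothFiberBundle n m M E F} (c : FibredChart π) {k l : ℕ}

theorem Jet.target_trunc (θ : Jet π k) : (θ.trunc l).target = θ.target :=
  Jet.target_mk θ.isLocalSection

namespace FibredChart

theorem mdifferentiableAt_base {x : M} (h : x ∈ c.base.source) :
    MDifferentiableAt (𝓡 (n + 1)) (𝓡 (n + 1)) c.base x :=
  (c.smooth_base.contMDiffAt (c.base.open_source.mem_nhds h)).mdifferentiableAt (by simp)

theorem mdifferentiableAt_base_symm {a : BaseModel n} (h : a ∈ c.base.target) :
    MDifferentiableAt (𝓡 (n + 1)) (𝓡 (n + 1)) c.base.symm a :=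
  (c.smooth_base_symm.contMDiffAt (c.base.open_target.mem_nhds h)).mdifferentiableAt (by simp)

theorem modelDeriv_base_comp_symm {x : M} (h : x ∈ c.base.source) :
    modelDeriv (𝓡 (n + 1)) (𝓡 (n + 1)) c.base x ∘L
      modelDeriv (𝓡 (n + 1)) (𝓡 (n + 1)) c.base.symm (c.base x) = .id ℝ (BaseModel n) := by
  have ht := c.base.map_source h
  have h1 := modelDeriv_comp (g := c.base) (f := c.base.symm) (I := 𝓡 (n + 1)) (J := 𝓡 (n + 1))
    (K := 𝓡 (n + 1)) (c.base x)
    (by rw [c.base.left_inv h]; exact c.mdifferentiableAt_base h)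
    (c.mdifferentiableAt_base_symm ht)
  rw [c.base.left_inv h] at h1
  rw [← h1, modelDeriv_congr (g := id), modelDeriv_id]
  filter_upwards [c.base.open_target.mem_nhds ht] with a ha using c.base.right_inv ha

end FibredChart

end FibredCharts

/-! ### Jet charts: projections and the Cartan embedding in coordinates -/

section JetCharts
variable {n m : ℕ} {M E F : Type*}
  [TopologicalSpace M] [ChartedSpace (BaseModel n) M]
  [TopologicalSpace E] [ChartedSpace (EuclideanSpace ℝ (Fin (n + 1 + m))) E]
  [TopologicalSpace F] [ChartedSpace (FibreModel m) F]
  [IsManifold (𝓡 (n + 1)) ∞ M] [IsManifold (𝓡 m) ∞ F]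
  {π : SmoothFiberBundle n m M E F} (c : FibredChart π) {k l : ℕ}

variable (π) in
/-- The fibred chart at `e` from which the preferred charts of the jet bundles are made. -/
def preferredChart (e : E) : FibredChart π := (exists_fibredChart π e).choose

theorem mem_preferredChart (e : E) : e ∈ (preferredChart π e).total.source :=
  (exists_fibredChart π e).choose_spec

namespace FibredChart

theorem mem_jetHomeo_source [Nonempty (Jet π k)] {θ : Jet π k} :
    θ ∈ (c.jetHomeo k).source ↔ θ.target ∈ c.total.source := Iff.rfl

theorem mdifferentiableAt_jetHomeo [Nonempty (Jet π k)] {θ : Jet π k}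
    (h : θ ∈ (c.jetHomeo k).source) :
    MDifferentiableAt 𝓘(ℝ, JetModel n m k) 𝓘(ℝ, JetModel n m k) (c.jetHomeo k) θ :=
  mdifferentiableAt_atlas c.jetHomeo_mem_atlas h

theorem mdifferentiableAt_jetHomeo_symm [Nonempty (Jet π k)] {q : JetModel n m k}
    (h : q ∈ (c.jetHomeo k).target) :
    MDifferentiableAt 𝓘(ℝ, JetModel n m k) 𝓘(ℝ, JetModel n m k) (c.jetHomeo k).symm q :=
  mdifferentiableAt_atlas_symm c.jetHomeo_mem_atlas h

theorem modelDeriv_jetHomeo_symm_comp [Nonempty (Jet π k)] {θ : Jet π k}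
    (h : θ ∈ (c.jetHomeo k).source) :
    modelDeriv 𝓘(ℝ, JetModel n m k) 𝓘(ℝ, JetModel n m k) (c.jetHomeo k).symm (c.jetHomeo k θ) ∘L
      modelDeriv 𝓘(ℝ, JetModel n m k) 𝓘(ℝ, JetModel n m k) (c.jetHomeo k) θ = .id ℝ _ := by
  have h1 := modelDeriv_comp (g := (c.jetHomeo k).symm) (f := c.jetHomeo k)
    (I := 𝓘(ℝ, JetModel n m k)) (J := 𝓘(ℝ, JetModel n m k)) (K := 𝓘(ℝ, JetModel n m k)) θ
    (c.mdifferentiableAt_jetHomeo_symm ((c.jetHomeo k).map_source h))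
    (c.mdifferentiableAt_jetHomeo h)
  rw [← h1, modelDeriv_congr (g := id), modelDeriv_id]
  filter_upwards [(c.jetHomeo k).open_source.mem_nhds h] with a ha
    using (c.jetHomeo k).left_inv ha

theorem mem_base_source [Nonempty (Jet π k)] {θ : Jet π k} (h : θ ∈ (c.jetHomeo k).source) :
    θ.base ∈ c.base.source := c.mem_base θ.isLocalSection h

theorem base_jetHomeo_symm [Nonempty (Jet π k)] {q : JetModel n m k}
    (h : q ∈ (c.jetHomeo k).target) : ((c.jetHomeo k).symm q).base = c.base.symm q.1 := by
  have h1 := c.jetChart_symm (k := k) (q := q) h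
  exact congrArg Jet.base h1

theorem fst_mem_base_target [Nonempty (Jet π k)] {q : JetModel n m k}
    (h : q ∈ (c.jetHomeo k).target) : q.1 ∈ c.base.target :=
  FibredChart.mem_base_target (c := c) (q := (q.1, q.2.value)) h

/-- The projection `J^k → M` in coordinates. -/
theorem modelDeriv_base_jetHomeo_symm [Nonempty (Jet π k)] {q : JetModel n m k}
    (h : q ∈ (c.jetHomeo k).target) :
    modelDeriv 𝓘(ℝ, JetModel n m k) (𝓡 (n + 1)) Jet.base ((c.jetHomeo k).symm q) ∘L
      modelDeriv 𝓘(ℝ, JetModel n m k) 𝓘(ℝ, JetModel n m k) (c.jetHomeo k).symm q =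
    modelDeriv (𝓡 (n + 1)) (𝓡 (n + 1)) c.base.symm q.1 ∘L .fst ℝ _ _ := by
  rw [← modelDeriv_comp q (Jet.contMDiff_base.mdifferentiable (by simp) _)
    (c.mdifferentiableAt_jetHomeo_symm h)]
  have h2 : MDifferentiableAt 𝓘(ℝ, JetModel n m k) (𝓡 (n + 1))
      (Prod.fst : JetModel n m k → BaseModel n) q := differentiableAt_fst.mdifferentiableAt
  have h1 := modelDeriv_comp (g := c.base.symm) (f := (Prod.fst : JetModel n m k → BaseModel n))
    (J := 𝓘(ℝ, JetModel n m k)) (I := 𝓡 (n + 1)) (K := 𝓡 (n + 1)) q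
    (c.mdifferentiableAt_base_symm (c.fst_mem_base_target h)) h2
  rw [modelDeriv_eq_fderiv, fderiv_fst] at h1
  rw [← h1]
  refine modelDeriv_congr ?_
  filter_upwards [(c.jetHomeo k).open_target.mem_nhds h] with q' h'
  exact c.base_jetHomeo_symm h'

/-- The projection `J^{l+1} → J^l` in coordinates. -/
theorem jetHomeo_trunc [Nonempty (Jet π l)] [Nonempty (Jet π (l + 1))] {θ : Jet π (l + 1)}
    (h : θ.target ∈ c.total.source) :
    c.jetHomeo l (θ.trunc l) =
      ((c.jetHomeo (l + 1) θ).1, JetFibre.truncL _ _ l (c.jetHomeo (l + 1) θ).2) :=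
  c.jetCoord_mk (k := l) θ.isLocalSection h

end FibredChart

theorem cartan_point (θ : Jet π (l + 1)) : (cartan θ).point = θ.trunc l := rfl

/-- The Cartan embedding in coordinates. -/
theorem FibredChart.cartan_model [Nonempty (Jet π l)] [Nonempty (Jet π (l + 1))]
    {θ : Jet π (l + 1)} (h : θ.target ∈ c.total.source) :
    modelDeriv 𝓘(ℝ, JetModel n m l) 𝓘(ℝ, JetModel n m l) (c.jetHomeo l) (θ.trunc l) ∘L
      (cartan θ).model ∘L
        modelDeriv (𝓡 (n + 1)) (𝓡 (n + 1)) c.base.symm (c.base θ.base) =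
    (ContinuousLinearMap.id ℝ _).prod (JetFibre.cartanL _ _ l (c.jetHomeo (l + 1) θ).2) := by
  set s := θ.repr
  set x := θ.base
  have hs : IsLocalSection π s x := θ.isLocalSection
  have hc : s x ∈ c.total.source := h
  have hb := c.mem_base hs hc
  have hb' := c.base.map_source hb
  have hσ : prolong s (Jet.mk s x hs : Jet π l) x = θ.trunc l := dif_pos hs
  have hm1 : MDifferentiableAt (𝓡 (n + 1)) 𝓘(ℝ, JetModel n m l)
      (prolong s (Jet.mk s x hs : Jet π l)) (c.base.symm (c.base x)) := by
    rw [c.base.left_inv hb]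
    exact (contMDiffAt_prolong hs _ fun y hy => dif_pos hy).mdifferentiableAt (by simp)
  have hm2 := c.mdifferentiableAt_base_symm hb'
  have hsrc : θ.trunc l ∈ (c.jetHomeo l).source := by
    rw [c.mem_jetHomeo_source, Jet.target_trunc]; exact h
  have h1 := modelDeriv_comp (c.base x) hm1 hm2
  have hpt : (prolong s (Jet.mk s x hs : Jet π l) ∘ c.base.symm) (c.base x) = θ.trunc l := by
    simp only [Function.comp_apply, c.base.left_inv hb]
    exact hσ
  have h2 := modelDeriv_comp (g := c.jetHomeo l) (c.base x)
    (by rw [hpt]; exact c.mdifferentiableAt_jetHomeo hsrc) (hm1.comp _ hm2)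
  rw [h1, hpt, c.base.left_inv hb] at h2
  refine Eq.trans h2.symm ?_
  -- In jet coordinates the prolongation is a ↦ (a, f(a), Df(a), …, D^l f(a)), f the local
  -- expression of the section. Its derivative has the identity and `cartanL` as components.
  have hev : c.jetHomeo l ∘ prolong s (Jet.mk s x hs : Jet π l) ∘ c.base.symm =ᶠ[𝓝 (c.base x)]
      fun a => (a, JetFibre.ofDerivs l fun j => iteratedFDeriv ℝ j (c.rep s) a) := by
    have hcont := c.base.continuousAt_symm hb'
    rw [ContinuousAt, c.base.left_inv hb] at hcont
    filter_upwards [hcont.eventually (hs.eventually_mem c hc), c.base.open_target.mem_nhds hb']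
      with a ha ha'
    have h3 : prolong s (Jet.mk s x hs : Jet π l) (c.base.symm a) = Jet.mk s _ ha.1 :=
      dif_pos ha.1
    simp only [Function.comp_apply, h3]
    refine (c.jetCoord_mk (k := l) ha.1 ha.2).trans ?_
    rw [FibredChart.jetCoord, c.base.right_inv ha']
  rw [modelDeriv_congr hev]
  have h4 := (hasFDerivAt_id (𝕜 := ℝ) (c.base x)).prodMk (hasFDerivAt_ofDerivs (k := l)
    (A := (c.jetHomeo (l + 1) θ).2) (c.contDiffAt_rep hs hc)
    (fun j => c.derivCLM_jetCoord (k := l + 1) hs hc j))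
  exact modelDeriv_eq_fderiv.trans h4.fderiv

/-- Jets with the same image have the same truncation, hence the same target in E, and so lie in one
jet chart. There the point of the first jet gives the derivatives of order ≤ l and its tangent map
those of orders 1, …, l + 1. -/
theorem cartan_injective : Function.Injective (cartan : Jet π (l + 1) → _) := by
  intro θ θ' h
  have : Nonempty (Jet π (l + 1)) := ⟨θ⟩
  have : Nonempty (Jet π l) := ⟨θ.trunc l⟩
  have hp : θ.trunc l = θ'.trunc l := congrArg FirstJet.point h
  have hm : (cartan θ).model = (cartan θ').model := by rw [h]
  have ht : θ.target = θ'.target := by rw [← Jet.target_trunc (l := l), hp, Jet.target_trunc]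
  have hb : θ.base = θ'.base := congrArg (fun θ : Jet π l => θ.base) hp
  let c := preferredChart π θ.target
  have hc : θ.target ∈ c.total.source := mem_preferredChart _
  have hc' : θ'.target ∈ c.total.source := ht ▸ hc
  apply (c.jetHomeo (l + 1)).injOn hc hc'
  have h1 := c.jetHomeo_trunc hc
  have h2 := c.cartan_model hc
  rw [hp, c.jetHomeo_trunc hc'] at h1
  rw [hm, hb, hp, c.cartan_model hc'] at h2
  have h3 := Prod.ext_iff.1 h1
  refine Prod.ext h3.1.symm (JetFibre.cartanL_injective h3.2.symm ?_)
  ext1 u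
  exact (Prod.ext_iff.1 (DFunLike.congr_fun h2 u)).2.symm

end JetCharts

/-! ### Smoothness of the transition functions; J† and W as smooth manifolds -/

section Blocks
variable {X V P : Type*} [NormedAddCommGroup X] [NormedSpace ℝ X] [NormedAddCommGroup V]
  [NormedSpace ℝ V] [TopologicalSpace P] [ChartedSpace (X × V) P] [IsManifold 𝓘(ℝ, X × V) ∞ P]

/-- Both blocks are linear in the derivative of the change of charts. One order of differentiability
is lost, which is harmless because ∞ + 1 = ∞. -/
theorem contMDiffOn_block [IsManifold 𝓘(ℝ, X × V) 1 P] (i j : atlas (X × V) P) :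
    ContMDiffOn 𝓘(ℝ, X × V) 𝓘(ℝ, X →L[ℝ] X) ∞ (baseBlock i j) (i.1.source ∩ j.1.source) ∧
      ContMDiffOn 𝓘(ℝ, X × V) 𝓘(ℝ, V →L[ℝ] V) ∞ (verticalBlock i j)
        (i.1.source ∩ j.1.source) := by
  have : IsManifold 𝓘(ℝ, X × V) (∞ + 1) P := ‹IsManifold 𝓘(ℝ, X × V) ∞ P›
  have h := (tangentBundleCore.isContMDiff (I := 𝓘(ℝ, X × V)) (M := P)
    (n := ∞)).contMDiffOn_coordChange i j
  have h' : ContMDiffOn 𝓘(ℝ, X × V) 𝓘(ℝ, X × V →L[ℝ] X × V) ∞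
      (fun x => fderiv ℝ (j.1 ∘ i.1.symm) (i.1 x)) (i.1.source ∩ j.1.source) :=
    h.congr fun x _ => (tangent_coordChange_eq i j x).symm
  have h1 : ContDiff ℝ ∞ fun T : X × V →L[ℝ] X × V =>
      ContinuousLinearMap.fst ℝ X V ∘L T ∘L ContinuousLinearMap.inl ℝ X V :=
    contDiff_const.clm_comp (contDiff_id.clm_comp contDiff_const)
  have h2 : ContDiff ℝ ∞ fun T : X × V →L[ℝ] X × V =>
      ContinuousLinearMap.snd ℝ X V ∘L T ∘L ContinuousLinearMap.inr ℝ X V :=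
    contDiff_const.clm_comp (contDiff_id.clm_comp contDiff_const)
  exact ⟨h1.contMDiff.comp_contMDiffOn h', h2.contMDiff.comp_contMDiffOn h'⟩

end Blocks

section Smoothness
variable {X X' : Type*} [NormedAddCommGroup X] [NormedSpace ℝ X] [FiniteDimensional ℝ X]
  [NormedAddCommGroup X'] [NormedSpace ℝ X']

theorem finiteDimensional_multilinear (n : ℕ) : FiniteDimensional ℝ (X [×n]→L[ℝ] ℝ) :=
  Module.Finite.of_injective
    (ContinuousMultilinearMap.toMultilinearMapLinear :
      (X [×n]→L[ℝ] ℝ) →ₗ[ℝ] MultilinearMap ℝ (fun _ : Fin n => X) ℝ)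
    (ContinuousMultilinearMap.toMultilinearMap_injective)

/-- The pull-back of exterior forms depends smoothly on the linear map. -/
theorem contDiff_compContinuousLinearMapCLM (n : ℕ) :
    ContDiff ℝ ∞ (fun f : X →L[ℝ] X' => (ContinuousAlternatingMap.compContinuousLinearMapCLM f :
      (X' [⋀^Fin n]→L[ℝ] ℝ) →L[ℝ] (X [⋀^Fin n]→L[ℝ] ℝ))) := by
  have := finiteDimensional_multilinear (X := X) n
  -- The inclusion of alternating into multilinear maps has a linear left inverse `r`, continuous
  -- since X is finite-dimensional. This reduces the claim to multilinear maps, where the pull-back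
  -- is the restriction to the diagonal of a continuous multilinear map.
  obtain ⟨r, hr⟩ := LinearMap.exists_leftInverse_of_injective
    (ContinuousAlternatingMap.toContinuousMultilinearMapCLM (E := X) (F := ℝ) (ι := Fin n) (𝕜 := ℝ)
      ℝ).toLinearMap
    (LinearMap.ker_eq_bot.2 ContinuousAlternatingMap.toContinuousMultilinearMap_injective)
  have h1 : ContDiff ℝ ∞ fun f : X →L[ℝ] X' =>
      ContinuousMultilinearMap.compContinuousLinearMapContinuousMultilinear ℝ (fun _ : Fin n => X)
        (fun _ => X') ℝ (fun _ => f) :=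
    (ContinuousMultilinearMap.contDiff _).comp (contDiff_pi.2 fun _ => contDiff_id)
  have h2 := (contDiff_const (c := r.toContinuousLinearMap)).clm_comp (h1.clm_comp
    (contDiff_const (c := ContinuousAlternatingMap.toContinuousMultilinearMapCLM (E := X') (F := ℝ)
      (ι := Fin n) (𝕜 := ℝ) ℝ)))
  convert h2 using 2 with f
  ext1 g
  exact (DFunLike.congr_fun hr (g.compContinuousLinearMap f)).symm

variable {V P : Type*} [NormedAddCommGroup V] [NormedSpace ℝ V]
  [TopologicalSpace P] [ChartedSpace (X × V) P] [IsManifold 𝓘(ℝ, X × V) ∞ P]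

theorem contDiff_compL_flip (V Λ : Type*) [NormedAddCommGroup V] [NormedSpace ℝ V]
    [NormedAddCommGroup Λ] [NormedSpace ℝ Λ] :
    ContDiff ℝ ∞ fun q : (Λ →L[ℝ] Λ) × (V →L[ℝ] V) =>
      (ContinuousLinearMap.compL ℝ V Λ Λ q.1) ∘L (ContinuousLinearMap.compL ℝ V V Λ).flip q.2 :=
  ((ContinuousLinearMap.compL ℝ V Λ Λ).contDiff.comp contDiff_fst).clm_comp
    ((ContinuousLinearMap.compL ℝ V V Λ).flip.contDiff.comp contDiff_snd)

/-- The transition functions of V^* ⊗ Λⁿ are built from the base block and the vertical block by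
smooth operations. This gives the total spaces J† and W their smooth structure. -/
instance isContMDiff_dualCore [IsManifold 𝓘(ℝ, X × V) 1 P] [FibredAtlas X V P] (n : ℕ) :
    (dualCore X V P n).IsContMDiff 𝓘(ℝ, X × V) ∞ where
  contMDiffOn_coordChange i j := by
    have h := contMDiffOn_block (P := P) (X := X) (V := V) j i
    rw [inter_comm] at h
    have h1 : ContMDiffOn 𝓘(ℝ, X × V)
        𝓘(ℝ, (X [⋀^Fin n]→L[ℝ] ℝ) →L[ℝ] (X [⋀^Fin n]→L[ℝ] ℝ)) ∞
        (fun x => ContinuousAlternatingMap.compContinuousLinearMapCLM (baseBlock j i x))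
        (i.1.source ∩ j.1.source) :=
      (contDiff_compContinuousLinearMapCLM n).contMDiff.comp_contMDiffOn h.1
    exact (contDiff_compL_flip V (X [⋀^Fin n]→L[ℝ] ℝ)).contMDiff.comp_contMDiffOn
      (h1.prodMk_space h.2)

end Smoothness

section DualCharts
variable {n m : ℕ} {M E F : Type*}
  [TopologicalSpace M] [ChartedSpace (BaseModel n) M]
  [TopologicalSpace E] [ChartedSpace (EuclideanSpace ℝ (Fin (n + 1 + m))) E]
  [TopologicalSpace F] [ChartedSpace (FibreModel m) F]
  [IsManifold (𝓡 (n + 1)) ∞ M] [IsManifold (𝓡 m) ∞ F]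
  {π : SmoothFiberBundle n m M E F} {l : ℕ}

instance : (dualJetCore π l).IsContMDiff 𝓘(ℝ, JetModel n m l) ∞ :=
  isContMDiff_dualCore n

instance : IsManifold (dualModel n m l) ∞ (DualJet π l) := Bundle.TotalSpace.isManifold _ _
instance : IsManifold (mixedModel n m l) ∞ (MixedSpace π l) := Bundle.TotalSpace.isManifold _ _
instance : IsManifold (dualModel n m l) 1 (DualJet π l) :=
  IsManifold.of_le (n := ∞) (by exact_mod_cast le_top)
instance : IsManifold (mixedModel n m l) 1 (MixedSpace π l) :=
  IsManifold.of_le (n := ∞) (by exact_mod_cast le_top)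

end DualCharts

/-! ### The map h in jet coordinates -/

section MomentumCharts
variable {n m : ℕ} {M E F : Type*}
  [TopologicalSpace M] [ChartedSpace (BaseModel n) M]
  [TopologicalSpace E] [ChartedSpace (EuclideanSpace ℝ (Fin (n + 1 + m))) E]
  [TopologicalSpace F] [ChartedSpace (FibreModel m) F]
  [IsManifold (𝓡 (n + 1)) ∞ M] [IsManifold (𝓡 m) ∞ F]
  {π : SmoothFiberBundle n m M E F} {k l : ℕ}

theorem verticalPart_apply (z : FirstJet n 𝓘(ℝ, JetModel n m l) (Jet.base : Jet π l → M))
    (ξ : JetModel n m l) : verticalPart z ξ = (ξ - z.model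
      (modelDeriv 𝓘(ℝ, JetModel n m l) (𝓡 (n + 1)) Jet.base z.point ξ)).2 := rfl

theorem exteriorOfDual_eq (z : FirstJet n 𝓘(ℝ, JetModel n m l) (Jet.base : Jet π l → M)) :
    exteriorOfDual z = altDual (verticalPart z) := rfl

variable (n m l) in
/-- The contact forms `du - C(A) dx` of the jet with derivatives `A`. -/
def contactMap (A : JetFibre (BaseModel n) (FibreModel m) (l + 1)) :
    JetModel n m l →L[ℝ] JetFibre (BaseModel n) (FibreModel m) l :=
  .snd ℝ _ _ - JetFibre.cartanL _ _ l A ∘L .fst ℝ _ _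

/-- The derivative of the inverse of a jet chart. -/
def FibredChart.frame (c : FibredChart π) [Nonempty (Jet π k)] (θ : Jet π k) :
    JetModel n m k →L[ℝ] JetModel n m k :=
  modelDeriv 𝓘(ℝ, JetModel n m k) 𝓘(ℝ, JetModel n m k) (c.jetHomeo k).symm (c.jetHomeo k θ)

theorem FibredChart.modelDeriv_base_frame (c : FibredChart π) [Nonempty (Jet π k)] {θ : Jet π k}
    (h : θ.target ∈ c.total.source) (ξ : JetModel n m k) :
    modelDeriv 𝓘(ℝ, JetModel n m k) (𝓡 (n + 1)) Jet.base θ (c.frame θ ξ) =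
      modelDeriv (𝓡 (n + 1)) (𝓡 (n + 1)) c.base.symm (c.base θ.base) ξ.1 := by
  have hs : θ ∈ (c.jetHomeo k).source := h
  have h1 := c.modelDeriv_base_jetHomeo_symm ((c.jetHomeo k).map_source hs)
  rw [(c.jetHomeo k).left_inv hs] at h1
  exact DFunLike.congr_fun h1 ξ

/-- The atlas element belonging to a fibred chart. -/
def FibredChart.jetAtlas (c : FibredChart π) (k : ℕ) [Nonempty (Jet π k)] :
    atlas (JetModel n m k) (Jet π k) := ⟨c.jetHomeo k, c.jetHomeo_mem_atlas⟩

/-- Since tangent vectors at θ are read in the preferred chart at θ, the frame of `c` is the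
derivative of the change from `c` to that chart. This links frames with the blocks that transform
the momenta. -/
theorem FibredChart.frame_eq_fderiv (c : FibredChart π) [Nonempty (Jet π k)] {θ : Jet π k}
    (h : θ.target ∈ c.total.source) : c.frame θ =
      fderiv ℝ ((achart (JetModel n m k) θ).1 ∘ (c.jetAtlas k).1.symm) ((c.jetAtlas k).1 θ) := by
  have hs : θ ∈ (c.jetHomeo k).source := h
  rw [FibredChart.frame, modelDeriv_eq_fderiv_inCharts
    (c.mdifferentiableAt_jetHomeo_symm ((c.jetHomeo k).map_source hs)),
    (c.jetHomeo k).left_inv hs]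
  simp only [extChartAt_model_space_eq_id, PartialEquiv.refl_symm, PartialEquiv.refl_coe,
    Function.comp_id, id_eq]
  rfl

/-- Changes of jet charts are fibred over the base, so the vertical part of the vector cannot
contribute. -/
theorem FibredChart.frame_fst (c : FibredChart π) [Nonempty (Jet π k)] {θ : Jet π k}
    (h : θ.target ∈ c.total.source) (ξ : JetModel n m k) :
    (c.frame θ ξ).1 = baseBlock (c.jetAtlas k) (achart _ θ) θ ξ.1 := by
  have h0 := FibredAtlas.change_fst (X := BaseModel n) (c.jetAtlas k) (achart (JetModel n m k) θ) θ
    ⟨h, mem_chart_source _ _⟩ ξ.2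
  have h1 : ξ = (ξ.1, 0) + (0, ξ.2) := by simp
  rw [c.frame_eq_fderiv h]
  conv_lhs => rw [h1, map_add, Prod.fst_add, h0, add_zero]
  rfl

theorem FibredChart.frame_snd (c : FibredChart π) [Nonempty (Jet π k)] {θ : Jet π k}
    (h : θ.target ∈ c.total.source) (v : JetFibre (BaseModel n) (FibreModel m) k) :
    (c.frame θ (0, v)).2 = verticalBlock (c.jetAtlas k) (achart _ θ) θ v := by
  rw [c.frame_eq_fderiv h]
  rfl

/-- The vertical part determined by the Cartan embedding, in coordinates. -/
theorem FibredChart.verticalPart_cartan_frame (c : FibredChart π) [Nonempty (Jet π l)]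
    [Nonempty (Jet π (l + 1))] {θ : Jet π (l + 1)} (h : θ.target ∈ c.total.source)
    (ξ : JetModel n m l) :
    verticalPart (cartan θ) (c.frame (θ.trunc l) ξ) =
      (c.frame (θ.trunc l) (0, contactMap n m l (c.jetHomeo (l + 1) θ).2 ξ)).2 := by
  have hs : (θ.trunc l).target ∈ c.total.source := by rwa [Jet.target_trunc]
  have hs' : θ.trunc l ∈ (c.jetHomeo l).source := hs
  have h1 := c.cartan_model (l := l) h
  -- This is the coordinate form of 𝒞, transported back by the inverse of the jet chart.
  have h2 : (cartan θ).model (modelDeriv (𝓡 (n + 1)) (𝓡 (n + 1)) c.base.symm (c.base θ.base) ξ.1) =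
      c.frame (θ.trunc l) (ξ.1, JetFibre.cartanL _ _ l (c.jetHomeo (l + 1) θ).2 ξ.1) := by
    have h3 := congrArg (c.frame (θ.trunc l)) (DFunLike.congr_fun h1 ξ.1)
    have h4 := DFunLike.congr_fun (c.modelDeriv_jetHomeo_symm_comp hs') ((cartan θ).model
      (modelDeriv (𝓡 (n + 1)) (𝓡 (n + 1)) c.base.symm (c.base θ.base) ξ.1))
    exact h4.symm.trans h3
  have h5 := c.modelDeriv_base_frame hs ξ
  rw [verticalPart_apply, cartan_point, h5]
  have h6 : (θ.trunc l).base = θ.base := rfl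
  rw [h6, h2, ← map_sub]
  -- The base components cancel in ξ - z(dπ ξ); what remains is the contact form evaluated on ξ.
  congr 2
  ext1
  · simp
  · rfl

theorem dualJetCore_coordChange_apply (i j : atlas (JetModel n m l) (Jet π l)) (θ : Jet π l)
    (p : DualFibre n m l) (v : JetFibre (BaseModel n) (FibreModel m) l)
    (x : Fin n → BaseModel n) :
    (dualJetCore π l).coordChange i j θ p v x =
      p (verticalBlock j i θ v) (fun a => baseBlock j i θ (x a)) := rfl

/-- The component of a point of `W` in the fibre of `J†`. -/
def MixedSpace.momenta (w : MixedSpace π l) : DualFibre n m l := w.2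

/-- The map `h` in coordinates. -/
theorem FibredChart.hMap_frame (c : FibredChart π) [Nonempty (Jet π l)]
    [Nonempty (Jet π (l + 1))] {w : MixedSpace π l} (h : w.proj.target ∈ c.total.source)
    (ξ : Fin (n + 1) → JetModel n m l) :
    exteriorOfDual (cartan w.proj) w.momenta (fun i => c.frame w.toJet (ξ i)) =
      altDual (contactMap n m l (c.jetHomeo (l + 1) w.proj).2)
        ((dualJetCore π l).coordChange (achart _ w.toJet) (c.jetAtlas l) w.toJet w.momenta) ξ := by
  have hs : w.toJet.target ∈ c.total.source := by
    change (w.proj.trunc l).target ∈ _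
    rwa [Jet.target_trunc]
  rw [exteriorOfDual_eq]
  -- The frame acts on vertical parts by the vertical block and on base parts by the base block.
  -- This is exactly how the coordinate change of J† acts on the momenta, so the terms agree one by
  -- one.
  refine altDual_apply_congr fun i s => ?_
  refine Eq.trans ?_ (dualJetCore_coordChange_apply _ _ _ _ _ _).symm
  have h1 := c.verticalPart_cartan_frame (l := l) h (ξ i)
  have h2 : (c.frame w.toJet (0, contactMap n m l (c.jetHomeo (l + 1) w.proj).2 (ξ i))).2 = _ :=
    c.frame_snd hs _
  have h3 : verticalPart (cartan w.proj) (c.frame w.toJet (ξ i)) = _ := h1.trans h2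
  rw [h3]
  exact congrArg _ (funext fun j => c.frame_fst hs _)

end MomentumCharts

/-! ### Differentiability of e_z in the jet and the momenta -/

section AltDual
variable {X V Z : Type*} [NormedAddCommGroup X] [NormedSpace ℝ X] [NormedAddCommGroup V]
  [NormedSpace ℝ V] [NormedAddCommGroup Z] [NormedSpace ℝ Z] {n : ℕ}

/-- The form is a fixed continuous linear function of the composite of `p` with `κ`, hence bilinear
in the pair. -/
theorem differentiableAt_altDual {κ : Z → X × V →L[ℝ] V} {p : Z → V →L[ℝ] X [⋀^Fin n]→L[ℝ] ℝ}
    {z : Z} (hκ : DifferentiableAt ℝ κ z) (hp : DifferentiableAt ℝ p z) :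
    DifferentiableAt ℝ (fun z => altDual (κ z) (p z)) z := by
  have h1 : DifferentiableAt ℝ (fun z => p z ∘L κ z) z := hp.clm_comp hκ
  let A : ((X × V) →L[ℝ] X [⋀^Fin n]→L[ℝ] ℝ) →L[ℝ] (X × V) [⋀^Fin (n + 1)]→L[ℝ] ℝ :=
    ContinuousAlternatingMap.alternatizeUncurryFinCLM ℝ (X × V) ℝ ∘L
      ContinuousLinearMap.compL ℝ (X × V) (X [⋀^Fin n]→L[ℝ] ℝ)
        ((X × V) [⋀^Fin n]→L[ℝ] ℝ) (ContinuousAlternatingMap.compContinuousLinearMapCLM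
          (.fst ℝ X V))
  have h2 : DifferentiableAt ℝ A (p z ∘L κ z) := by fun_prop
  have h3 : DifferentiableAt ℝ (A ∘ fun z => p z ∘L κ z) z := h2.comp z h1
  exact h3

end AltDual

/-! ### Norms on the model spaces of J† and W -/

section ModelInstances
variable (n m k l : ℕ)

/-- The norm of the model fibre of `J†`. -/
abbrev dualFibreNormedAddCommGroup : NormedAddCommGroup (DualFibre n m l) := inferInstance

attribute [local instance] dualFibreNormedAddCommGroup

/-- The normed space structure of the model fibre of `J†`. -/
abbrev dualFibreNormedSpace : NormedSpace ℝ (DualFibre n m l) := inferInstance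

attribute [local instance] dualFibreNormedSpace

/-- The vector space structure of the model fibre of `J†`. -/
abbrev dualFibreModule : Module ℝ (DualFibre n m l) := NormedSpace.toModule

attribute [local instance] dualFibreModule

/-- The norm of the product of a model of a jet bundle with the model fibre of `J†`. -/
abbrev mixedNormedAddCommGroup : NormedAddCommGroup (JetModel n m k × DualFibre n m l) :=
  Prod.normedAddCommGroup

attribute [local instance] mixedNormedAddCommGroup

/-- The normed space structure of the product of a model of a jet bundle with the model fibre
of `J†`. -/
abbrev mixedNormedSpace : NormedSpace ℝ (JetModel n m k × DualFibre n m l) := Prod.normedSpace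

attribute [local instance] mixedNormedSpace

/-- The vector space structure of the product of a model of a jet bundle with the model fibre
of `J†`. -/
abbrev mixedModule : Module ℝ (JetModel n m k × DualFibre n m l) := NormedSpace.toModule

end ModelInstances

/-! ### The form θ' in the bundle charts of W -/

section LagrangianCharts

attribute [local instance] dualFibreNormedAddCommGroup dualFibreNormedSpace dualFibreModule
  mixedNormedAddCommGroup mixedNormedSpace mixedModule

variable {n m : ℕ} {M E F : Type*}
  [TopologicalSpace M] [ChartedSpace (BaseModel n) M]
  [TopologicalSpace E] [ChartedSpace (EuclideanSpace ℝ (Fin (n + 1 + m))) E]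
  [TopologicalSpace F] [ChartedSpace (FibreModel m) F]
  [IsManifold (𝓡 (n + 1)) ∞ M] [IsManifold (𝓡 m) ∞ F]
  {π : SmoothFiberBundle n m M E F} {l : ℕ}

theorem MixedSpace.contMDiff_toJet : ContMDiff (mixedModel n m l) 𝓘(ℝ, JetModel n m l) ∞
    (MixedSpace.toJet : MixedSpace π l → Jet π l) :=
  (truncMap π l).contMDiff.comp (Bundle.contMDiff_proj _)

/-- The derivative of the projection `W → J^l`. -/
def MixedSpace.toJetDeriv (w : MixedSpace π l) :
    JetModel n m (l + 1) × DualFibre n m l →L[ℝ] JetModel n m l :=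
  modelDeriv (mixedModel n m l) 𝓘(ℝ, JetModel n m l) MixedSpace.toJet w

theorem MixedSpace.modelDeriv_base (w : MixedSpace π l) :
    modelDeriv (mixedModel n m l) (𝓡 (n + 1)) MixedSpace.base w =
      modelDeriv 𝓘(ℝ, JetModel n m l) (𝓡 (n + 1)) Jet.base w.toJet ∘L w.toJetDeriv :=
  modelDeriv_comp w (Jet.contMDiff_base.mdifferentiable (by simp) _)
    (MixedSpace.contMDiff_toJet.mdifferentiable (by simp) _)

namespace LagrangianDensity
variable (L : LagrangianDensity π (l + 1))

/-- The Lagrangian density as a covector of the model space. -/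
def density (θ : Jet π (l + 1)) : BaseModel n [⋀^Fin (n + 1)]→L[ℝ] ℝ := L.toFun θ

/-- The Lagrangian density as a horizontal form. -/
def form : DForm (Jet π (l + 1)) 𝓘(ℝ, JetModel n m (l + 1)) (n + 1) := fun θ =>
  (L.toFun θ).compContinuousLinearMap
    (mfderiv 𝓘(ℝ, JetModel n m (l + 1)) (𝓡 (n + 1)) Jet.base θ)

theorem form_model (θ : Jet π (l + 1)) : L.form.model θ =
    (L.density θ).compContinuousLinearMap
      (modelDeriv 𝓘(ℝ, JetModel n m (l + 1)) (𝓡 (n + 1)) Jet.base θ) := rfl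

/-- The Lagrangian density in the preferred chart at `θ₀`. -/
def coordForm (θ₀ : Jet π (l + 1)) (q : JetModel n m (l + 1)) :
    BaseModel n [⋀^Fin (n + 1)]→L[ℝ] ℝ :=
  (L.form.inChart θ₀ q).compContinuousLinearMap (.inl ℝ _ _)

theorem contDiffOn_coordForm (θ₀ : Jet π (l + 1)) : ContDiffOn ℝ ∞ (L.coordForm θ₀)
    (extChartAt 𝓘(ℝ, JetModel n m (l + 1)) θ₀).target :=
  (ContinuousAlternatingMap.compContinuousLinearMapCLM (𝕜 := ℝ) (F := ℝ) (ι := Fin (n + 1))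
    (ContinuousLinearMap.inl ℝ (BaseModel n)
      (JetFibre (BaseModel n) (FibreModel m) (l + 1)))).contDiff.comp_contDiffOn (L.smooth θ₀)

theorem coordForm_apply (θ₀ θ : Jet π (l + 1))
    (h : θ.target ∈ (preferredChart π θ₀.target).total.source) (x : Fin (n + 1) → BaseModel n) :
    L.coordForm θ₀ (chartAt (JetModel n m (l + 1)) θ₀ θ) x =
      L.density θ fun i => modelDeriv (𝓡 (n + 1)) (𝓡 (n + 1))
        (preferredChart π θ₀.target).base.symm
          ((preferredChart π θ₀.target).base θ.base) (x i) := by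
  have : Nonempty (Jet π (l + 1)) := ⟨θ₀⟩
  have hs : θ ∈ ((preferredChart π θ₀.target).jetHomeo (l + 1)).source := h
  have h1 : (extChartAt 𝓘(ℝ, JetModel n m (l + 1)) θ₀).symm (chartAt (JetModel n m (l + 1)) θ₀ θ) =
      θ := ((preferredChart π θ₀.target).jetHomeo (l + 1)).left_inv hs
  rw [coordForm, DForm.inChart_eq, h1, form_model]
  exact congrArg (L.density θ) (funext fun i =>
    (preferredChart π θ₀.target).modelDeriv_base_frame h (x i, 0))

/-- The map `h + 𝕃`. -/
def totalMomentum (w : MixedSpace π l) : JetModel n m l [⋀^Fin (n + 1)]→L[ℝ] ℝ :=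
  exteriorOfDual (cartan w.proj) w.momenta + (L.density w.proj).compContinuousLinearMap
    (modelDeriv 𝓘(ℝ, JetModel n m l) (𝓡 (n + 1)) Jet.base w.toJet)

/-- The map `h + 𝕃` in coordinates. -/
def coordMomentum (θ₀ : Jet π (l + 1)) (y : JetModel n m (l + 1) × DualFibre n m l) :
    JetModel n m l [⋀^Fin (n + 1)]→L[ℝ] ℝ :=
  altDual (contactMap n m l y.1.2) y.2 +
    (L.coordForm θ₀ y.1).compContinuousLinearMap (.fst ℝ _ _)

/-- The preferred chart at a jet is made from a fibred chart that depends only on the target in E,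
and truncation keeps the target. So the preferred charts at a point of W and at its projections to
J^{l+1} and J^l all come from one fibred chart. -/
theorem achart_toJet (w₀ : MixedSpace π l) [Nonempty (Jet π l)] :
    achart (JetModel n m l) w₀.toJet = (preferredChart π w₀.proj.target).jetAtlas l := by
  have h : w₀.toJet.target = w₀.proj.target := Jet.target_trunc (l := l) w₀.proj
  rw [← h]
  rfl

/-- The chart of W at `w₀` records the jet coordinates of w and its momenta transported to the
preferred chart at `w₀.toJet`. These are the data in the coordinate formulas for h and for the
density. -/
theorem totalMomentum_frame (w₀ w : MixedSpace π l) [Nonempty (Jet π l)]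
    (h : w.proj.target ∈ (preferredChart π w₀.proj.target).total.source)
    (ξ : Fin (n + 1) → JetModel n m l) :
    L.totalMomentum w (fun i => (preferredChart π w₀.proj.target).frame w.toJet (ξ i)) =
      L.coordMomentum w₀.proj (extChartAt (mixedModel n m l) w₀ w) ξ := by
  have : Nonempty (Jet π (l + 1)) := ⟨w.proj⟩
  have hs : w.toJet.target ∈ (preferredChart π w₀.proj.target).total.source := by
    change (w.proj.trunc l).target ∈ _
    rwa [Jet.target_trunc]
  have h1 := FibredChart.hMap_frame (preferredChart π w₀.proj.target) h ξ
  rw [← achart_toJet] at h1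
  have h2 := L.coordForm_apply w₀.proj w.proj h fun i => (ξ i).1
  refine congrArg₂ (· + ·) h1 (Eq.trans ?_ h2.symm)
  exact congrArg (L.density w.proj) (funext fun i =>
    (preferredChart π w₀.proj.target).modelDeriv_base_frame hs (ξ i))

/-- By the tautological property, h^*Θ at w is h(w) pulled back along T_wW → T_θJ^l. The projection
W → M factors through J^l, so 𝔭^*𝓛 is a pull-back along the same map. -/
theorem thetaPrime_model (w : MixedSpace π l) : L.thetaPrime.model w =
    (L.totalMomentum w).compContinuousLinearMap w.toJetDeriv := by
  have h : L.thetaPrime.model w =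
      (exteriorOfDual (cartan w.proj) w.momenta).compContinuousLinearMap w.toJetDeriv +
      (L.density w.proj).compContinuousLinearMap
        (modelDeriv (mixedModel n m l) (𝓡 (n + 1)) MixedSpace.base w) := rfl
  rw [h, MixedSpace.modelDeriv_base]
  rfl

variable (n m l) in
/-- The projection `W → J^l` in coordinates. -/
def coordProj : JetModel n m (l + 1) × DualFibre n m l →L[ℝ] JetModel n m l :=
  ((ContinuousLinearMap.fst ℝ _ _).prod
    (JetFibre.truncL (BaseModel n) (FibreModel m) l ∘L ContinuousLinearMap.snd ℝ _ _)) ∘L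
    ContinuousLinearMap.fst ℝ _ _

theorem mem_source_of_mem_extChartAt {w₀ w : MixedSpace π l}
    (h : w ∈ (extChartAt (mixedModel n m l) w₀).source) :
    w.proj.target ∈ (preferredChart π w₀.proj.target).total.source := by
  rw [FiberBundle.extChartAt, PartialEquiv.trans_source, PartialEquiv.prod_source] at h
  exact (extChartAt_source 𝓘(ℝ, JetModel n m (l + 1)) w₀.proj ▸ h.2.1 :)

theorem toJet_extChartAt_symm (w₀ : MixedSpace π l) [Nonempty (Jet π l)]
    {y : JetModel n m (l + 1) × DualFibre n m l}
    (hy : y ∈ (extChartAt (mixedModel n m l) w₀).target) :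
    ((preferredChart π w₀.proj.target).jetHomeo l)
      ((extChartAt (mixedModel n m l) w₀).symm y).toJet = coordProj n m l y := by
  have : Nonempty (Jet π (l + 1)) := ⟨w₀.proj⟩
  set w := (extChartAt (mixedModel n m l) w₀).symm y with hw
  have h1 := mem_source_of_mem_extChartAt ((extChartAt (mixedModel n m l) w₀).map_target hy)
  have h2 := congrArg Prod.fst ((extChartAt (mixedModel n m l) w₀).right_inv hy)
  have h3 : (preferredChart π w₀.proj.target).jetHomeo (l + 1) w.proj = y.1 := h2
  have h4 := FibredChart.jetHomeo_trunc (l := l) (preferredChart π w₀.proj.target) h1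
  rw [← hw, h3] at h4
  exact h4

/-- Both sides differentiate the projection W → J^l composed with the inverse chart of W; in jet
coordinates this projection is the linear map `coordProj`, so only the derivative of the inverse jet
chart is left in front. -/
theorem toJetDeriv_comp_extChartAt_symm (w₀ : MixedSpace π l) [Nonempty (Jet π l)]
    {y : JetModel n m (l + 1) × DualFibre n m l}
    (hy : y ∈ (extChartAt (mixedModel n m l) w₀).target) :
    ((extChartAt (mixedModel n m l) w₀).symm y).toJetDeriv ∘L
      modelDeriv 𝓘(ℝ, JetModel n m (l + 1) × DualFibre n m l) (mixedModel n m l)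
        (extChartAt (mixedModel n m l) w₀).symm y =
    (preferredChart π w₀.proj.target).frame ((extChartAt (mixedModel n m l) w₀).symm y).toJet ∘L
      coordProj n m l := by
  set c := preferredChart π w₀.proj.target
  have hd : MDifferentiableAt 𝓘(ℝ, JetModel n m (l + 1) × DualFibre n m l) (mixedModel n m l)
      (extChartAt (mixedModel n m l) w₀).symm y := mdifferentiableAt_extChartAt_symm hy
  have h1 := modelDeriv_comp y (MixedSpace.contMDiff_toJet.mdifferentiable (by simp)
    ((extChartAt (mixedModel n m l) w₀).symm y)) hd
  refine h1.symm.trans ?_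
  have hmem : ∀ y ∈ (extChartAt (mixedModel n m l) w₀).target,
      ((extChartAt (mixedModel n m l) w₀).symm y).toJet ∈ (c.jetHomeo l).source := by
    intro y hy
    have h1 := mem_source_of_mem_extChartAt ((extChartAt (mixedModel n m l) w₀).map_target hy)
    change (Jet.trunc l ((extChartAt (mixedModel n m l) w₀).symm y).proj).target ∈ c.total.source
    rwa [Jet.target_trunc]
  have hy2 := (c.jetHomeo l).map_source (hmem y hy)
  rw [toJet_extChartAt_symm w₀ hy] at hy2
  have hR : MDifferentiableAt 𝓘(ℝ, JetModel n m (l + 1) × DualFibre n m l)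
      𝓘(ℝ, JetModel n m l) (coordProj n m l) y :=
    (coordProj n m l).differentiableAt.mdifferentiableAt
  have h2 := modelDeriv_comp y (c.mdifferentiableAt_jetHomeo_symm hy2) hR
  rw [modelDeriv_eq_fderiv, ContinuousLinearMap.fderiv] at h2
  rw [FibredChart.frame, toJet_extChartAt_symm w₀ hy, ← h2]
  refine modelDeriv_congr ?_
  filter_upwards [(isOpen_extChartAt_target w₀).mem_nhds hy] with y' hy'
  simp only [Function.comp_apply]
  rw [← toJet_extChartAt_symm w₀ hy', (c.jetHomeo l).left_inv (hmem y' hy')]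

/-- The form `θ'` in coordinates. -/
theorem thetaPrime_inChart (w₀ : MixedSpace π l) {y : JetModel n m (l + 1) × DualFibre n m l}
    (hy : y ∈ (extChartAt (mixedModel n m l) w₀).target) :
    L.thetaPrime.inChart w₀ y =
      (L.coordMomentum w₀.proj y).compContinuousLinearMap (coordProj n m l) := by
  have : Nonempty (Jet π l) := ⟨w₀.toJet⟩
  have h1 := mem_source_of_mem_extChartAt ((extChartAt (mixedModel n m l) w₀).map_target hy)
  rw [DForm.inChart_eq, thetaPrime_model]
  refine ContinuousAlternatingMap.ext fun ξ => ?_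
  have h2 := L.totalMomentum_frame w₀ ((extChartAt (mixedModel n m l) w₀).symm y) h1
    fun i => coordProj n m l (ξ i)
  rw [(extChartAt (mixedModel n m l) w₀).right_inv hy] at h2
  refine Eq.trans (congrArg (L.totalMomentum _) (funext fun i => ?_)) h2
  exact DFunLike.congr_fun (toJetDeriv_comp_extChartAt_symm w₀ hy) (ξ i)

theorem differentiableAt_coordMomentum (w₀ : MixedSpace π l) :
    DifferentiableAt ℝ (L.coordMomentum w₀.proj) (extChartAt (mixedModel n m l) w₀ w₀) := by
  have h1 : DifferentiableAt ℝ (L.coordForm w₀.proj) (extChartAt (mixedModel n m l) w₀ w₀).1 :=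
    ((L.contDiffOn_coordForm w₀.proj).contDiffAt
      (extChartAt_target_mem_nhds w₀.proj)).differentiableAt (by simp)
  have h2 : DifferentiableAt ℝ (fun y : JetModel n m (l + 1) × DualFibre n m l =>
      (L.coordForm w₀.proj y.1).compContinuousLinearMap (ContinuousLinearMap.fst ℝ (BaseModel n)
        (JetFibre (BaseModel n) (FibreModel m) l))) (extChartAt (mixedModel n m l) w₀ w₀) :=
    (ContinuousAlternatingMap.compContinuousLinearMapCLM (𝕜 := ℝ) (F := ℝ) (ι := Fin (n + 1))
      (ContinuousLinearMap.fst ℝ (BaseModel n)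
        (JetFibre (BaseModel n) (FibreModel m) l))).differentiableAt.comp _
      (h1.comp (extChartAt (mixedModel n m l) w₀ w₀) differentiableAt_fst)
  have h3 : Differentiable ℝ (contactMap n m l) :=
    (differentiable_const _).sub (((ContinuousLinearMap.compL ℝ (JetModel n m l) (BaseModel n)
      (JetFibre (BaseModel n) (FibreModel m) l)).flip (.fst ℝ _ _) ∘L
        JetFibre.cartanL (BaseModel n) (FibreModel m) l).differentiable)
  have h4 : DifferentiableAt ℝ (fun y : JetModel n m (l + 1) × DualFibre n m l =>
      contactMap n m l y.1.2) (extChartAt (mixedModel n m l) w₀ w₀) :=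
    h3.differentiableAt.comp _ (differentiableAt_fst.snd)
  exact (differentiableAt_altDual h4 differentiableAt_snd).add h2

end LagrangianDensity
end LagrangianCharts

/-! ### Alternating forms modulo a subspace; horizontal parts -/

section AlternatingAux

/-- A form whose contractions with a subspace vanish may be evaluated modulo that subspace. -/
theorem apply_eq_of_forall_contraction {Y : Type*} [NormedAddCommGroup Y] [NormedSpace ℝ Y] {k : ℕ}
    {Ω : Y [⋀^Fin (k + 1)]→L[ℝ] ℝ} {K : Submodule ℝ Y}
    (h : ∀ v ∈ K, ∀ ξ : Fin k → Y, Ω (Fin.cons v ξ) = 0)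
    {x y : Fin (k + 1) → Y} (hxy : ∀ i, x i - y i ∈ K) : Ω x = Ω y := by
  have h0 : ∀ x : Fin (k + 1) → Y, x 0 ∈ K → Ω x = 0 := fun x hx => by
    rw [← Fin.cons_self_tail x]
    exact h _ hx _
  -- Antisymmetry moves the argument lying in `K` to the front.
  have h1 : ∀ (x : Fin (k + 1) → Y) i, x i ∈ K → Ω x = 0 := by
    intro x i hx
    by_cases hi : i = 0
    · exact h0 x (hi ▸ hx)
    · have h2 := Ω.toAlternatingMap.map_swap x (Ne.symm hi : (0 : Fin (k + 1)) ≠ i)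
      have h3 : Ω (x ∘ Equiv.swap 0 i) = 0 := h0 _ (by simpa using hx)
      have h4 : -Ω x = 0 := h2.symm.trans h3
      linarith
  -- Expand x = y + (x - y) in all arguments: every term except Ω y has some argument x i - y i in
  -- `K`.
  have h2 := Ω.toMultilinearMap.map_add_univ y (x - y)
  rw [Finset.sum_eq_single Finset.univ] at h2
  · rw [add_sub_cancel, Finset.piecewise_univ] at h2
    exact h2
  · intro s _ hs
    obtain ⟨i, hi⟩ : ∃ i, i ∉ s := by
      by_contra! h5
      exact hs (Finset.eq_univ_iff_forall.2 h5)
    refine h1 _ i ?_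
    rw [Finset.piecewise_eq_of_notMem _ _ _ hi]
    exact hxy i
  · simp

variable {X V : Type*} [NormedAddCommGroup X] [NormedSpace ℝ X] [NormedAddCommGroup V]
  [NormedSpace ℝ V] {n : ℕ}

/-- Put κ = du - C dx. On the horizontal part of a vector (x, v), κ takes the value -Cx = κ(x, v) -
v. Consequently a change of C alters the form only by horizontal terms. -/
theorem altDual_comp_horizontal (C : X →L[ℝ] V) (p : V →L[ℝ] X [⋀^Fin n]→L[ℝ] ℝ) :
    (altDual (.snd ℝ X V - C ∘L .fst ℝ X V) p).compContinuousLinearMap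
        (.inl ℝ X V ∘L .fst ℝ X V) =
      altDual (.snd ℝ X V - C ∘L .fst ℝ X V) p - altDual (.snd ℝ X V) p := by
  refine ContinuousAlternatingMap.ext fun u => ?_
  change altDual _ p (fun i => ((u i).1, 0)) = altDual _ p u - altDual _ p u
  rw [altDual_apply, altDual_apply, altDual_apply, ← Finset.sum_sub_distrib]
  refine Finset.sum_congr rfl fun i _ => ?_
  rw [← smul_sub, ← ContinuousAlternatingMap.sub_apply, ← map_sub]
  congr 1
  change p _ (fun j => (u (i.succAbove j)).1) = p _ (fun j => (u (i.succAbove j)).1)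
  congr 2
  simp

end AlternatingAux

/-! ### Partial derivatives on a product -/

section PartialDerivatives
variable {A B C D : Type*} [NormedAddCommGroup A] [NormedSpace ℝ A] [NormedAddCommGroup B]
  [NormedSpace ℝ B] [NormedAddCommGroup C] [NormedSpace ℝ C] [NormedAddCommGroup D]
  [NormedSpace ℝ D] {G : A × B → C} {y : A × B}

theorem fderiv_inr_of_affine (h : DifferentiableAt ℝ G y) (κ : B →L[ℝ] C) (c : C)
    (hG : ∀ p, G (y.1, p) = κ p + c) (p : B) : fderiv ℝ G y (0, p) = κ p := by
  have h1 : HasFDerivAt (fun p => G (y.1, p)) (fderiv ℝ G y ∘L .inr ℝ A B) y.2 :=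
    HasFDerivAt.comp (g := G) (f := fun p => (y.1, p)) y.2 h.hasFDerivAt
      (hasFDerivAt_prodMk_right y.1 y.2)
  have h2 : HasFDerivAt (fun p => G (y.1, p)) κ y.2 := by
    simp only [hG]
    exact κ.hasFDerivAt.add_const _
  exact DFunLike.congr_fun (h1.unique h2) p

theorem apply_fderiv_inl_eq_zero (h : DifferentiableAt ℝ G y) (T : C →L[ℝ] D) {K : B → D}
    (hG : ∀ y, T (G y) = K y.2) (q : A) : T (fderiv ℝ G y (q, 0)) = 0 := by
  have h1 : HasFDerivAt (fun q => T (G (q, y.2))) (T ∘L fderiv ℝ G y ∘L .inl ℝ A B) y.1 :=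
    T.hasFDerivAt.comp y.1 (HasFDerivAt.comp (g := G) (f := fun q => (q, y.2)) y.1
      h.hasFDerivAt (hasFDerivAt_prodMk_left y.1 y.2))
  have h2 : HasFDerivAt (fun q => T (G (q, y.2))) (0 : A →L[ℝ] D) y.1 := by
    simp only [hG]
    exact hasFDerivAt_const (K y.2) y.1
  exact DFunLike.congr_fun (h1.unique h2) q

end PartialDerivatives

/-! ### Kernels read in the model spaces -/

section PDKernel
variable {n : ℕ} {M : Type*} [TopologicalSpace M] [ChartedSpace (BaseModel n) M]

theorem mem_pdKernel_iff {EP HP P : Type*} [NormedAddCommGroup EP] [NormedSpace ℝ EP]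
    [TopologicalSpace HP] [TopologicalSpace P] [ChartedSpace HP P] {I : ModelWithCorners ℝ EP HP}
    {ξ : P → M} {Ω : DForm P I (n + 2)} {y : P} {z : FirstJet n I ξ} :
    z ∈ pdKernel ξ Ω y ↔ z.point = y ∧ ∀ v : EP, modelDeriv I (𝓡 (n + 1)) ξ y v = 0 →
      ∀ u : Fin (n + 1) → BaseModel n,
        Ω.model y (Fin.cons v fun i => z.model (u i) : Fin (n + 2) → EP) = 0 := by
  obtain ⟨p, lin, hlin⟩ := z
  constructor
  · rintro ⟨rfl, h⟩
    exact ⟨rfl, h⟩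
  · rintro ⟨rfl, h⟩
    exact ⟨rfl, h⟩

end PDKernel

/-! ### Contractions of dθ' with vectors vertical over J^l -/

section Contraction

attribute [local instance] dualFibreNormedAddCommGroup dualFibreNormedSpace dualFibreModule
  mixedNormedAddCommGroup mixedNormedSpace mixedModule

variable {n m : ℕ} {M E F : Type*}
  [TopologicalSpace M] [ChartedSpace (BaseModel n) M]
  [TopologicalSpace E] [ChartedSpace (EuclideanSpace ℝ (Fin (n + 1 + m))) E]
  [TopologicalSpace F] [ChartedSpace (FibreModel m) F]
  [IsManifold (𝓡 (n + 1)) ∞ M] [IsManifold (𝓡 m) ∞ F]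
  {π : SmoothFiberBundle n m M E F} {k l : ℕ}

theorem frame_self (θ : Jet π k) [Nonempty (Jet π k)] :
    (preferredChart π θ.target).frame θ = .id ℝ (JetModel n m k) :=
  modelDeriv_extChartAt_symm_self (I := 𝓘(ℝ, JetModel n m k)) θ

/-- The derivative of the projection to the base in the preferred chart. -/
theorem exists_modelDeriv_base (θ : Jet π k) : ∃ S : BaseModel n →L[ℝ] BaseModel n,
    Function.Injective S ∧ ∀ ξ : JetModel n m k,
      modelDeriv 𝓘(ℝ, JetModel n m k) (𝓡 (n + 1)) Jet.base θ ξ = S ξ.1 := by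
  have : Nonempty (Jet π k) := ⟨θ⟩
  have ht := mem_preferredChart (π := π) θ.target
  have hs : θ ∈ ((preferredChart π θ.target).jetHomeo k).source := ht
  refine ⟨modelDeriv (𝓡 (n + 1)) (𝓡 (n + 1)) (preferredChart π θ.target).base.symm
    ((preferredChart π θ.target).base θ.base), ?_, fun ξ => ?_⟩
  rotate_left
  · have h := (preferredChart π θ.target).modelDeriv_base_frame ht ξ
    rw [frame_self] at h
    exact h
  · intro x y hxy
    have hb := (preferredChart π θ.target).modelDeriv_base_comp_symm
      ((preferredChart π θ.target).mem_base_source ht)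
    exact (DFunLike.congr_fun hb x).symm.trans ((congrArg _ hxy).trans (DFunLike.congr_fun hb y))

/-- The differential of the projection is S ∘ pr_X in the preferred chart, so pr_X ∘ z has a left
inverse. Being injective between spaces of equal finite dimension, it is onto. -/
theorem surjective_fst_of_base_comp {θ : Jet π k} {z : BaseModel n →L[ℝ] JetModel n m k}
    (h : modelDeriv 𝓘(ℝ, JetModel n m k) (𝓡 (n + 1)) Jet.base θ ∘L z = .id ℝ _) :
    Function.Surjective (ContinuousLinearMap.fst ℝ _ _ ∘L z) := by
  obtain ⟨S, -, hS⟩ := exists_modelDeriv_base θ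
  refine (LinearMap.injective_iff_surjective
    (f := (ContinuousLinearMap.fst ℝ _ _ ∘L z).toLinearMap)).1 fun x y hxy => ?_
  have hx := (DFunLike.congr_fun h x).symm.trans (hS (z x))
  have hy := (DFunLike.congr_fun h y).symm.trans (hS (z y))
  exact hx.trans ((congrArg S hxy).trans hy.symm)

/-- The fibred chart chosen for w is also the one chosen for its l-jet, so at the centre the frame
is trivial. Coordinate formulas at w thereby become statements about the actual tangent spaces. -/
theorem MixedSpace.frame_toJet (w : MixedSpace π l) [Nonempty (Jet π l)] :
    (preferredChart π w.proj.target).frame w.toJet = .id ℝ (JetModel n m l) := by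
  have h : w.toJet.target = w.proj.target := Jet.target_trunc (l := l) w.proj
  rw [← h]
  exact frame_self w.toJet

theorem MixedSpace.toJetDeriv_eq (w : MixedSpace π l) :
    w.toJetDeriv = LagrangianDensity.coordProj n m l := by
  have : Nonempty (Jet π l) := ⟨w.toJet⟩
  have h := LagrangianDensity.toJetDeriv_comp_extChartAt_symm w
    (mem_extChartAt_target (I := mixedModel n m l) w)
  rw [extChartAt_to_inv, modelDeriv_extChartAt_symm_self, MixedSpace.frame_toJet] at h
  exact h

theorem MixedSpace.verticalPart_cartan (w : MixedSpace π l) :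
    verticalPart (cartan w.proj) =
      contactMap n m l (extChartAt (mixedModel n m l) w w).1.2 := by
  have : Nonempty (Jet π l) := ⟨w.toJet⟩
  have : Nonempty (Jet π (l + 1)) := ⟨w.proj⟩
  refine ContinuousLinearMap.ext fun ξ => ?_
  have h := (preferredChart π w.proj.target).verticalPart_cartan_frame (l := l)
    (mem_preferredChart _) ξ
  have h2 : (preferredChart π w.proj.target).frame (w.proj.trunc l) = .id ℝ (JetModel n m l) :=
    w.frame_toJet
  rw [h2] at h
  exact h

namespace LagrangianDensity
variable (L : LagrangianDensity π (l + 1))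

/-- For a fixed jet, h is linear in the momenta and the density does not involve them. -/
theorem fderiv_coordMomentum_snd {θ₀ : Jet π (l + 1)} {y : JetModel n m (l + 1) × DualFibre n m l}
    (h : DifferentiableAt ℝ (L.coordMomentum θ₀) y) (p : DualFibre n m l) :
    fderiv ℝ (L.coordMomentum θ₀) y (0, p) = altDual (contactMap n m l y.1.2) p := by
  exact fderiv_inr_of_affine h (altDual (contactMap n m l y.1.2))
    ((L.coordForm θ₀ y.1).compContinuousLinearMap (.fst ℝ _ _)) (fun _ => rfl) p

/-- The jet enters h + 𝕃 only through C(A) dx and the density, and both contribute horizontal forms.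
-/
theorem fderiv_coordMomentum_horizontal {θ₀ : Jet π (l + 1)}
    {y : JetModel n m (l + 1) × DualFibre n m l}
    (h : DifferentiableAt ℝ (L.coordMomentum θ₀) y) (q : JetModel n m (l + 1)) :
    (fderiv ℝ (L.coordMomentum θ₀) y (q, 0)).compContinuousLinearMap
      (.inl ℝ _ _ ∘L .fst ℝ _ _) = fderiv ℝ (L.coordMomentum θ₀) y (q, 0) := by
  -- `T` takes a form to its horizontal part minus itself. On h + 𝕃 the result depends on the
  -- momenta alone, so its derivative along jets is zero.
  let T : (JetModel n m l [⋀^Fin (n + 1)]→L[ℝ] ℝ) →L[ℝ] JetModel n m l [⋀^Fin (n + 1)]→L[ℝ] ℝ :=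
    ContinuousAlternatingMap.compContinuousLinearMapCLM (.inl ℝ _ _ ∘L .fst ℝ _ _) - .id ℝ _
  have hT : ∀ y, T (L.coordMomentum θ₀ y) =
      -altDual (.snd ℝ (BaseModel n) (JetFibre (BaseModel n) (FibreModel m) l)) y.2 := by
    intro y
    have h1 := altDual_comp_horizontal (JetFibre.cartanL (BaseModel n) (FibreModel m) l y.1.2) y.2
    have h2 : T (L.coordMomentum θ₀ y) = ((altDual (contactMap n m l y.1.2)
        y.2).compContinuousLinearMap (.inl ℝ _ _ ∘L .fst ℝ _ _) +
        (L.coordForm θ₀ y.1).compContinuousLinearMap (.fst ℝ _ _)) -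
        (altDual (contactMap n m l y.1.2) y.2 +
          (L.coordForm θ₀ y.1).compContinuousLinearMap (.fst ℝ _ _)) := rfl
    rw [h2, contactMap, h1]
    abel
  exact sub_eq_zero.1 (apply_fderiv_inl_eq_zero h T (K := fun p =>
    -altDual (.snd ℝ (BaseModel n) (JetFibre (BaseModel n) (FibreModel m) l)) p) hT q)

/-- The contraction of `dθ'` with a vector which is vertical over `J^l`. -/
theorem model_d_thetaPrime_cons (w : MixedSpace π l) {v : JetModel n m (l + 1) × DualFibre n m l}
    (hv : w.toJetDeriv v = 0) (ξ : Fin (n + 1) → JetModel n m (l + 1) × DualFibre n m l) :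
    L.thetaPrime.d.model w (Fin.cons v ξ : Fin (n + 2) → JetModel n m (l + 1) × DualFibre n m l) =
      fderiv ℝ (L.coordMomentum w.proj) (extChartAt (mixedModel n m l) w w) v
        fun i => w.toJetDeriv (ξ i) := by
  rw [DForm.model_d, w.toJetDeriv_eq]
  rw [w.toJetDeriv_eq] at hv
  refine Eq.trans ?_ (extDeriv_compContinuousLinearMap_cons (coordProj n m l)
    (L.differentiableAt_coordMomentum w) hv ξ)
  refine congrArg (fun A : (JetModel n m (l + 1) × DualFibre n m l) [⋀^Fin (n + 2)]→L[ℝ] ℝ =>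
    A (Fin.cons v ξ)) (Filter.EventuallyEq.extDeriv_eq ?_)
  filter_upwards [extChartAt_target_mem_nhds (I := mixedModel n m l) w] with y hy
  exact L.thetaPrime_inChart w hy

/-- On the constraint submanifold, the derivative of `h + 𝕃` in directions which are vertical over
`J^l` is that of `h` with respect to the momenta. -/
theorem fderiv_coordMomentum_of_mem {w : MixedSpace π l} (hw : w ∈ L.constraintSet)
    {v : JetModel n m (l + 1) × DualFibre n m l} (hv : w.toJetDeriv v = 0) :
    fderiv ℝ (L.coordMomentum w.proj) (extChartAt (mixedModel n m l) w w) v =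
      exteriorOfDual (cartan w.proj) v.2 := by
  obtain ⟨z, hz⟩ := hw
  obtain ⟨hp, hz⟩ := mem_pdKernel_iff.1 hz
  have hd := L.differentiableAt_coordMomentum w
  have hq : w.toJetDeriv (v.1, 0) = 0 := by
    rw [w.toJetDeriv_eq] at hv ⊢
    exact hv
  -- The part of v along the jets is itself vertical over J^l, so z ∈ Ker dθ' makes the
  -- corresponding derivative vanish on all z(u). It is a horizontal form and z projects onto the
  -- base, hence it is zero. This is the only use of w ∈ 𝒫.
  have hτ : fderiv ℝ (L.coordMomentum w.proj) (extChartAt (mixedModel n m l) w w) (v.1, 0) = 0 := by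
    have hsplit : modelDeriv 𝓘(ℝ, JetModel n m l) (𝓡 (n + 1)) Jet.base w.toJet ∘L
        (w.toJetDeriv ∘L z.model) = .id ℝ _ := by
      have h1 := z.modelDeriv_comp_model
      rw [hp, MixedSpace.modelDeriv_base] at h1
      exact h1
    refine eq_zero_of_horizontal (L.fderiv_coordMomentum_horizontal hd v.1)
      (z := w.toJetDeriv ∘L z.model) (surjective_fst_of_base_comp hsplit) fun u => ?_
    refine (L.model_d_thetaPrime_cons w hq fun i => z.model (u i)).symm.trans (hz _ ?_ u)
    rw [MixedSpace.modelDeriv_base, ContinuousLinearMap.comp_apply, hq, map_zero]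
  have h1 : v = (v.1, 0) + (0, v.2) := by simp
  have h2 := L.fderiv_coordMomentum_snd hd v.2
  rw [exteriorOfDual_eq, w.verticalPart_cartan, ← h2]
  conv_lhs => rw [h1, map_add, hτ, zero_add]

/-- On 𝒫 the contraction sees only the momentum component of `v`. Both the existence of elements of
Ker ω and the computation of their images on J^l depend on this. -/
theorem model_d_thetaPrime_cons_of_mem {w : MixedSpace π l} (hw : w ∈ L.constraintSet)
    {v : JetModel n m (l + 1) × DualFibre n m l} (hv : w.toJetDeriv v = 0)
    (ξ : Fin (n + 1) → JetModel n m (l + 1) × DualFibre n m l) :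
    L.thetaPrime.d.model w (Fin.cons v ξ : Fin (n + 2) → JetModel n m (l + 1) × DualFibre n m l) =
      exteriorOfDual (cartan w.proj) v.2 fun i => w.toJetDeriv (ξ i) := by
  rw [L.model_d_thetaPrime_cons w hv, L.fderiv_coordMomentum_of_mem hw hv]

end LagrangianDensity
end Contraction

/-! ### The projections of J† and W, and the fibres of J†, in coordinates -/

section Projections

attribute [local instance] dualFibreNormedAddCommGroup dualFibreNormedSpace dualFibreModule
  mixedNormedAddCommGroup mixedNormedSpace mixedModule

variable {n m : ℕ} {M E F : Type*}
  [TopologicalSpace M] [ChartedSpace (BaseModel n) M]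
  [TopologicalSpace E] [ChartedSpace (EuclideanSpace ℝ (Fin (n + 1 + m))) E]
  [TopologicalSpace F] [ChartedSpace (FibreModel m) F]
  [IsManifold (𝓡 (n + 1)) ∞ M] [IsManifold (𝓡 m) ∞ F]
  {π : SmoothFiberBundle n m M E F} {l : ℕ}

theorem modelDeriv_tau0 (P : DualJet π l) :
    modelDeriv (dualModel n m l) 𝓘(ℝ, JetModel n m l) tau0 P = .fst ℝ _ _ := by
  have h1 := modelDeriv_comp (g := extChartAt 𝓘(ℝ, JetModel n m l) P.proj) (f := tau0)
    (I := 𝓘(ℝ, JetModel n m l)) (J := dualModel n m l) (K := 𝓘(ℝ, JetModel n m l)) P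
    (mdifferentiableAt_extChartAt (mem_chart_source _ _))
    (contMDiff_tau0.mdifferentiable (by simp) P)
  have h2 := modelDeriv_comp (g := (Prod.fst : JetModel n m l × DualFibre n m l → JetModel n m l))
    (f := extChartAt (dualModel n m l) P)
    (I := 𝓘(ℝ, JetModel n m l × DualFibre n m l)) (J := dualModel n m l)
    (K := 𝓘(ℝ, JetModel n m l)) P differentiableAt_fst.mdifferentiableAt
    (mdifferentiableAt_extChartAt (mem_chart_source _ _))
  have h3 : modelDeriv 𝓘(ℝ, JetModel n m l) 𝓘(ℝ, JetModel n m l)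
      (extChartAt 𝓘(ℝ, JetModel n m l) P.proj) (tau0 P) = .id ℝ _ :=
    modelDeriv_extChartAt_self P.proj
  rw [h3] at h1
  rw [modelDeriv_extChartAt_self, modelDeriv_eq_fderiv, fderiv_fst] at h2
  exact h1.symm.trans h2

theorem modelDeriv_tau (P : DualJet π l) (v : JetModel n m l × DualFibre n m l) :
    modelDeriv (dualModel n m l) (𝓡 (n + 1)) tau P v =
      modelDeriv 𝓘(ℝ, JetModel n m l) (𝓡 (n + 1)) Jet.base P.proj v.1 := by
  have h1 := modelDeriv_comp P (Jet.contMDiff_base.mdifferentiable (by simp) (tau0 P))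
    (contMDiff_tau0.mdifferentiable (by simp) P)
  rw [modelDeriv_tau0] at h1
  exact DFunLike.congr_fun h1 v

theorem MixedSpace.contMDiff_toDual : ContMDiff (mixedModel n m l) (dualModel n m l) ∞
    (MixedSpace.toDual : MixedSpace π l → DualJet π l) := by
  intro w₀
  refine Bundle.contMDiffAt_totalSpace.2 ⟨MixedSpace.contMDiff_toJet w₀, ?_⟩
  have hs : ContMDiff 𝓘(ℝ, JetModel n m (l + 1) × DualFibre n m l) 𝓘(ℝ, DualFibre n m l) ∞
      (Prod.snd : JetModel n m (l + 1) × DualFibre n m l → DualFibre n m l) :=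
    contDiff_snd.contMDiff
  have h : ContMDiffAt (mixedModel n m l) 𝓘(ℝ, DualFibre n m l) ∞
      (Prod.snd ∘ extChartAt (mixedModel n m l) w₀) w₀ :=
    (hs _).comp w₀ contMDiffAt_extChartAt
  -- W carries the pulled-back trivializations, so w and its image in J† have the same fibre
  -- coordinate.
  exact h

/-- The charts at w and at its image have the same fibre coordinates, and over the jets the map is
truncation. The vectors it kills are thus those vertical over J^l with zero momentum component. -/
theorem MixedSpace.modelDeriv_toDual (w : MixedSpace π l) :
    modelDeriv (mixedModel n m l) (dualModel n m l) MixedSpace.toDual w =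
      w.toJetDeriv.prod (.snd ℝ _ _) := by
  have hd := MixedSpace.contMDiff_toDual.mdifferentiable (by simp) w
  have h1 := modelDeriv_comp w (contMDiff_tau0.mdifferentiable (by simp) w.toDual) hd
  rw [modelDeriv_tau0] at h1
  have hs : ∀ y, MDifferentiableAt 𝓘(ℝ, JetModel n m l × DualFibre n m l) 𝓘(ℝ, DualFibre n m l)
      (Prod.snd : JetModel n m l × DualFibre n m l → DualFibre n m l) y :=
    fun y => differentiableAt_snd.mdifferentiableAt
  have h2 := modelDeriv_comp (g := (Prod.snd : JetModel n m l × DualFibre n m l → DualFibre n m l))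
    (f := extChartAt (dualModel n m l) w.toDual ∘ MixedSpace.toDual)
    (I := 𝓘(ℝ, JetModel n m l × DualFibre n m l)) (J := mixedModel n m l)
    (K := 𝓘(ℝ, DualFibre n m l)) w (hs _)
    ((mdifferentiableAt_extChartAt (mem_chart_source _ _)).comp w hd)
  have h3 := modelDeriv_comp (g := extChartAt (dualModel n m l) w.toDual)
    (f := MixedSpace.toDual) (I := dualModel n m l) (J := mixedModel n m l)
    (K := 𝓘(ℝ, JetModel n m l × DualFibre n m l)) w
    (mdifferentiableAt_extChartAt (mem_chart_source _ _)) hd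
  have h4 := modelDeriv_comp
    (g := (Prod.snd : JetModel n m (l + 1) × DualFibre n m l → DualFibre n m l))
    (f := extChartAt (mixedModel n m l) w)
    (I := 𝓘(ℝ, JetModel n m (l + 1) × DualFibre n m l)) (J := mixedModel n m l)
    (K := 𝓘(ℝ, DualFibre n m l)) w differentiableAt_snd.mdifferentiableAt
    (mdifferentiableAt_extChartAt (mem_chart_source _ _))
  rw [h3, modelDeriv_extChartAt_self, modelDeriv_eq_fderiv, fderiv_snd] at h2
  rw [modelDeriv_extChartAt_self, modelDeriv_eq_fderiv, fderiv_snd] at h4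
  have h5 := h2.symm.trans h4
  refine ContinuousLinearMap.ext fun v => Prod.ext ?_ ?_
  · exact DFunLike.congr_fun h1.symm v
  · exact DFunLike.congr_fun h5 v

/-- The component of a point of `J†` in the fibre. -/
def DualJet.momenta (P : DualJet π l) : DualFibre n m l := P.2

/-- The inclusion of a fibre of `J†`. -/
def fibreInclusion (θ : Jet π l) (p : DualFibre n m l) : DualJet π l := ⟨θ, p⟩

theorem contMDiff_fibreInclusion (θ : Jet π l) :
    ContMDiff 𝓘(ℝ, DualFibre n m l) (dualModel n m l) ∞ (fibreInclusion θ) := by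
  intro p
  refine Bundle.contMDiffAt_totalSpace.2 ⟨contMDiffAt_const, ?_⟩
  exact ((dualJetCore π l).coordChange (achart _ θ) (achart _ θ) θ).contMDiff p

theorem modelDeriv_fibreInclusion (θ : Jet π l) (p : DualFibre n m l) :
    modelDeriv 𝓘(ℝ, DualFibre n m l) (dualModel n m l) (fibreInclusion θ) p = .inr ℝ _ _ := by
  have h1 := modelDeriv_comp (g := extChartAt (dualModel n m l) (fibreInclusion θ p))
    (f := fibreInclusion θ) (I := dualModel n m l) (J := 𝓘(ℝ, DualFibre n m l))
    (K := 𝓘(ℝ, JetModel n m l × DualFibre n m l)) p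
    (mdifferentiableAt_extChartAt (mem_chart_source _ _))
    ((contMDiff_fibreInclusion θ).mdifferentiable (by simp) p)
  -- Over the centre θ of the chart the coordinate change of J† is the identity, so the inclusion is
  -- p ↦ (constant, p) in the chart.
  have h2 : extChartAt (dualModel n m l) (fibreInclusion θ p) ∘ fibreInclusion θ =
      fun q => (chartAt (JetModel n m l) θ θ, q) := by
    funext q
    refine Prod.ext rfl ?_
    exact (dualJetCore π l).coordChange_self (achart _ θ) θ (mem_chart_source _ _) q
  rw [modelDeriv_extChartAt_self, h2, modelDeriv_eq_fderiv,
    (hasFDerivAt_prodMk_right (𝕜 := ℝ) _ p).fderiv] at h1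
  exact h1.symm

end Projections

/-! ### Hyperregular Lagrangians: Ker ω and the fibre derivative of 𝓗 -/

section Legendre

attribute [local instance] dualFibreNormedAddCommGroup dualFibreNormedSpace dualFibreModule
  mixedNormedAddCommGroup mixedNormedSpace mixedModule

variable {n m : ℕ} {M E F : Type*}
  [TopologicalSpace M] [ChartedSpace (BaseModel n) M]
  [TopologicalSpace E] [ChartedSpace (EuclideanSpace ℝ (Fin (n + 1 + m))) E]
  [TopologicalSpace F] [ChartedSpace (FibreModel m) F]
  [IsManifold (𝓡 (n + 1)) ∞ M] [IsManifold (𝓡 m) ∞ F]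
  {π : SmoothFiberBundle n m M E F} {l : ℕ} {L : LagrangianDensity π (l + 1)}

namespace LagrangianDensity.IsHyperregular
variable (hL : L.IsHyperregular) (P : DualJet π l)

theorem invSection_mem : hL.invSection P ∈ L.constraintSet :=
  ((Equiv.ofBijective _ hL.bijective).symm P).2

theorem toDual_invSection : (hL.invSection P).toDual = P :=
  (Equiv.ofBijective _ hL.bijective).apply_symm_apply P

theorem toJet_invSection : (hL.invSection P).toJet = P.proj :=
  congrArg tau0 (hL.toDual_invSection P)

theorem contMDiff_invSection :
    ContMDiff (dualModel n m l) (mixedModel n m l) ∞ hL.invSection := hL.contMDiff_symm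

/-- The derivative of `𝔰`. -/
def sectionDeriv : JetModel n m l × DualFibre n m l →L[ℝ] JetModel n m (l + 1) × DualFibre n m l :=
  modelDeriv (dualModel n m l) (mixedModel n m l) hL.invSection P

/-- Differentiate the identity that 𝔰 followed by W → J† is the identity. Of d𝔰(v) only the
component along the derivatives of order l + 1 remains undetermined, and dθ' does not see it on 𝒫.
-/
theorem modelDeriv_toDual_sectionDeriv (v : JetModel n m l × DualFibre n m l) :
    ((hL.invSection P).toJetDeriv (hL.sectionDeriv P v), (hL.sectionDeriv P v).2) = v := by
  have h1 := modelDeriv_comp P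
    (MixedSpace.contMDiff_toDual.mdifferentiable (by simp) (hL.invSection P))
    (hL.contMDiff_invSection.mdifferentiable (by simp) P)
  have h2 : MixedSpace.toDual ∘ hL.invSection = id := funext hL.toDual_invSection
  rw [h2, modelDeriv_id, MixedSpace.modelDeriv_toDual] at h1
  exact (DFunLike.congr_fun h1 v).symm

theorem toJetDeriv_sectionDeriv (v : JetModel n m l × DualFibre n m l) :
    (hL.invSection P).toJetDeriv (hL.sectionDeriv P v) = v.1 :=
  congrArg Prod.fst (hL.modelDeriv_toDual_sectionDeriv P v)

theorem sectionDeriv_snd (v : JetModel n m l × DualFibre n m l) :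
    (hL.sectionDeriv P v).2 = v.2 :=
  congrArg Prod.snd (hL.modelDeriv_toDual_sectionDeriv P v)

/-- Here the smoothness of 𝔰 enters: d commutes with the pull-back along it. -/
theorem omega_model (ξ : Fin (n + 2) → JetModel n m l × DualFibre n m l) :
    hL.omega.model P ξ = L.thetaPrime.d.model (hL.invSection P)
      fun i => hL.sectionDeriv P (ξ i) := by
  have hd : DifferentiableAt ℝ (L.thetaPrime.inChart (hL.invSection P))
      (extChartAt (mixedModel n m l) (hL.invSection P) (hL.invSection P)) := by
    refine ((ContinuousAlternatingMap.compContinuousLinearMapCLM (𝕜 := ℝ) (F := ℝ)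
      (ι := Fin (n + 1)) (coordProj n m l)).differentiableAt.comp _
      (L.differentiableAt_coordMomentum (hL.invSection P))).congr_of_eventuallyEq ?_
    filter_upwards [extChartAt_target_mem_nhds (I := mixedModel n m l) (hL.invSection P)] with y hy
    exact L.thetaPrime_inChart _ hy
  exact DFunLike.congr_fun
    (DForm.model_d_pullback hL.contMDiff_invSection L.thetaPrime P hd) ξ

theorem omega_model_cons (v : JetModel n m l × DualFibre n m l)
    (ξ : Fin (n + 1) → JetModel n m l × DualFibre n m l) :
    hL.omega.model P (Fin.cons v ξ : Fin (n + 2) → JetModel n m l × DualFibre n m l) =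
      L.thetaPrime.d.model (hL.invSection P)
        (Fin.cons (hL.sectionDeriv P v) (fun i => hL.sectionDeriv P (ξ i)) :
          Fin (n + 2) → JetModel n m (l + 1) × DualFibre n m l) := by
  rw [omega_model]
  congr 1
  funext i
  refine Fin.cases rfl (fun i => rfl) i

/-- As 𝔰(P) ∈ 𝒫, there is some z in Ker dθ' at 𝔰(P); its image under W → J† lies in Ker ω. Indeed d𝔰
of the image differs from z by vectors killed by W → J†, to which dθ' is blind on 𝒫. -/
theorem ker_nonempty : (hL.ker P).Nonempty := by
  obtain ⟨z, hz⟩ := hL.invSection_mem P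
  obtain ⟨hp, hz⟩ := mem_pdKernel_iff.1 hz
  let z' : FirstJet n (dualModel n m l) (tau : DualJet π l → M) :=
    FirstJet.push (f := MixedSpace.toDual) ((Jet.contMDiff_base.comp contMDiff_tau0).mdifferentiable
      (by simp)) (MixedSpace.contMDiff_toDual.mdifferentiable (by simp)) z
  have hz' : ∀ u, z'.model u = ((hL.invSection P).toJetDeriv (z.model u), (z.model u).2) := by
    intro u
    have h1 : z'.model u = modelDeriv (mixedModel n m l) (dualModel n m l) MixedSpace.toDual
      z.point (z.model u) := rfl
    rw [h1, hp, MixedSpace.modelDeriv_toDual]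
    rfl
  refine ⟨z', mem_pdKernel_iff.2 ⟨?_, fun v hv u => ?_⟩⟩
  · exact (congrArg MixedSpace.toDual hp).trans (hL.toDual_invSection P)
  rw [hL.omega_model_cons]
  -- The kernel of the derivative of W → J†. Its vectors have zero momentum component, so the
  -- contraction formula gives e(0) = 0.
  have hK : ∀ v ∈ LinearMap.ker ((hL.invSection P).toJetDeriv.prod
      (.snd ℝ (JetModel n m (l + 1)) (DualFibre n m l))).toLinearMap,
      ∀ ξ : Fin (n + 1) → JetModel n m (l + 1) × DualFibre n m l,
      L.thetaPrime.d.model (hL.invSection P)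
        (Fin.cons v ξ : Fin (n + 2) → JetModel n m (l + 1) × DualFibre n m l) = 0 := by
    intro v hv ξ
    have hv1 : (hL.invSection P).toJetDeriv v = 0 := congrArg Prod.fst hv
    have hv2 : v.2 = 0 := congrArg Prod.snd hv
    rw [L.model_d_thetaPrime_cons_of_mem (hL.invSection_mem P) hv1, hv2, map_zero]
    rfl
  -- Replace d𝔰(z'(u)) by z(u), which is legitimate modulo that kernel, and apply z ∈ Ker dθ' to the
  -- vertical vector d𝔰(v).
  refine (apply_eq_of_forall_contraction hK (fun i => ?_)).trans (hz (hL.sectionDeriv P v) ?_ u)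
  · refine Fin.cases ?_ (fun i => ?_) i
    · simp
    · have h1 := hL.modelDeriv_toDual_sectionDeriv P (z'.model (u i))
      rw [hz'] at h1
      rw [LinearMap.mem_ker, map_sub, sub_eq_zero]
      refine Eq.trans ?_ h1
      rw [← hz']
      rfl
  · rw [modelDeriv_tau] at hv
    rw [MixedSpace.modelDeriv_base, ContinuousLinearMap.comp_apply, hL.toJetDeriv_sectionDeriv,
      hL.toJet_invSection]
    exact hv

/-- The right-hand side does not involve `z`, so this gives at once the independence of the choice
and the value of 𝔽𝓗. It suffices that the image of z on J^l has no vertical part relative to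
𝒞(leg⁻¹(P)); nondegeneracy of the pairing with the momenta yields this. -/
theorem tau0Jet_eq {z : FirstJet n (dualModel n m l) (tau : DualJet π l → M)}
    (hz : z ∈ hL.ker P) : tau0Jet z = cartan (hL.legInv P) := by
  obtain ⟨hp, hz⟩ := mem_pdKernel_iff.1 hz
  have hpt : (cartan (hL.legInv P)).point = P.proj := hL.toJet_invSection P
  have hm : (tau0Jet z).model = .fst ℝ _ _ ∘L z.model := by
    have h1 : (tau0Jet z).model = modelDeriv (dualModel n m l) 𝓘(ℝ, JetModel n m l) tau0 z.point ∘L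
      z.model := rfl
    rw [h1, modelDeriv_tau0]
  set ζ : BaseModel n →L[ℝ] JetModel n m l := .fst ℝ _ _ ∘L z.model with hζ
  have hbase : modelDeriv 𝓘(ℝ, JetModel n m l) (𝓡 (n + 1)) Jet.base P.proj ∘L ζ = .id ℝ _ := by
    refine ContinuousLinearMap.ext fun u => ?_
    have h1 := DFunLike.congr_fun z.modelDeriv_comp_model u
    rw [hp] at h1
    exact (modelDeriv_tau P (z.model u)).symm.trans h1
  have hκ : verticalPart (cartan (hL.legInv P)) ∘L ζ = 0 := by
    refine eq_zero_of_forall_dual _ (surjective_fst_of_base_comp hbase) fun p u => ?_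
    -- Tangent vectors to the fibre of J† are vertical over M, and d𝔰 sends them to vectors vertical
    -- over J^l with momentum component p. The kernel condition therefore says that e(p) vanishes on
    -- the vectors ζ(u i).
    have h1 := hz (0, p) (by rw [modelDeriv_tau, map_zero]) u
    rw [hL.omega_model_cons, L.model_d_thetaPrime_cons_of_mem (hL.invSection_mem P)
      (hL.toJetDeriv_sectionDeriv P _), hL.sectionDeriv_snd, exteriorOfDual_eq, altDual_apply] at h1
    refine Eq.trans (Finset.sum_congr rfl fun i _ => ?_) h1
    have h2 : ∀ i, (hL.invSection P).toJetDeriv (hL.sectionDeriv P (z.model (u i))) = ζ (u i) :=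
      fun i => hL.toJetDeriv_sectionDeriv P _
    congr 1
    simp only [Fin.removeNth_apply, h2]
    rfl
  have hcb := (cartan (hL.legInv P)).modelDeriv_comp_model
  refine FirstJet.ext_model ((congrArg tau0 hp).trans hpt.symm) ?_
  rw [hm]
  rw [hpt] at hcb
  obtain ⟨S, hS, hbS⟩ := exists_modelDeriv_base P.proj
  -- The components along the base agree because both maps split dπ and `S` is injective; the
  -- components along the fibre agree because the vertical part of ζ is zero.
  refine ContinuousLinearMap.ext fun u => Prod.ext (hS ?_) ?_
  · have h1 := (hbS (ζ u)).symm.trans (DFunLike.congr_fun hbase u)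
    have h2 := (hbS _).symm.trans (DFunLike.congr_fun hcb u)
    exact h1.trans h2.symm
  · have h1 := DFunLike.congr_fun hκ u
    rw [ContinuousLinearMap.comp_apply, verticalPart_apply, hpt] at h1
    have h2 : modelDeriv 𝓘(ℝ, JetModel n m l) (𝓡 (n + 1)) Jet.base P.proj (ζ u) = u :=
      DFunLike.congr_fun hbase u
    rw [h2] at h1
    exact sub_eq_zero.1 h1

theorem fiberDerivative_eq : hL.fiberDerivative P = cartan (hL.legInv P) := by
  rw [fiberDerivative, dif_pos (hL.ker_nonempty P)]
  exact hL.tau0Jet_eq P (hL.ker_nonempty P).some_mem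

/-- Chain rule: d𝔰 sends the fibre direction (0, p) to a vector vertical over J^l with momentum
component p. Along such vectors the derivative of h + 𝕃 at points of 𝒫 is e(p), whatever 𝔰 does in
highest order. -/
theorem hasFDerivAt_totalMomentum : HasFDerivAt
    (fun p : DualFibre n m l => L.totalMomentum (hL.invSection (fibreInclusion P.proj p)))
    (exteriorOfDual (cartan (hL.legInv P))) P.momenta := by
  have : Nonempty (Jet π l) := ⟨P.proj⟩
  set σ : DualFibre n m l → JetModel n m (l + 1) × DualFibre n m l :=
    extChartAt (mixedModel n m l) (hL.invSection P) ∘ hL.invSection ∘ fibreInclusion P.proj with hσ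
  -- This holds for every p and not only near P: the l-jet of 𝔰 is constant along the fibre, so the
  -- target in E stays in the same fibred chart and the frame remains the identity.
  have h1 : ∀ p, L.totalMomentum (hL.invSection (fibreInclusion P.proj p)) =
      L.coordMomentum (hL.invSection P).proj (σ p) := by
    intro p
    have ht : (hL.invSection (fibreInclusion P.proj p)).toJet = (hL.invSection P).toJet :=
      (hL.toJet_invSection _).trans (hL.toJet_invSection P).symm
    have ht' : (hL.invSection (fibreInclusion P.proj p)).proj.target =
        (hL.invSection P).proj.target :=
      (Jet.target_trunc (l := l) _).symm.trans ((congrArg Jet.target ht).trans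
        (Jet.target_trunc (l := l) _))
    refine ContinuousAlternatingMap.ext fun ξ => ?_
    have h2 := L.totalMomentum_frame (hL.invSection P)
      (hL.invSection (fibreInclusion P.proj p)) (ht' ▸ mem_preferredChart _) ξ
    rw [ht, MixedSpace.frame_toJet] at h2
    exact h2
  have hi : MDifferentiableAt 𝓘(ℝ, DualFibre n m l) (mixedModel n m l)
      (hL.invSection ∘ fibreInclusion P.proj) P.momenta :=
    (hL.contMDiff_invSection.comp (contMDiff_fibreInclusion P.proj)).mdifferentiable (by simp)
      P.momenta
  have hc : MDifferentiableAt (mixedModel n m l)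
      𝓘(ℝ, JetModel n m (l + 1) × DualFibre n m l)
      (extChartAt (mixedModel n m l) (hL.invSection P)) (hL.invSection P) :=
    mdifferentiableAt_extChartAt (mem_chart_source _ _)
  have hσd : DifferentiableAt ℝ σ P.momenta := (hc.comp P.momenta hi).differentiableAt
  have hσ' : fderiv ℝ σ P.momenta = hL.sectionDeriv P ∘L .inr ℝ _ _ := by
    have h2 := modelDeriv_comp P.momenta hc hi
    have h3 := modelDeriv_comp P.momenta (hL.contMDiff_invSection.mdifferentiable (by simp) P)
      ((contMDiff_fibreInclusion P.proj).mdifferentiable (by simp) P.momenta)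
    rw [h3, modelDeriv_fibreInclusion] at h2
    have h4 : modelDeriv (mixedModel n m l) 𝓘(ℝ, JetModel n m (l + 1) × DualFibre n m l)
        (extChartAt (mixedModel n m l) (hL.invSection P)) (hL.invSection P) = .id ℝ _ :=
      modelDeriv_extChartAt_self _
    rw [← modelDeriv_eq_fderiv]
    exact h2.trans (congrArg (· ∘L _) h4)
  have h2 := (L.differentiableAt_coordMomentum (hL.invSection P)).hasFDerivAt
  have h3 : HasFDerivAt (L.coordMomentum (hL.invSection P).proj ∘ σ)
      (fderiv ℝ (L.coordMomentum (hL.invSection P).proj)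
        (extChartAt (mixedModel n m l) (hL.invSection P) (hL.invSection P)) ∘L
          fderiv ℝ σ P.momenta) P.momenta :=
    HasFDerivAt.comp (f := σ) P.momenta h2 hσd.hasFDerivAt
  have h4 : fderiv ℝ (L.coordMomentum (hL.invSection P).proj)
      (extChartAt (mixedModel n m l) (hL.invSection P) (hL.invSection P)) ∘L fderiv ℝ σ P.momenta =
      exteriorOfDual (cartan (hL.legInv P)) := by
    refine ContinuousLinearMap.ext fun p => ?_
    rw [hσ']
    have h5 := L.fderiv_coordMomentum_of_mem (hL.invSection_mem P)
      (hL.toJetDeriv_sectionDeriv P (0, p))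
    rw [hL.sectionDeriv_snd] at h5
    exact h5
  rw [h4] at h3
  rw [funext h1]
  exact h3

end LagrangianDensity.IsHyperregular
end Legendre

end JetLegendre

end

/-! ### The theorem -/

open JetLegendre
theorem mainTheorem7 {n m l : ℕ} {M E F : Type*}
    [TopologicalSpace M] [ChartedSpace (BaseModel n) M] [IsManifold (𝓡 (n + 1)) ∞ M]
    [TopologicalSpace E] [ChartedSpace (EuclideanSpace ℝ (Fin (n + 1 + m))) E]
    [IsManifold (𝓡 (n + 1 + m)) ∞ E]
    [TopologicalSpace F] [ChartedSpace (FibreModel m) F] [IsManifold (𝓡 m) ∞ F]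
    (π : SmoothFiberBundle n m M E F) (L : LagrangianDensity π (l + 1))
    (hL : L.IsHyperregular) :
    -- `Ker ω|_P` is non-empty, and `𝔽𝓗(P)` may be computed from any of its elements
    (∀ P : DualJet π l, (hL.ker P).Nonempty ∧
      ∀ z ∈ hL.ker P, tau0Jet z = hL.fiberDerivative P) ∧
    -- `𝔽𝓗` is a map over `J^l`, and it is the fibre derivative of the section `𝓗`
    (∀ P : DualJet π l, (hL.fiberDerivative P).point = P.proj ∧
      HasFDerivAt (𝕜 := ℝ) (E := DualFibre n m l) (F := JetModel n m l [⋀^Fin (n + 1)]→L[ℝ] ℝ)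
        (fun p => hL.hamiltonian ⟨P.proj, p⟩) (exteriorOfDual (hL.fiberDerivative P)) P.2) ∧
    -- the diagram commutes
    hL.fiberDerivative = cartan ∘ hL.legInv ∧
    -- `𝔽𝓗` takes values in the image of `𝒞` and factors uniquely through `J^{l+1}`
    range hL.fiberDerivative ⊆ range (cartan (π := π) (l := l)) ∧
    (∃! g : DualJet π l → Jet π (l + 1), hL.fiberDerivative = cartan ∘ g) := by
  have h3 : hL.fiberDerivative = cartan ∘ hL.legInv := funext hL.fiberDerivative_eq
  refine ⟨fun P => ⟨hL.ker_nonempty P, fun z hz => ?_⟩, fun P => ⟨?_, ?_⟩, h3, ?_, hL.legInv, h3,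
    fun g hg => ?_⟩
  · rw [hL.tau0Jet_eq P hz, hL.fiberDerivative_eq]
  · rw [hL.fiberDerivative_eq]
    exact hL.toJet_invSection P
  · rw [hL.fiberDerivative_eq]
    -- The Hamiltonian section is `totalMomentum` along 𝔰, and the point of J† over the same l-jet
    -- with momenta p is `fibreInclusion` at p.
    exact hL.hasFDerivAt_totalMomentum P
  · rw [h3]
    exact range_comp_subset_range _ _
  · exact funext fun P => cartan_injective (congrFun (hg.symm.trans h3) P)
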